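/- Let $a_1,\dots,a_4\ge 0$ be integers and let $(b_1,\dots,b_4)$ be a permutation of $(1,1,1,2)$ with $a_1/b_1\le a_2/b_2\le a_3/b_3\le a_4/b_4$. Let $(\mathbb C^*)^2$ act on $\mathbb C[u,v,x_1,x_2,x_3,x_4]$ with weights $$\begin{pmatrix}1&1&-a_1&-a_2&-a_3&-a_4\\0&0&b_1&b_2&b_3&b_4\end{pmatrix},$$ and let $\mathcal F=(\mathbb C^6\setminus V(I))/(\mathbb C^*)^2$, where $I=(u,v)\cap(x_1,x_2,x_3,x_4)$ (a $\mathbb P(1,1,1,2)$-bundle over $\mathbb P^1$). Let $X=(F=0)\subset\mathcal F$ be a hypersurface with at most finitely many singular points (for example, with terminal singularities), where $F$ is an irreducible polynomial, homogeneous of bidegree $(\omega,4)$ for some $\omega\in\mathbb Z$. Suppose that $F=x_3f-x_4g$ for some polynomials $f,g$, so that $X$ is given by $x_3f=x_4g$ and $D=(x_3=x_4=0)$ is a prime Weil divisor on $X$. Then: 1. if $D$ is $\mathbb Q$-Cartier (in particular, if $X$ is $\mathbb Q$-factorial), then the Picard number $\rho_X$, i.e. the rank of the group $N^1(X)$ of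 Cartier divisors on $X$ modulo numerical equivalence, is at least $3$; 2. in any case, the Picard group of the nonsingular locus of $X$ (which is the group of Weil divisors on $X$ modulo linear equivalence) has rank at least $3$. -/

import Mathlib

open MvPolynomial

noncomputable section

/-- The Cox ring `ℂ[u, v, x₁, x₂, x₃, x₄]`: the variables `u, v` are `X (inl 0), X (inl 1)` and
`x₁, …, x₄` are `X (inr 0), …, X (inr 3)`. -/
abbrev Cox : Type := MvPolynomial (Fin 2 ⊕ Fin 4) ℂ

/-- The numerical data of a `ℙ(1,1,1,2)`-bundle over `ℙ¹`, i.e. of the weight matrix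
`(1 1 -a₁ -a₂ -a₃ -a₄ ; 0 0 b₁ b₂ b₃ b₄)` with `aᵢ ≥ 0`, `{b₁,…,b₄} = {1,1,1,2}`, and the
variables ordered by decreasing ratio weight `-aᵢ/bᵢ`. -/
structure ScrollData where
  a : Fin 4 → ℕ
  b : Fin 4 → ℕ
  weights : ∃ t : Fin 4, ∀ i, b i = if i = t then 2 else 1
  ordered : ∀ i j, i ≤ j → a i * b j ≤ a j * b i

namespace ScrollData

variable (W : ScrollData)

/-- The bidegrees of the Cox variables. -/
def wt : Fin 2 ⊕ Fin 4 → ℤ × ℤ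
  | Sum.inl _ => (1, 0)
  | Sum.inr i => (-(W.a i : ℤ), (W.b i : ℤ))

/-- `f` is bihomogeneous of bidegree `d` (the zero polynomial is so for every `d`). -/
def IsBihom (f : Cox) (d : ℤ × ℤ) : Prop := IsWeightedHomogeneous W.wt f d

/-- The complement in `ℂ⁶` of the zero locus of the irrelevant ideal `(u,v) ∩ (x₁,x₂,x₃,x₄)`. -/
def Stable (_W : ScrollData) : Type :=
  {p : Fin 2 ⊕ Fin 4 → ℂ // (∃ j, p (Sum.inl j) ≠ 0) ∧ ∃ i, p (Sum.inr i) ≠ 0}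

/-- Two stable vectors are equivalent if they lie in one orbit of the torus `(ℂˣ)²` acting with
the given weights. -/
def torusRel (p q : W.Stable) : Prop :=
  ∃ s t : ℂˣ, ∀ k, q.1 k = ((s ^ (W.wt k).1 * t ^ (W.wt k).2 : ℂˣ) : ℂ) * p.1 k

instance torusSetoid : Setoid W.Stable where
  r := W.torusRel
  iseqv := by
    refine ⟨fun p => ⟨1, 1, fun k => by simp⟩, ?_, ?_⟩
    · rintro p q ⟨s, t, h⟩
      refine ⟨s⁻¹, t⁻¹, fun k => ?_⟩
      rw [h k, ← mul_assoc, ← Units.val_mul]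
      simp [mul_mul_mul_comm]
    · rintro p q r ⟨s, t, h⟩ ⟨s', t', h'⟩
      refine ⟨s' * s, t' * t, fun k => ?_⟩
      rw [h' k, h k, ← mul_assoc, ← Units.val_mul, mul_zpow, mul_zpow]
      congr 2
      exact mul_mul_mul_comm _ _ _ _

/-- The (closed) points of the toric variety `𝓕 = (ℂ⁶ ∖ V(I)) / (ℂˣ)²`. -/
def Point : Type := Quotient W.torusSetoid

variable {W} in
/-- A choice of homogeneous coordinates of a point of `𝓕`. Below, only the vanishing of
bihomogeneous polynomials at these coordinates is used, which does not depend on the choice. -/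
def Point.coords (x : W.Point) : Fin 2 ⊕ Fin 4 → ℂ := (Quotient.out x).1

/-- The irrelevant ideal `(u,v) ∩ (x₁,x₂,x₃,x₄)`. -/
def irrelevantIdeal : Ideal Cox :=
  Ideal.span (Set.range fun j : Fin 2 => (X (Sum.inl j) : Cox)) ⊓
    Ideal.span (Set.range fun i : Fin 4 => (X (Sum.inr i) : Cox))

/-- An irreducible closed subvariety of `𝓕`, given by its bihomogeneous prime ideal in the Cox
ring. -/
structure Subvariety where
  ideal : Ideal Cox
  prime : ideal.IsPrime
  bihom : ∀ f ∈ ideal, ∀ d : ℤ × ℤ, weightedHomogeneousComponent W.wt d f ∈ ideal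
  relevant : ¬ irrelevantIdeal ≤ ideal

namespace Subvariety

variable {W} (V : W.Subvariety)

instance isPrime_ideal : V.ideal.IsPrime := V.prime

/-- The fraction field of the bigraded coordinate ring of `V`. -/
abbrev Frac : Type := FractionRing (Cox ⧸ V.ideal)

/-- The restriction to `V` of the fraction `a / b`. -/
def frac (a b : Cox) : V.Frac :=
  algebraMap (Cox ⧸ V.ideal) V.Frac (Ideal.Quotient.mk V.ideal a) /
    algebraMap (Cox ⧸ V.ideal) V.Frac (Ideal.Quotient.mk V.ideal b)

/-- The restrictions to `V` of the fractions `a / b`, where `a` and `b` are bihomogeneous of the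
same bidegree and `b` is outside the prime ideal `Q ⊇ I(V)`. -/
def fractionsAt (Q : Ideal Cox) (hQ : Q.IsPrime) (hV : V.ideal ≤ Q) : Subalgebra ℂ V.Frac where
  carrier := {z | ∃ (d : ℤ × ℤ) (a b : Cox),
    W.IsBihom a d ∧ W.IsBihom b d ∧ b ∉ Q ∧ z = V.frac a b}
  mul_mem' := by
    rintro _ _ ⟨d, a, b, ha, hb, hbQ, rfl⟩ ⟨e, a', b', ha', hb', hbQ', rfl⟩
    refine ⟨d + e, a * a', b * b', ha.mul ha', hb.mul hb', fun h => ?_, ?_⟩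
    · exact (hQ.mem_or_mem h).elim hbQ hbQ'
    · simp only [frac, map_mul]
      exact div_mul_div_comm _ _ _ _
  add_mem' := by
    rintro _ _ ⟨d, a, b, ha, hb, hbQ, rfl⟩ ⟨e, a', b', ha', hb', hbQ', rfl⟩
    have key : ∀ c : Cox, c ∉ Q →
        algebraMap (Cox ⧸ V.ideal) V.Frac (Ideal.Quotient.mk V.ideal c) ≠ 0 := by
      intro c hc h0
      rw [IsFractionRing.to_map_eq_zero_iff, Ideal.Quotient.eq_zero_iff_mem] at h0
      exact hc (hV h0)
    refine ⟨d + e, a * b' + b * a', b * b', ?_, hb.mul hb', fun h => ?_, ?_⟩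
    · exact (weightedHomogeneousSubmodule ℂ W.wt (d + e)).add_mem (ha.mul hb') (hb.mul ha')
    · exact (hQ.mem_or_mem h).elim hbQ hbQ'
    · simp only [frac, map_mul, map_add]
      exact div_add_div _ _ (key b hbQ) (key b' hbQ')
  algebraMap_mem' := by
    intro c
    refine ⟨0, C c, 1, isWeightedHomogeneous_C _ c, isWeightedHomogeneous_one _ _,
      fun h => hQ.ne_top ((Ideal.eq_top_iff_one _).2 h), ?_⟩
    simp only [frac, map_one, div_one]
    rfl

/-- The field of rational functions on `V`: quotients of bihomogeneous elements of the same
bidegree. -/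
def functionField : Subalgebra ℂ V.Frac := V.fractionsAt V.ideal V.prime le_rfl

/-- The dimension of `V`, as the transcendence degree of its function field. -/
def dim : Cardinal := Algebra.trdeg ℂ V.functionField

/-- The (closed) points of `V`. -/
def Pt : Type := {x : W.Point // ∀ f ∈ V.ideal, eval x.coords f = 0}

variable {V} in
/-- The bihomogeneous polynomial `h` does not vanish at the point `p`. -/
def Pt.NonvanishingAt (p : V.Pt) (h : Cox) : Prop := eval p.1.coords h ≠ 0

/-- The local ring `𝒪_{V,p}` of `V` at the point `p`, inside the function field of `V`. -/
def localRing (p : V.Pt) : Subalgebra ℂ V.Frac :=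
  V.fractionsAt (RingHom.ker (eval p.1.coords)) (RingHom.ker_isPrime _) p.2

/-- The nonsingular locus of `V`. -/
def regularLocus : Set V.Pt := {p | IsRegularLocalRing (V.localRing p)}

/-- The rational function `c` is a unit of the local ring at `p`. -/
def IsUnitAt (p : V.Pt) (c : (V.functionField)ˣ) : Prop :=
  ((c : V.functionField) : V.Frac) ∈ V.localRing p ∧
    ((c⁻¹ : (V.functionField)ˣ) : V.functionField).1 ∈ V.localRing p

variable {V} in
theorem IsUnitAt.one (p : V.Pt) : V.IsUnitAt p 1 := by
  constructor
  · simp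
  · simp

variable {V} in
theorem IsUnitAt.mul {p : V.Pt} {c d : (V.functionField)ˣ} (hc : V.IsUnitAt p c)
    (hd : V.IsUnitAt p d) : V.IsUnitAt p (c * d) := by
  constructor
  · simpa using (V.localRing p).mul_mem hc.1 hd.1
  · simpa using (V.localRing p).mul_mem hd.2 hc.2

variable {V} in
theorem IsUnitAt.inv {p : V.Pt} {c : (V.functionField)ˣ} (hc : V.IsUnitAt p c) :
    V.IsUnitAt p c⁻¹ := ⟨hc.2, by simpa using hc.1⟩

/-- Cartier divisors on the open subset `U` of `V`, given by a local equation `φ p` at every point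
`p ∈ U`: every `p ∈ U` has a Zariski neighbourhood `{h ≠ 0}` in `U` at all of whose points `q` the
function `φ p` is also a local equation. The values of `φ` outside `U` are irrelevant, and two such
`φ` give the same divisor if they differ by a unit of the local ring at every point of `U`. -/
def cartier (U : Set V.Pt) : Subgroup (V.Pt → (V.functionField)ˣ) where
  carrier := {φ | ∀ p ∈ U, ∃ (d : ℤ × ℤ) (h : Cox), W.IsBihom h d ∧ p.NonvanishingAt h ∧
    ∀ q ∈ U, q.NonvanishingAt h → V.IsUnitAt q (φ q / φ p)}
  one_mem' := fun p _ => ⟨0, 1, isWeightedHomogeneous_one _ _, by simp [Pt.NonvanishingAt],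
    fun q _ _ => by simpa using IsUnitAt.one q⟩
  mul_mem' := by
    intro φ ψ hφ hψ p hp
    obtain ⟨d, h, hh, hp1, H⟩ := hφ p hp
    obtain ⟨e, k, hk, hp2, K⟩ := hψ p hp
    refine ⟨d + e, h * k, hh.mul hk, ?_, fun q hq hq1 => ?_⟩
    · simp only [Pt.NonvanishingAt, map_mul]
      exact mul_ne_zero hp1 hp2
    · simp only [Pt.NonvanishingAt, map_mul] at hq1
      have := (H q hq (left_ne_zero_of_mul hq1)).mul (K q hq (right_ne_zero_of_mul hq1))
      rwa [div_mul_div_comm] at this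
  inv_mem' := by
    intro φ hφ p hp
    obtain ⟨d, h, hh, hp1, H⟩ := hφ p hp
    refine ⟨d, h, hh, hp1, fun q hq hq1 => ?_⟩
    have := (H q hq hq1).inv
    rwa [inv_div, ← inv_div_inv] at this

/-- Principal Cartier divisors on `U`: a single rational function is a local equation at every
point of `U`. -/
def principal (U : Set V.Pt) : Subgroup (V.Pt → (V.functionField)ˣ) where
  carrier := {φ | ∃ c : (V.functionField)ˣ, ∀ p ∈ U, V.IsUnitAt p (φ p / c)}
  one_mem' := ⟨1, fun p _ => by simpa using IsUnitAt.one p⟩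
  mul_mem' := by
    rintro φ ψ ⟨c, hc⟩ ⟨d, hd⟩
    refine ⟨c * d, fun p hp => ?_⟩
    have := (hc p hp).mul (hd p hp)
    rwa [div_mul_div_comm] at this
  inv_mem' := by
    rintro φ ⟨c, hc⟩
    refine ⟨c⁻¹, fun p hp => ?_⟩
    have := (hc p hp).inv
    rwa [inv_div, ← inv_div_inv] at this

/-- The Picard group of the open subset `U` of `V`: Cartier divisors on `U` modulo linear
equivalence. -/
abbrev Pic (U : Set V.Pt) : Type := V.cartier U ⧸ (V.principal U).subgroupOf (V.cartier U)

instance commGroupPic (U : Set V.Pt) : CommGroup (V.Pic U) :=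
  QuotientGroup.Quotient.commGroup ((V.principal U).subgroupOf (V.cartier U))

section Intersection

variable (C : W.Subvariety)

/-- The restriction to the subvariety `C ⊆ V` of a rational function `ψ` on `V` that is defined at
the generic point of `C`: if `ψ = a / b` with `b ∉ I(C)`, it is the restriction of `a / b`. -/
def restrict (ψ : V.Frac) : C.Frac :=
  Classical.epsilon fun χ : C.Frac => ∃ (d : ℤ × ℤ) (a b : Cox),
    W.IsBihom a d ∧ W.IsBihom b d ∧ b ∉ C.ideal ∧ ψ = V.frac a b ∧ χ = C.frac a b

/-- The order at the point `p` of a curve `C` of a nonzero rational function `χ = α / β`, where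
`α, β ∈ 𝒪_{C,p}` are nonzero: `length (𝒪_{C,p} / α) - length (𝒪_{C,p} / β)`. -/
def ordAt (p : C.Pt) (χ : C.Frac) : ℤ :=
  Classical.epsilon fun n : ℤ => ∃ α β : C.localRing p, α ≠ 0 ∧ β ≠ 0 ∧
    χ * (β : C.Frac) = (α : C.Frac) ∧
    n = ((Ring.ord (C.localRing p) α).toNat : ℤ) - ((Ring.ord (C.localRing p) β).toNat : ℤ)

variable {V C} in
/-- A point of `C ⊆ V`, as a point of `V`. -/
def Pt.incl (hC : V.ideal ≤ C.ideal) (p : C.Pt) : V.Pt := ⟨p.1, fun f hf => p.2 f (hC hf)⟩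

/-- The intersection number of a Cartier divisor `φ` on `V` with a curve `C ⊆ V`: the degree of the
restriction to `C` of the linearly equivalent divisor `φ / φ p₀`, `p₀ ∈ C`, whose support does not
contain `C`. -/
def intersectionNumber (hC : V.ideal ≤ C.ideal) (p₀ : C.Pt)
    (φ : V.Pt → (V.functionField)ˣ) : ℤ :=
  ∑ᶠ p : C.Pt, C.ordAt p
    (V.restrict C ((φ (p.incl hC) / φ (p₀.incl hC) : (V.functionField)ˣ) : V.functionField).1)

end Intersection

/-- A Cartier divisor is numerically trivial if its intersection number with every curve is
zero. -/
def NumTrivial (φ : V.cartier Set.univ) : Prop :=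
  ∀ (C : W.Subvariety) (hC : V.ideal ≤ C.ideal), C.dim = 1 →
    ∀ p₀ : C.Pt, V.intersectionNumber C hC p₀ φ.1 = 0

/-- `N¹(V)`: Cartier divisors modulo numerical equivalence, i.e. modulo the subgroup of the
numerically trivial ones. -/
abbrev N1 : Type := V.cartier Set.univ ⧸ Subgroup.closure {φ | V.NumTrivial φ}

instance commGroupN1 : CommGroup V.N1 :=
  QuotientGroup.Quotient.commGroup (Subgroup.closure {φ | V.NumTrivial φ})

/-- The Picard number of `V`, the rank of `N¹(V)`. -/
def picardNumber : Cardinal := Module.rank ℤ (Additive V.N1)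

/-- The ideal in `𝒪_{V,p}` of the closed subscheme of `V` cut out by the bihomogeneous ideal
`J`. -/
def idealAt (J : Ideal Cox) (p : V.Pt) : Ideal (V.localRing p) :=
  Ideal.span {z | ∃ (d : ℤ × ℤ) (a b : Cox), W.IsBihom a d ∧ W.IsBihom b d ∧ a ∈ J ∧
    p.NonvanishingAt b ∧ (z : V.Frac) = V.frac a b}

/-- Let `V` be normal and let `J` be the ideal of a prime divisor `D` of `V`. Then `D` is
`ℚ`-Cartier: for some `m ≥ 1` the Weil divisor `m D` is Cartier. A Cartier divisor `φ` on `V` equals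
`m D` if and only if it does so on the nonsingular locus (whose complement has codimension at least
two), where it means that `φ p` generates the `m`-th power of the ideal of `D`. -/
def IsQCartier (J : Ideal Cox) : Prop :=
  ∃ m : ℕ, 0 < m ∧ ∃ φ ∈ V.cartier Set.univ, ∀ p ∈ V.regularLocus,
    ∃ z : V.localRing p, (z : V.Frac) = ((φ p : V.functionField) : V.Frac) ∧
      V.idealAt J p ^ m = Ideal.span {z}

end Subvariety

end ScrollData

end

/-!
# Picard numbers of hypersurfaces in `ℙ(1,1,1,2)`-bundles over `ℙ¹`

In the comments `u, v` are the variables `X (inl 0)`, `X (inl 1)`, and `xᵢ` is `X (inr i)` for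
`i = 0, 1, 2, 3`. Let `t` be the index with `b_t = 2`.

Three explicit divisors are separated by their intersection numbers with three smooth rational
curves in the nonsingular locus of `V`. The curves being there, the same three numbers are
homomorphisms on Cartier divisors on all of `V` and on Cartier divisors on the nonsingular locus.
Both quotients in question, `N¹(V)` and `Pic` of the nonsingular locus, therefore have rank at
least `3` once the `3 × 3` matrix of intersection numbers is nonsingular
(`three_le_rank_of_homs`).

The singularities of `V` enter in two ways. `V` is singular wherever all the partial derivatives of
its equation vanish (`Subvariety.not_isRegularLocalRing_of_pderiv_eq_zero`), and at every point
where all `xᵢ` with `i ≠ t` vanish (`Subvariety.not_isRegularLocalRing_of_vertex`), as `𝓕` has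
transversal `ℂ³ / ±1` singularities there; in both cases the embedding dimension exceeds the
dimension. As there are only finitely many singular points, some fibre `v = τ u` has none. Hence
the point `x_t = 1` of this fibre is not on `V`. As `V` contains the surface `x₂ = x₃ = 0`, this
shows that `{2, 3} = {t, l}` for some `l`; write the equation as `x_t A = x_l B`. The form `A` has
degree `2` in the `xᵢ`, and `x_t` occurs in it on the fibre. At nonsingular points of the surface
`D = (x_t = x_l = 0)` the forms `A` and `B` have no common zero.

The curves are
* the line `x_t = x_l = 0` in the fibre `v = τ u`;
* the conic `A = x_l = 0` in the same fibre, which differs from the line since otherwise the zeros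
  of the cubic form `B` on the line would be singular points of `V`
  (`Subvariety.IsHypersurface.exists_conic`);
* a general section `x₀ = c (v - τ u)ⁿ x₁` of the surface `D` over `ℙ¹`.

The divisors are those of `𝒪(1,0)`, of `𝒪(0,2)`, and `D`, or a Cartier multiple of `D` on all of
`V`. On the line and the conic, `𝒪(1,0)` has degree `0` and `𝒪(0,2)` has positive degree. The local
equation of `D` is `x_l / A = x_t / B`, so the normal bundle of `D` restricts to the line as
`𝒪(-1)`, while `D` has nonnegative degree on the conic, which it does not contain. Finally `𝒪(1,0)`
has degree `1` on the section.

The curves are handled through their parametrizations (`RatCurve`): a form of bidegree `d` restricts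
to a polynomial with `deg d` zeros on `ℙ¹` (`RatCurve.sum_rootMultiplicity`), the order `ordAt` of a
fraction at a point is the difference of the multiplicities of the zeros
(`Subvariety.IsLocalParam.ordAt_frac`), and so intersection numbers are additive, vanish on
principal divisors, and are computed by degrees of forms (`RatCurve.degree_eq_of_ratio`).
-/

noncomputable section

namespace ScrollData

variable {W : ScrollData}

/-! ### Bihomogeneous polynomials -/

theorem isBihom_X (k : Fin 2 ⊕ Fin 4) : W.IsBihom (X k) (W.wt k) := isWeightedHomogeneous_X ℂ W.wt k

theorem IsBihom.congr {a : Cox} {d e : ℤ × ℤ} (ha : W.IsBihom a d) (h : d = e) : W.IsBihom a e :=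
  h ▸ ha

/-- Rescaling the variables by a character `c` of the torus multiplies the value of a
bihomogeneous polynomial of bidegree `d` by `c d`. -/
theorem IsBihom.aeval_mul {A : Type*} [CommRing A] [Algebra ℂ A] {c : ℤ × ℤ → A} (hc0 : c 0 = 1)
    (hc : ∀ d e, c (d + e) = c d * c e) (z : Fin 2 ⊕ Fin 4 → A) {a : Cox} {d : ℤ × ℤ}
    (ha : W.IsBihom a d) : aeval (fun k => c (W.wt k) * z k) a = c d * aeval z a := by
  have hpow : ∀ (n : ℕ) (e : ℤ × ℤ), c (n • e) = c e ^ n := by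
    intro n e
    induction n with
    | zero => simp [hc0]
    | succ n ih => rw [succ_nsmul, hc, ih, pow_succ]
  simp only [aeval_def, eval₂_eq, Finset.mul_sum]
  refine Finset.sum_congr rfl fun s hs => ?_
  have hd : Finsupp.weight W.wt s = d := ha (mem_support_iff.1 hs)
  have : c d = ∏ k ∈ s.support, c (W.wt k) ^ s k := by
    rw [← hd, Finsupp.weight_apply, Finsupp.sum]
    induction s.support using Finset.induction_on with
    | empty => simp [hc0]
    | insert k t hk ih => rw [Finset.sum_insert hk, Finset.prod_insert hk, hc, ih, hpow]
  rw [this, mul_left_comm, ← Finset.prod_mul_distrib]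
  simp only [mul_pow]

theorem IsBihom.eval_torus (s t : ℂˣ) (z : Fin 2 ⊕ Fin 4 → ℂ) {a : Cox} {d : ℤ × ℤ}
    (ha : W.IsBihom a d) :
    eval (fun k => ((s ^ (W.wt k).1 * t ^ (W.wt k).2 : ℂˣ) : ℂ) * z k) a =
      ((s ^ d.1 * t ^ d.2 : ℂˣ) : ℂ) * eval z a := by
  have := ha.aeval_mul (c := fun e => ((s ^ e.1 * t ^ e.2 : ℂˣ) : ℂ)) (by simp)
    (fun d e => by
      rw [← Units.val_mul]
      congr 1
      simp only [Prod.fst_add, Prod.snd_add, zpow_add]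
      exact mul_mul_mul_comm _ _ _ _) z
  simpa [MvPolynomial.coe_aeval_eq_eval] using this

theorem sum_component (f : Cox) : ∃ s : Finset (ℤ × ℤ),
    f = ∑ d ∈ s, weightedHomogeneousComponent W.wt d f := by
  have hfin : (Function.support fun d => weightedHomogeneousComponent W.wt d f).Finite :=
    weightedHomogeneousComponent_finsupp f
  refine ⟨hfin.toFinset, ?_⟩
  conv_lhs => rw [← sum_weightedHomogeneousComponent W.wt f]
  exact finsum_eq_sum_of_support_subset _ (by rw [Set.Finite.coe_toFinset])

theorem isBihom_component (f : Cox) (d : ℤ × ℤ) :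
    W.IsBihom (weightedHomogeneousComponent W.wt d f) d :=
  weightedHomogeneousComponent_isWeightedHomogeneous d f

theorem component_self {f : Cox} {d : ℤ × ℤ} (hf : W.IsBihom f d) :
    weightedHomogeneousComponent W.wt d f = f :=
  weightedHomogeneousComponent_eq_self hf

/-- Taking components commutes with multiplication by a bihomogeneous polynomial. -/
theorem component_mul {f : Cox} {d : ℤ × ℤ} (hf : W.IsBihom f d) (g : Cox) (e : ℤ × ℤ) :
    weightedHomogeneousComponent W.wt (d + e) (f * g) =
      f * weightedHomogeneousComponent W.wt e g := by
  obtain ⟨s, hs⟩ := sum_component (W := W) g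
  have key : ∀ i, weightedHomogeneousComponent W.wt (d + e)
      (f * weightedHomogeneousComponent W.wt i g) =
      f * weightedHomogeneousComponent W.wt e (weightedHomogeneousComponent W.wt i g) := by
    intro i
    have h1 : W.IsBihom (f * weightedHomogeneousComponent W.wt i g) (d + i) :=
      IsWeightedHomogeneous.mul hf (isBihom_component g i)
    by_cases h : i = e
    · subst h
      rw [component_self h1, component_self (isBihom_component g i)]
    · rw [IsWeightedHomogeneous.weightedHomogeneousComponent_ne _ h1
          (fun h' => h (add_left_cancel h').symm),
        IsWeightedHomogeneous.weightedHomogeneousComponent_ne _ (isBihom_component g i) (Ne.symm h),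
        mul_zero]
  conv_lhs => rw [hs]
  conv_rhs => rw [hs]
  simp only [Finset.mul_sum, map_sum, key]

theorem eval_eq_zero_of_components {z : Fin 2 ⊕ Fin 4 → ℂ} {f : Cox}
    (h : ∀ d, eval z (weightedHomogeneousComponent W.wt d f) = 0) : eval z f = 0 := by
  obtain ⟨s, hs⟩ := sum_component (W := W) f
  rw [hs, map_sum]
  exact Finset.sum_eq_zero fun d _ => h d

/-- A bihomogeneous element of a principal ideal with bihomogeneous generator is a bihomogeneous
multiple of the generator. -/
theorem exists_bihom_of_mem_span_singleton {F a : Cox} {d e : ℤ × ℤ} (hF : W.IsBihom F d)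
    (ha : W.IsBihom a e) (h : a ∈ Ideal.span {F}) : ∃ q, W.IsBihom q (e - d) ∧ a = F * q := by
  obtain ⟨q, rfl⟩ := Ideal.mem_span_singleton'.1 h
  refine ⟨weightedHomogeneousComponent W.wt (e - d) q, isBihom_component _ _, ?_⟩
  rw [← component_mul hF, add_sub_cancel, mul_comm F, component_self ha]

theorem exists_bihom_of_mem_span_pair {k l : Fin 2 ⊕ Fin 4} {a : Cox} {e : ℤ × ℤ}
    (ha : W.IsBihom a e) (h : a ∈ Ideal.span {(X k : Cox), X l}) :
    ∃ q r, W.IsBihom q (e - W.wt k) ∧ W.IsBihom r (e - W.wt l) ∧ a = X k * q + X l * r := by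
  obtain ⟨q, r, rfl⟩ := Ideal.mem_span_pair.1 h
  refine ⟨weightedHomogeneousComponent W.wt (e - W.wt k) q,
    weightedHomogeneousComponent W.wt (e - W.wt l) r, isBihom_component _ _,
    isBihom_component _ _, ?_⟩
  rw [← component_mul (isBihom_X k), ← component_mul (isBihom_X l), add_sub_cancel, add_sub_cancel,
    mul_comm (X k), mul_comm (X l), ← map_add, component_self ha]

/-! ### Points -/

/-- The homogeneous coordinates of a point are determined up to the torus. -/
theorem Point.exists_coords_mk (γ : W.Stable) : ∃ s t : ℂˣ, ∀ k,
    Point.coords (W := W) (Quotient.mk _ γ) k =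
      ((s ^ (W.wt k).1 * t ^ (W.wt k).2 : ℂˣ) : ℂ) * γ.1 k := by
  have h : W.torusRel γ (Quotient.out (Quotient.mk W.torusSetoid γ)) :=
    Setoid.symm (Quotient.mk_out (s := W.torusSetoid) γ)
  exact h

theorem Point.eval_coords_mk (γ : W.Stable) {a : Cox} {d : ℤ × ℤ} (ha : W.IsBihom a d) :
    eval (Point.coords (W := W) (Quotient.mk _ γ)) a = 0 ↔ eval γ.1 a = 0 := by
  obtain ⟨s, t, h⟩ := Point.exists_coords_mk γ
  rw [funext h, ha.eval_torus]
  exact mul_eq_zero_iff_left (Units.ne_zero _)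

namespace Subvariety

variable (V : W.Subvariety)

/-- The restriction of polynomials to `V`, with values in the fraction field. -/
def toFrac : Cox →ₐ[ℂ] V.Frac :=
  (IsScalarTower.toAlgHom ℂ (Cox ⧸ V.ideal) V.Frac).comp (Ideal.Quotient.mkₐ ℂ V.ideal)

theorem frac_def (a b : Cox) : V.frac a b = V.toFrac a / V.toFrac b := rfl

variable {V}

theorem toFrac_eq_zero {a : Cox} : V.toFrac a = 0 ↔ a ∈ V.ideal := by
  rw [← Ideal.Quotient.eq_zero_iff_mem]
  exact IsFractionRing.to_map_eq_zero_iff (R := Cox ⧸ V.ideal) (K := V.Frac)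

theorem toFrac_ne_zero {a : Cox} : V.toFrac a ≠ 0 ↔ a ∉ V.ideal := toFrac_eq_zero.not

theorem frac_eq_frac {a b a' b' : Cox} (hb : b ∉ V.ideal) (hb' : b' ∉ V.ideal) :
    V.frac a b = V.frac a' b' ↔ a * b' - a' * b ∈ V.ideal := by
  rw [frac_def, frac_def, div_eq_div_iff (toFrac_ne_zero.2 hb) (toFrac_ne_zero.2 hb'),
    ← sub_eq_zero, ← map_mul, ← map_mul, ← map_sub, toFrac_eq_zero]

theorem frac_mul_frac (a b a' b' : Cox) :
    V.frac a b * V.frac a' b' = V.frac (a * a') (b * b') := by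
  simp only [frac_def, map_mul, div_mul_div_comm]

theorem inv_frac (a b : Cox) : (V.frac a b)⁻¹ = V.frac b a := by
  simp only [frac_def, inv_div]

theorem mul_notMem {a b : Cox} (ha : a ∉ V.ideal) (hb : b ∉ V.ideal) : a * b ∉ V.ideal :=
  fun h => (V.prime.mem_or_mem h).elim ha hb

theorem notMem_of_eval_ne_zero (p : V.Pt) {a : Cox} (h : eval p.1.coords a ≠ 0) : a ∉ V.ideal :=
  fun ha => h (p.2 a ha)

theorem mem_localRing {p : V.Pt} {z : V.Frac} : z ∈ V.localRing p ↔ ∃ (d : ℤ × ℤ) (a b : Cox),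
    W.IsBihom a d ∧ W.IsBihom b d ∧ eval p.1.coords b ≠ 0 ∧ z = V.frac a b := Iff.rfl

/-- A quotient of two bihomogeneous polynomials of the same bidegree outside `I(V)`, as a nonzero
rational function. -/
def mkUnit (a b : Cox) {d : ℤ × ℤ} (ha : W.IsBihom a d) (hb : W.IsBihom b d) (ha' : a ∉ V.ideal)
    (hb' : b ∉ V.ideal) : (V.functionField)ˣ where
  val := ⟨V.frac a b, d, a, b, ha, hb, hb', rfl⟩
  inv := ⟨V.frac b a, d, b, a, hb, ha, ha', rfl⟩
  val_inv := by
    ext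
    simp only [MulMemClass.mk_mul_mk, frac_def, OneMemClass.coe_one]
    rw [div_mul_div_cancel₀ (toFrac_ne_zero.2 hb'), div_self (toFrac_ne_zero.2 ha')]
  inv_val := by
    ext
    simp only [MulMemClass.mk_mul_mk, frac_def, OneMemClass.coe_one]
    rw [div_mul_div_cancel₀ (toFrac_ne_zero.2 ha'), div_self (toFrac_ne_zero.2 hb')]

/-- The underlying element of the fraction field of a nonzero rational function. -/
def unitVal : (V.functionField)ˣ →* V.Frac :=
  (V.functionField.val : V.functionField →* V.Frac).comp (Units.coeHom _)

theorem unitVal_mkUnit {a b : Cox} {d : ℤ × ℤ} (ha : W.IsBihom a d) (hb : W.IsBihom b d)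
    (ha' : a ∉ V.ideal) (hb' : b ∉ V.ideal) :
    unitVal (mkUnit a b ha hb ha' hb') = V.frac a b := rfl

theorem unitVal_div (c d : (V.functionField)ˣ) : unitVal (c / d) = unitVal c / unitVal d :=
  map_div _ _ _

theorem unitVal_inv (c : (V.functionField)ˣ) : unitVal c⁻¹ = (unitVal c)⁻¹ := map_inv _ _

theorem unitVal_ne_zero (c : (V.functionField)ˣ) : unitVal c ≠ 0 := by
  intro h
  have := unitVal_inv c
  have h1 : unitVal (c * c⁻¹) = 1 := by simp
  rw [map_mul, h, zero_mul] at h1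
  exact zero_ne_one h1

theorem isUnitAt_def {p : V.Pt} {c : (V.functionField)ˣ} :
    V.IsUnitAt p c ↔ unitVal c ∈ V.localRing p ∧ unitVal c⁻¹ ∈ V.localRing p := Iff.rfl

/-- A rational function is a unit at `p` if and only if it is a quotient of two bihomogeneous
polynomials of the same bidegree that do not vanish at `p`. -/
theorem isUnitAt_iff {p : V.Pt} {c : (V.functionField)ˣ} :
    V.IsUnitAt p c ↔ ∃ (d : ℤ × ℤ) (a b : Cox), W.IsBihom a d ∧ W.IsBihom b d ∧
      eval p.1.coords a ≠ 0 ∧ eval p.1.coords b ≠ 0 ∧ unitVal c = V.frac a b := by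
  rw [isUnitAt_def, unitVal_inv, mem_localRing, mem_localRing]
  constructor
  · rintro ⟨⟨d, a, b, ha, hb, hbp, h⟩, e, a', b', ha', hb', hbp', h'⟩
    refine ⟨d, a, b, ha, hb, fun hap => ?_, hbp, h⟩
    rw [h, inv_frac] at h'
    have haV : a ∉ V.ideal := by
      intro haV
      apply unitVal_ne_zero c
      rw [h, frac_def, toFrac_eq_zero.2 haV, zero_div]
    rw [frac_eq_frac haV (notMem_of_eval_ne_zero p hbp')] at h'
    have := p.2 _ h'
    rw [map_sub, map_mul, map_mul, hap, mul_zero, sub_zero] at this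
    exact mul_ne_zero hbp hbp' this
  · rintro ⟨d, a, b, ha, hb, hap, hbp, h⟩
    exact ⟨⟨d, a, b, ha, hb, hbp, h⟩, ⟨d, b, a, hb, ha, hap, by rw [h, inv_frac]⟩⟩

/-- The restriction to `C` of the fraction `a / b`. -/
theorem restrict_frac {C : W.Subvariety} (hC : V.ideal ≤ C.ideal) {d : ℤ × ℤ} {a b : Cox}
    (ha : W.IsBihom a d) (hb : W.IsBihom b d) (hbC : b ∉ C.ideal) :
    V.restrict C (V.frac a b) = C.frac a b := by
  obtain ⟨e, a', b', ha', hb', hbC', h, h'⟩ :=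
    Classical.epsilon_spec (p := fun χ : C.Frac => ∃ (d' : ℤ × ℤ) (a' b' : Cox),
      W.IsBihom a' d' ∧ W.IsBihom b' d' ∧ b' ∉ C.ideal ∧ V.frac a b = V.frac a' b' ∧
        χ = C.frac a' b') ⟨C.frac a b, d, a, b, ha, hb, hbC, rfl, rfl⟩
  rw [restrict, h', eq_comm, frac_eq_frac hbC hbC']
  exact hC ((frac_eq_frac (fun h => hbC (hC h)) fun h => hbC' (hC h)).1 h)

end Subvariety

end ScrollData

/-! ### A criterion for a local ring not to be regular -/

/-- A regular local ring in which the maximal ideal is the only prime containing `s` has embedding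
dimension at most `#s`, by Krull's height theorem. -/
theorem IsRegularLocalRing.spanFinrank_maximalIdeal_le_card {R : Type*} [CommRing R]
    [IsRegularLocalRing R] (s : Finset R) (hs : ∀ z ∈ s, z ∈ IsLocalRing.maximalIdeal R)
    (h : ∀ P : Ideal R, P.IsPrime → (∀ z ∈ s, z ∈ P) → IsLocalRing.maximalIdeal R ≤ P) :
    (IsLocalRing.maximalIdeal R).spanFinrank ≤ s.card := by
  have hmin : IsLocalRing.maximalIdeal R ∈ (Ideal.span (s : Set R)).minimalPrimes := by
    refine ⟨⟨inferInstance, Ideal.span_le.2 hs⟩, ?_⟩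
    rintro P ⟨hP, hsP⟩ -
    exact h P hP fun z hz => hsP (Ideal.subset_span hz)
  have h1 := Ideal.height_le_card_of_mem_minimalPrimes_span_finset hmin
  have h2 : ((IsLocalRing.maximalIdeal R).spanFinrank : WithBot ℕ∞) ≤ (s.card : ℕ∞) := by
    rw [IsRegularLocalRing.spanFinrank_maximalIdeal,
      ← IsLocalRing.maximalIdeal_height_eq_ringKrullDim]
    exact WithBot.coe_le_coe.2 h1
  exact_mod_cast h2

namespace ScrollData

variable {W : ScrollData}

namespace Subvariety

variable {V : W.Subvariety}

theorem isUnit_localRing_iff {p : V.Pt} {d : ℤ × ℤ} {a b : Cox} (ha : W.IsBihom a d)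
    (hb : W.IsBihom b d) (hbp : eval p.1.coords b ≠ 0) (z : V.localRing p)
    (hz : (z : V.Frac) = V.frac a b) : IsUnit z ↔ eval p.1.coords a ≠ 0 := by
  have hbV := notMem_of_eval_ne_zero p hbp
  constructor
  · intro hu hap
    obtain ⟨w, hw⟩ := hu.exists_right_inv
    obtain ⟨e, a', b', ha', hb', hbp', hw'⟩ := mem_localRing.1 w.2
    have h1 : V.frac (a * a') (b * b') = V.frac 1 1 := by
      rw [← frac_mul_frac, ← hz, ← hw', ← MulMemClass.coe_mul, hw]
      simp [frac_def]
    have h1V : (1 : Cox) ∉ V.ideal := fun h => V.prime.ne_top ((Ideal.eq_top_iff_one _).2 h)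
    rw [frac_eq_frac (mul_notMem hbV (notMem_of_eval_ne_zero p hbp')) h1V] at h1
    have := p.2 _ h1
    simp only [mul_one, one_mul, map_sub, map_mul, hap, zero_mul, zero_sub, neg_eq_zero] at this
    exact mul_ne_zero hbp hbp' this
  · intro hap
    refine IsUnit.of_mul_eq_one (⟨V.frac b a, d, b, a, hb, ha, hap, rfl⟩ : V.localRing p) ?_
    ext
    rw [MulMemClass.coe_mul, hz, frac_mul_frac, frac_def, mul_comm b a,
      div_self (toFrac_ne_zero.2 (mul_notMem (notMem_of_eval_ne_zero p hap) hbV))]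
    rfl

theorem mem_maximalIdeal_iff {p : V.Pt} [IsLocalRing (V.localRing p)] {d : ℤ × ℤ} {a b : Cox}
    (ha : W.IsBihom a d) (hb : W.IsBihom b d) (hbp : eval p.1.coords b ≠ 0) (z : V.localRing p)
    (hz : (z : V.Frac) = V.frac a b) :
    z ∈ IsLocalRing.maximalIdeal (V.localRing p) ↔ eval p.1.coords a = 0 := by
  rw [IsLocalRing.mem_maximalIdeal, mem_nonunits_iff, isUnit_localRing_iff ha hb hbp z hz, not_not]

/-- The bidegrees in which some bihomogeneous polynomial does not vanish at `p`. -/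
def Admissible (p : V.Pt) (d : ℤ × ℤ) : Prop := ∃ b, W.IsBihom b d ∧ eval p.1.coords b ≠ 0

/-- A lower bound for the embedding dimension of a local ring: a linear map `ℓ` which obeys the
Leibniz rule at `p` and kills `I(V)` factors through the cotangent space, so the rank of the span of
its values on numerators of elements of the maximal ideal is at most the embedding dimension. -/
theorem finrank_le_spanFinrank_maximalIdeal {E : Type*} [AddCommGroup E] [Module ℂ E] {p : V.Pt}
    [IsLocalRing (V.localRing p)] [IsNoetherianRing (V.localRing p)] (ℓ : Cox →ₗ[ℂ] E)
    (hmul : ∀ d e a b, Admissible p d → Admissible p e → W.IsBihom a d → W.IsBihom b e →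
      ℓ (a * b) = eval p.1.coords b • ℓ a + eval p.1.coords a • ℓ b)
    (hker : ∀ d a, Admissible p d → W.IsBihom a d → a ∈ V.ideal → ℓ a = 0)
    (hspan : ∀ N : Submodule ℂ E, (∀ d a, Admissible p d → W.IsBihom a d →
      eval p.1.coords a = 0 → ℓ a ∈ N) → N = ⊤) :
    Module.finrank ℂ E ≤ (IsLocalRing.maximalIdeal (V.localRing p)).spanFinrank := by
  obtain ⟨s, hcard, hs⟩ := Submodule.FG.exists_span_finset_card_eq_spanFinrank
    (IsNoetherian.noetherian (IsLocalRing.maximalIdeal (V.localRing p)))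
  choose d a b ha hb hbp hz using fun z : V.localRing p => mem_localRing.1 z.2
  classical
  let N : Submodule ℂ E := Submodule.span ℂ (s.image fun z => ℓ (a z) : Finset E)
  have hN : N = ⊤ := by
    apply hspan
    intro d' a' hd' ha' hap'
    obtain ⟨b', hb', hbp'⟩ := id hd'
    have key : ∀ z ∈ IsLocalRing.maximalIdeal (V.localRing p), ∃ d a b, W.IsBihom a d ∧
        W.IsBihom b d ∧ eval p.1.coords b ≠ 0 ∧ (z : V.Frac) = V.frac a b ∧
        eval p.1.coords a = 0 ∧ ℓ a ∈ N := by
      intro z hzm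
      rw [← hs] at hzm
      induction hzm using Submodule.span_induction with
      | mem z hzs =>
        refine ⟨_, a z, b z, ha z, hb z, hbp z, hz z, ?_, Submodule.subset_span ?_⟩
        · rw [← mem_maximalIdeal_iff (ha z) (hb z) (hbp z) z (hz z), ← hs]
          exact Submodule.subset_span hzs
        · exact Finset.mem_coe.2 (Finset.mem_image_of_mem (fun z => ℓ (a z)) hzs)
      | zero =>
        refine ⟨0, 0, 1, isWeightedHomogeneous_zero _ _ _, isWeightedHomogeneous_one _ _, by simp,
          by simp [frac_def], by simp, by simp⟩
      | add z w _ _ hz' hw' =>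
        obtain ⟨d, a, b, ha, hb, hbp, hz, hap, hN⟩ := hz'
        obtain ⟨e, a', b', ha', hb', hbp', hw, hap', hN'⟩ := hw'
        refine ⟨d + e, a * b' + b * a', b * b',
          (weightedHomogeneousSubmodule ℂ W.wt (d + e)).add_mem (ha.mul hb') (hb.mul ha'),
          hb.mul hb', ?_, ?_, ?_, ?_⟩
        · rw [map_mul]
          exact mul_ne_zero hbp hbp'
        · rw [AddMemClass.coe_add, hz, hw]
          simp only [frac_def, map_add, map_mul]
          exact div_add_div _ _ (toFrac_ne_zero.2 (notMem_of_eval_ne_zero p hbp))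
            (toFrac_ne_zero.2 (notMem_of_eval_ne_zero p hbp'))
        · simp [hap, hap']
        · rw [map_add, hmul d e a b' ⟨b, hb, hbp⟩ ⟨b', hb', hbp'⟩ ha hb',
            hmul d e b a' ⟨b, hb, hbp⟩ ⟨b', hb', hbp'⟩ hb ha', hap, hap', zero_smul, zero_smul,
            add_zero, zero_add]
          exact N.add_mem (N.smul_mem _ hN) (N.smul_mem _ hN')
      | smul r z _ hz' =>
        obtain ⟨d, a, b, ha, hb, hbp, hz, hap, hN⟩ := hz'
        obtain ⟨e, a', b', ha', hb', hbp', hr⟩ := mem_localRing.1 r.2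
        refine ⟨e + d, a' * a, b' * b, ha'.mul ha, hb'.mul hb, ?_, ?_, by simp [hap], ?_⟩
        · rw [map_mul]
          exact mul_ne_zero hbp' hbp
        · rw [smul_eq_mul, MulMemClass.coe_mul, hz, hr, frac_mul_frac]
        · rw [hmul e d a' a ⟨b', hb', hbp'⟩ ⟨b, hb, hbp⟩ ha' ha, hap, zero_smul, zero_add]
          exact N.smul_mem _ hN
    obtain ⟨e, a, b, ha, hb, hbp, hz, hap, hN⟩ :=
      key ⟨V.frac a' b', d', a', b', ha', hb', hbp', rfl⟩
        ((mem_maximalIdeal_iff ha' hb' hbp' _ rfl).2 hap')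
    have he : Admissible p e := ⟨b, hb, hbp⟩
    rw [frac_eq_frac (notMem_of_eval_ne_zero p hbp') (notMem_of_eval_ne_zero p hbp)] at hz
    have h0 : ℓ (a' * b - a * b') = 0 := by
      refine hker (d' + e) _ ⟨b' * b, hb'.mul hb, ?_⟩ ?_ hz
      · rw [map_mul]
        exact mul_ne_zero hbp' hbp
      · refine IsWeightedHomogeneous.sub (ha'.mul hb) ?_
        rw [add_comm]
        exact ha.mul hb'
    rw [map_sub, hmul d' e a' b hd' he ha' hb, hmul e d' a b' he hd' ha hb', hap, hap', zero_smul,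
      zero_smul, add_zero, add_zero, sub_eq_zero] at h0
    have : ℓ a' = (eval p.1.coords b)⁻¹ • (eval p.1.coords b' • ℓ a) := by
      rw [← h0, inv_smul_smul₀ hbp]
    rw [this]
    exact N.smul_mem _ (N.smul_mem _ hN)
  calc Module.finrank ℂ E = Module.finrank ℂ N := by rw [hN, finrank_top]
    _ ≤ (s.image fun z => ℓ (a z)).card := finrank_span_finset_le_card _
    _ ≤ s.card := Finset.card_image_le
    _ = _ := hcard

end Subvariety

/-! ### Hypersurfaces are singular where the differential of the equation vanishes -/

/-- The monomial `xᵢ u^{aᵢ}` (with `u` replaced by `v` if `j = 1`), of bidegree `(0, bᵢ)`. -/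
def xhat (W : ScrollData) (j : Fin 2) (i : Fin 4) : Cox := X (Sum.inr i) * X (Sum.inl j) ^ W.a i

theorem isBihom_xhat (j : Fin 2) (i : Fin 4) : W.IsBihom (W.xhat j i) (0, (W.b i : ℤ)) := by
  have := (isBihom_X (W := W) (Sum.inr i)).mul ((isBihom_X (W := W) (Sum.inl j)).pow (W.a i))
  have h : W.wt (Sum.inr i) + W.a i • W.wt (Sum.inl j) = (0, (W.b i : ℤ)) := by
    ext <;> simp [wt]
  exact h ▸ this

theorem eval_xhat (z : Fin 2 ⊕ Fin 4 → ℂ) (j : Fin 2) (i : Fin 4) :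
    eval z (W.xhat j i) = z (Sum.inr i) * z (Sum.inl j) ^ W.a i := by simp [xhat]

/-- The numerator of a local coordinate on the chart `X (inl j) ≠ 0`, `X (inr i) ≠ 0`. -/
def chartNum (W : ScrollData) (j : Fin 2) : Fin 2 ⊕ Fin 4 → Cox
  | Sum.inl j' => X (Sum.inl j')
  | Sum.inr l => W.xhat j l

/-- The denominator of a local coordinate on the chart `X (inl j) ≠ 0`, `X (inr i) ≠ 0`. -/
def chartDen (W : ScrollData) (j : Fin 2) (i : Fin 4) : Fin 2 ⊕ Fin 4 → Cox
  | Sum.inl _ => X (Sum.inl j)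
  | Sum.inr l => W.xhat j i ^ W.b l

/-- The bidegree of the numerator and of the denominator of a local coordinate. -/
def chartDeg (W : ScrollData) : Fin 2 ⊕ Fin 4 → ℤ × ℤ
  | Sum.inl _ => (1, 0)
  | Sum.inr l => (0, (W.b l : ℤ))

theorem isBihom_chartNum (j : Fin 2) (k : Fin 2 ⊕ Fin 4) :
    W.IsBihom (W.chartNum j k) (W.chartDeg k) := by
  rcases k with j' | l
  · exact isBihom_X _
  · exact isBihom_xhat j l

theorem isBihom_chartDen (j : Fin 2) {i : Fin 4} (hi : W.b i = 1) (k : Fin 2 ⊕ Fin 4) :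
    W.IsBihom (W.chartDen j i k) (W.chartDeg k) := by
  rcases k with j' | l
  · exact isBihom_X (W := W) (Sum.inl j)
  · have := (isBihom_xhat (W := W) j i).pow (W.b l)
    have h : W.b l • ((0 : ℤ), (W.b i : ℤ)) = W.chartDeg (Sum.inr l) := by
      ext <;> simp [chartDeg, hi]
    exact h ▸ this

/-- The character of the torus which is `(U^d₁) (Z^d₂)` in terms of nonzero `U`, `Z`. -/
def chartChar {K : Type*} [Field K] (U Z : K) (d : ℤ × ℤ) : K := U ^ d.1 * Z ^ d.2

theorem chartChar_zero {K : Type*} [Field K] (U Z : K) : chartChar U Z 0 = 1 := by simp [chartChar]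

theorem chartChar_add {K : Type*} [Field K] {U Z : K} (hU : U ≠ 0) (hZ : Z ≠ 0) (d e : ℤ × ℤ) :
    chartChar U Z (d + e) = chartChar U Z d * chartChar U Z e := by
  simp only [chartChar, Prod.fst_add, Prod.snd_add, zpow_add₀ hU, zpow_add₀ hZ]
  ring

theorem chartChar_ne_zero {K : Type*} [Field K] {U Z : K} (hU : U ≠ 0) (hZ : Z ≠ 0) (d : ℤ × ℤ) :
    chartChar U Z d ≠ 0 := mul_ne_zero (zpow_ne_zero _ hU) (zpow_ne_zero _ hZ)

/-- In a field, a variable is its local coordinate times the value of a character. -/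
theorem chartChar_mul_coord {K : Type*} [Field K] [Algebra ℂ K] (z : Fin 2 ⊕ Fin 4 → K) (j : Fin 2)
    (i : Fin 4) (hj : z (Sum.inl j) ≠ 0) (hi : z (Sum.inr i) ≠ 0) (k : Fin 2 ⊕ Fin 4) :
    chartChar (z (Sum.inl j)) (aeval z (W.xhat j i)) (W.wt k) *
      (aeval z (W.chartNum j k) / aeval z (W.chartDen j i k)) = z k := by
  have hx : aeval z (W.xhat j i) ≠ 0 := by
    simpa [xhat] using ⟨hi, fun h => absurd h hj⟩
  rcases k with j' | l
  · simp only [chartChar, wt, zpow_one, zpow_zero, mul_one, chartNum, chartDen, aeval_X]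
    exact mul_div_cancel₀ _ hj
  · simp only [chartChar, wt, zpow_neg, zpow_natCast, chartNum, chartDen, map_pow]
    rw [mul_assoc, mul_div_cancel₀ _ (pow_ne_zero _ hx)]
    simp only [xhat, map_mul, map_pow, aeval_X]
    rw [mul_comm, mul_assoc, mul_inv_cancel₀ (pow_ne_zero _ hj), mul_one]

/-- The value of a bihomogeneous polynomial in terms of the local coordinates. -/
theorem IsBihom.aeval_chart {K : Type*} [Field K] [Algebra ℂ K] (z : Fin 2 ⊕ Fin 4 → K) (j : Fin 2)
    (i : Fin 4) (hj : z (Sum.inl j) ≠ 0) (hi : z (Sum.inr i) ≠ 0) {a : Cox} {d : ℤ × ℤ}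
    (ha : W.IsBihom a d) :
    aeval z a = chartChar (z (Sum.inl j)) (aeval z (W.xhat j i)) d *
      aeval (fun k => aeval z (W.chartNum j k) / aeval z (W.chartDen j i k)) a := by
  have hx : aeval z (W.xhat j i) ≠ 0 := by
    simpa [xhat] using ⟨hi, fun h => absurd h hj⟩
  rw [← ha.aeval_mul (chartChar_zero _ _) (chartChar_add hj hx)]
  congr 2
  funext k
  exact (chartChar_mul_coord z j i hj hi k).symm

/-- Let `y` be elements of a local `ℂ`-algebra with values `y₀` in the residue field and
`F(y) = 0`. A prime ideal containing the equations of a line through `y₀` on which `F` does not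
vanish identically contains the elements `y - y₀`. -/
theorem aeval_sub_mem_of_line {ι R : Type*} [CommRing R] [IsLocalRing R] [Algebra ℂ R] {y : ι → R}
    {y₀ e : ι → ℂ} (hy : ∀ k, y k - algebraMap ℂ R (y₀ k) ∈ IsLocalRing.maximalIdeal R)
    {F : MvPolynomial ι ℂ} (hF : aeval y F = 0) (he : eval (fun k => y₀ k + e k) F ≠ 0)
    {k₀ : ι} (hk₀ : e k₀ ≠ 0) {P : Ideal R} (hP : P.IsPrime)
    (hlin : ∀ k, e k₀ • (y k - algebraMap ℂ R (y₀ k)) - e k • (y k₀ - algebraMap ℂ R (y₀ k₀)) ∈ P)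
    (a : MvPolynomial ι ℂ) : aeval y a - algebraMap ℂ R (eval y₀ a) ∈ P := by
  let w : R := (e k₀)⁻¹ • (y k₀ - algebraMap ℂ _ (y₀ k₀))
  have hwm : w ∈ IsLocalRing.maximalIdeal R := by
    simp only [w]
    rw [Algebra.smul_def]
    exact Ideal.mul_mem_left _ _ (hy k₀)
  let π : R →ₐ[ℂ] (R ⧸ P) := Ideal.Quotient.mkₐ ℂ P
  have hπ0 : ∀ z, π z = 0 ↔ z ∈ P := fun z => Ideal.Quotient.eq_zero_iff_mem
  have hπy : ∀ k, π (y k) = π (algebraMap ℂ _ (y₀ k) + algebraMap ℂ _ (e k) * w) := by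
    intro k
    rw [← sub_eq_zero, ← map_sub, hπ0]
    have h1 : y k - (algebraMap ℂ _ (y₀ k) + algebraMap ℂ _ (e k) * w) = (e k₀)⁻¹ •
        (e k₀ • (y k - algebraMap ℂ R (y₀ k)) - e k • (y k₀ - algebraMap ℂ R (y₀ k₀))) := by
      simp only [w, smul_sub, smul_smul, inv_mul_cancel₀ hk₀, one_smul, ← Algebra.smul_def]
      rw [mul_comm (e k₀)⁻¹ (e k)]
      abel
    rw [h1, Algebra.smul_def]
    exact Ideal.mul_mem_left _ _ (hlin k)
  -- The restriction of `F` to the line.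
  let G : Polynomial ℂ :=
    aeval (fun k => Polynomial.C (y₀ k) + Polynomial.C (e k) * Polynomial.X) F
  have hG0 : G ≠ 0 := by
    intro h
    apply he
    have h1 : Polynomial.aeval (1 : ℂ) G = eval (fun k => y₀ k + e k) F := by
      simp only [G]
      rw [comp_aeval_apply]
      change _ = aeval _ F
      congr 2
      funext k
      simp
    rw [← h1, h, map_zero]
  have hGw : π (Polynomial.aeval w G) = 0 := by
    simp only [G]
    rw [comp_aeval_apply, comp_aeval_apply, ← map_zero π, ← hF, comp_aeval_apply]
    congr 2
    funext k
    rw [hπy]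
    simp
  have hw0 : π w = 0 := by
    obtain ⟨q, hq, hq0⟩ := Polynomial.exists_eq_pow_rootMultiplicity_mul_and_not_dvd G hG0 0
    rw [Polynomial.dvd_iff_isRoot, Polynomial.IsRoot.def] at hq0
    rw [hq, map_mul, map_mul, map_pow, map_pow, Polynomial.C_0, sub_zero, Polynomial.aeval_X] at hGw
    have hunit : IsUnit (Polynomial.aeval w q) := by
      by_contra hnu
      have h1 : Polynomial.aeval w q ∈ IsLocalRing.maximalIdeal R := hnu
      have h2 : Polynomial.aeval w (q - Polynomial.C (q.eval 0)) ∈ IsLocalRing.maximalIdeal R := by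
        obtain ⟨q', hq'⟩ : Polynomial.X ∣ q - Polynomial.C (q.eval 0) := by
          rw [Polynomial.X_dvd_iff, Polynomial.coeff_zero_eq_eval_zero]
          simp
        rw [hq', map_mul, Polynomial.aeval_X]
        exact Ideal.mul_mem_right _ _ hwm
      have h3 := Ideal.sub_mem _ h1 h2
      rw [map_sub, sub_sub_cancel, Polynomial.aeval_C] at h3
      exact h3 ((IsUnit.mk0 _ hq0).map (algebraMap ℂ R))
    have hne : π (Polynomial.aeval w q) ≠ 0 := (hunit.map π).ne_zero
    exact eq_zero_of_pow_eq_zero ((mul_eq_zero_iff_right hne).1 hGw)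
  rw [← hπ0, map_sub, sub_eq_zero, comp_aeval_apply]
  have h1 : (fun k => π (y k)) = fun k => algebraMap ℂ (R ⧸ P) (y₀ k) := by
    funext k
    rw [hπy, map_add, map_mul, hw0, mul_zero, add_zero, AlgHom.commutes]
  rw [h1, AlgHom.commutes]
  exact aeval_algebraMap_apply (R ⧸ P) y₀ a

namespace Subvariety

variable {V : W.Subvariety}

/-- If all partial derivatives of the equation of `V` vanish at a point `p` of a smooth chart of
`𝓕`, then the embedding dimension of `V` at `p` is at least `4`. -/
theorem four_le_spanFinrank_of_pderiv_eq_zero {F : Cox} (hV : V.ideal = Ideal.span {F}) (p : V.Pt)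
    [IsLocalRing (V.localRing p)] [IsNoetherianRing (V.localRing p)] {j : Fin 2} {i : Fin 4}
    (hi : W.b i = 1) (hpj : p.1.coords (Sum.inl j) ≠ 0) (hpi : p.1.coords (Sum.inr i) ≠ 0)
    (hd : ∀ k, eval p.1.coords (pderiv k F) = 0) :
    4 ≤ (IsLocalRing.maximalIdeal (V.localRing p)).spanFinrank := by
  set x := p.1.coords with hx
  have hFp : eval x F = 0 := p.2 F (hV ▸ Ideal.mem_span_singleton_self F)
  have hxhat : eval x (W.xhat j i) ≠ 0 := by
    rw [eval_xhat]
    exact mul_ne_zero hpi (pow_ne_zero _ hpj)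
  have hden : ∀ k, eval x (W.chartDen j i k) ≠ 0 := by
    rintro (j' | l)
    · simpa [chartDen] using hpj
    · simp only [chartDen, map_pow]
      exact pow_ne_zero _ hxhat
  have hadm : ∀ k, Admissible p (W.chartDeg k) := fun k => ⟨_, isBihom_chartDen j hi k, hden k⟩
  -- The values of the local coordinates at `p`.
  let y₀ : Fin 2 ⊕ Fin 4 → ℂ := fun k => eval x (W.chartNum j k) / eval x (W.chartDen j i k)
  let ι := {k : Fin 2 ⊕ Fin 4 // k ≠ Sum.inl j ∧ k ≠ Sum.inr i}
  have hι : Fintype.card ι = 4 := by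
    clear * -
    revert i j
    decide
  let ℓ : Cox →ₗ[ℂ] (ι → ℂ) :=
    LinearMap.pi fun k => (aeval x).toLinearMap ∘ₗ (pderiv k.1).toLinearMap
  have hℓ : ∀ a k, ℓ a k = eval x (pderiv k.1 a) := fun a k => rfl
  have h := finrank_le_spanFinrank_maximalIdeal (p := p) ℓ ?_ ?_ ?_
  · simpa [hι] using h
  · intro d e a b _ _ _ _
    funext k
    simp only [hℓ, Derivation.leibniz, smul_eq_mul, map_add, map_mul, Pi.add_apply, Pi.smul_apply]
    ring
  · intro d a _ _ ha
    rw [hV] at ha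
    obtain ⟨q, rfl⟩ := Ideal.mem_span_singleton'.1 ha
    funext k
    simp only [hℓ, Derivation.leibniz, smul_eq_mul, map_add, map_mul, hd, hFp, mul_zero, zero_mul,
      add_zero, Pi.zero_apply]
  · intro N hN
    have hsingle : ∀ k : ι, Pi.single k (1 : ℂ) ∈ N := by
      intro k
      have h1 := hN (W.chartDeg k.1) (W.chartNum j k.1 - C (y₀ k.1) * W.chartDen j i k.1)
        (hadm k.1) ((isBihom_chartNum j k.1).sub ((isBihom_chartDen j hi k.1).C_mul _))
        (by
          simp only [map_sub, map_mul, eval_C]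
          rw [div_mul_cancel₀ _ (hden k.1), sub_self])
      have hXj : ∀ k' : ι, pderiv k'.1 (X (Sum.inl j) : Cox) = 0 := fun k' =>
        pderiv_X_of_ne (Ne.symm k'.2.1)
      have hXi : ∀ k' : ι, pderiv k'.1 (X (Sum.inr i) : Cox) = 0 := fun k' =>
        pderiv_X_of_ne (Ne.symm k'.2.2)
      have hden0 : ∀ k' : ι, pderiv k'.1 (W.chartDen j i k.1) = 0 := by
        intro k'
        rcases k.1 with j' | l
        · exact hXj k'
        · simp [chartDen, xhat, Derivation.leibniz, Derivation.leibniz_pow, hXi, hXj]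
      obtain ⟨c, hc, hnum⟩ : ∃ c : ℂ, c ≠ 0 ∧ ∀ k' : ι,
          eval x (pderiv k'.1 (W.chartNum j k.1)) = c * Pi.single (M := fun _ => ℂ) k 1 k' := by
        have hs : ∀ k' : ι, (Pi.single (M := fun _ => ℂ) k 1 k' : ℂ) =
            eval x (pderiv k'.1 (X k.1 : Cox)) := by
          intro k'
          by_cases h : k = k'
          · subst h
            simp
          · rw [Pi.single_eq_of_ne (Ne.symm h),
              pderiv_X_of_ne (fun h' => h (Subtype.ext h')), map_zero]
        rcases hk : k.1 with j' | l
        · exact ⟨1, one_ne_zero, fun k' => by rw [one_mul, hs, hk]; rfl⟩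
        · refine ⟨x (Sum.inl j) ^ W.a l, pow_ne_zero _ hpj, fun k' => ?_⟩
          rw [hs, hk]
          simp [chartNum, xhat, Derivation.leibniz, Derivation.leibniz_pow, hXj]
      have h2 : ℓ (W.chartNum j k.1 - C (y₀ k.1) * W.chartDen j i k.1) =
          c • Pi.single k (1 : ℂ) := by
        funext k'
        rw [hℓ, map_sub, map_sub, hnum, pderiv_C_mul, hden0, mul_zero, map_zero, sub_zero]
        rfl
      rw [h2] at h1
      exact (N.smul_mem_iff hc).1 h1
    rw [eq_top_iff]
    intro f _
    rw [pi_eq_sum_univ' f]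
    exact N.sum_mem fun k _ => N.smul_mem _ (hsingle k)

/-- If `p` lies in the chart `X (inl j) ≠ 0`, `X (inr i) ≠ 0` with `bᵢ = 1`, where `𝓕` is smooth,
and all partial derivatives of the equation `F` of `V` vanish at `p`, then `V` is singular at `p`:
the embedding dimension is at least `4`, while the local ring has dimension at most `3`, because a
line through `p` on which `F` does not vanish identically meets `V` properly. -/
theorem not_isRegularLocalRing_of_pderiv_eq_zero {F : Cox} {dF : ℤ × ℤ} (hF : W.IsBihom F dF)
    (hF0 : F ≠ 0) (hV : V.ideal = Ideal.span {F}) (p : V.Pt) {j : Fin 2} {i : Fin 4}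
    (hi : W.b i = 1) (hpj : p.1.coords (Sum.inl j) ≠ 0) (hpi : p.1.coords (Sum.inr i) ≠ 0)
    (hd : ∀ k, eval p.1.coords (pderiv k F) = 0) : ¬ IsRegularLocalRing (V.localRing p) := by
  intro hreg
  set x := p.1.coords with hx
  have hFV : F ∈ V.ideal := hV ▸ Ideal.mem_span_singleton_self F
  have hFp : eval x F = 0 := p.2 F hFV
  have hxhat : eval x (W.xhat j i) ≠ 0 := by
    rw [eval_xhat]
    exact mul_ne_zero hpi (pow_ne_zero _ hpj)
  have hden : ∀ k, eval x (W.chartDen j i k) ≠ 0 := by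
    rintro (j' | l)
    · simpa [chartDen] using hpj
    · simp only [chartDen, map_pow]
      exact pow_ne_zero _ hxhat
  -- The values of the local coordinates at `p`.
  let y₀ : Fin 2 ⊕ Fin 4 → ℂ := fun k => eval x (W.chartNum j k) / eval x (W.chartDen j i k)
  have hy₀ : ∀ {a d}, W.IsBihom a d →
      eval x a = chartChar (x (Sum.inl j)) (eval x (W.xhat j i)) d * eval y₀ a :=
    fun ha => ha.aeval_chart x j i hpj hpi
  have hlow := four_le_spanFinrank_of_pderiv_eq_zero hV p hi hpj hpi hd
  -- The local coordinates as elements of the local ring.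
  let y : Fin 2 ⊕ Fin 4 → V.localRing p := fun k =>
    ⟨V.frac (W.chartNum j k) (W.chartDen j i k), W.chartDeg k, W.chartNum j k, W.chartDen j i k,
      isBihom_chartNum j k, isBihom_chartDen j hi k, hden k, rfl⟩
  let U : V.Frac := V.toFrac (X (Sum.inl j))
  let Z : V.Frac := V.toFrac (W.xhat j i)
  have hU : U ≠ 0 := toFrac_ne_zero.2 (notMem_of_eval_ne_zero p (by simpa using hpj))
  have hZ : Z ≠ 0 := toFrac_ne_zero.2 (notMem_of_eval_ne_zero p hxhat)
  have hXi : V.toFrac (X (Sum.inr i)) ≠ 0 :=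
    toFrac_ne_zero.2 (notMem_of_eval_ne_zero p (by simpa using hpi))
  have htoFrac : ∀ a, aeval (fun k => V.toFrac (X k)) a = V.toFrac a := by
    intro a
    exact (DFunLike.congr_fun (aeval_unique V.toFrac) a).symm
  have hy : ∀ {a d}, W.IsBihom a d →
      V.toFrac a = chartChar U Z d * (aeval y a : V.localRing p) := by
    intro a d ha
    have := ha.aeval_chart (fun k => V.toFrac (X k)) j i hU hXi
    simp only [htoFrac] at this
    rw [this]
    congr 1
    change _ = (V.localRing p).val _
    rw [comp_aeval_apply]
    rfl
  have hFy : aeval y F = 0 := by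
    have := hy hF
    rw [toFrac_eq_zero.2 hFV] at this
    exact Subtype.ext ((mul_eq_zero_iff_left (chartChar_ne_zero hU hZ dF)).1 this.symm)
  have hym : ∀ k, y k - algebraMap ℂ _ (y₀ k) ∈ IsLocalRing.maximalIdeal (V.localRing p) := by
    intro k
    refine (mem_maximalIdeal_iff (a := W.chartNum j k - C (y₀ k) * W.chartDen j i k)
      ((isBihom_chartNum j k).sub ((isBihom_chartDen j hi k).C_mul _)) (isBihom_chartDen j hi k)
      (hden k) _ ?_).2 ?_
    · rw [frac_def, map_sub, map_mul, sub_div, mul_div_cancel_right₀ _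
        (toFrac_ne_zero.2 (notMem_of_eval_ne_zero p (hden k)))]
      rfl
    · simp only [map_sub, map_mul, eval_C]
      rw [div_mul_cancel₀ _ (hden k), sub_self]
  have hF₀ : eval y₀ F = 0 := by
    have := hy₀ hF
    rw [hFp] at this
    exact (mul_eq_zero_iff_left (chartChar_ne_zero hpj hxhat dF)).1 this.symm
  have hcoord : ∀ z : Fin 2 ⊕ Fin 4 → ℂ, z (Sum.inl j) ≠ 0 → z (Sum.inr i) ≠ 0 →
      eval z (W.chartNum j (Sum.inl j)) / eval z (W.chartDen j i (Sum.inl j)) = 1 ∧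
      eval z (W.chartNum j (Sum.inr i)) / eval z (W.chartDen j i (Sum.inr i)) = 1 := by
    intro z hzj hzi
    constructor
    · simpa [chartNum, chartDen] using hzj
    · simp only [chartNum, chartDen, hi, pow_one]
      refine div_self ?_
      rw [eval_xhat]
      exact mul_ne_zero hzi (pow_ne_zero _ hzj)
  obtain ⟨r, hrj, hri, hrF⟩ : ∃ r : Fin 2 ⊕ Fin 4 → ℂ,
      r (Sum.inl j) = 1 ∧ r (Sum.inr i) = 1 ∧ eval r F ≠ 0 := by
    have hne : F * X (Sum.inl j) * X (Sum.inr i) ≠ 0 :=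
      mul_ne_zero (mul_ne_zero hF0 (X_ne_zero _)) (X_ne_zero _)
    obtain ⟨z, hz⟩ : ∃ z, eval z (F * X (Sum.inl j) * X (Sum.inr i)) ≠ 0 := by
      by_contra! h
      exact hne (MvPolynomial.funext fun z => by simpa using h z)
    simp only [map_mul, eval_X] at hz
    have hzi := right_ne_zero_of_mul hz
    have hzj := right_ne_zero_of_mul (left_ne_zero_of_mul hz)
    have hzF := left_ne_zero_of_mul (left_ne_zero_of_mul hz)
    refine ⟨fun k => eval z (W.chartNum j k) / eval z (W.chartDen j i k), (hcoord z hzj hzi).1,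
      (hcoord z hzj hzi).2, fun h => hzF ?_⟩
    rw [show eval z F = _ from hF.aeval_chart z j i hzj hzi]
    exact mul_eq_zero_of_right _ h
  let e : Fin 2 ⊕ Fin 4 → ℂ := fun k => r k - y₀ k
  have hej : e (Sum.inl j) = 0 := by
    simp only [e, hrj, y₀, (hcoord x hpj hpi).1, sub_self]
  have hei : e (Sum.inr i) = 0 := by
    simp only [e, hri, y₀, (hcoord x hpj hpi).2, sub_self]
  obtain ⟨k₀, hk₀⟩ : ∃ k, e k ≠ 0 := by
    by_contra! h
    have : r = y₀ := funext fun k => sub_eq_zero.1 (h k)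
    exact hrF (this ▸ hF₀)
  have hyj : y (Sum.inl j) = algebraMap ℂ _ (y₀ (Sum.inl j)) := by
    simp only [y₀, (hcoord x hpj hpi).1, map_one]
    ext
    simp only [y, chartNum, chartDen, frac_def]
    exact div_self hU
  have hyi : y (Sum.inr i) = algebraMap ℂ _ (y₀ (Sum.inr i)) := by
    simp only [y₀, (hcoord x hpj hpi).2, map_one]
    ext
    simp only [y, chartNum, chartDen, frac_def, hi, pow_one]
    exact div_self hZ
  -- Equations of the line through `p` in the direction `e`.
  let lin : Fin 2 ⊕ Fin 4 → V.localRing p := fun k =>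
    e k₀ • (y k - algebraMap ℂ _ (y₀ k)) - e k • (y k₀ - algebraMap ℂ _ (y₀ k₀))
  classical
  let s : Finset (V.localRing p) :=
    (((Finset.univ.erase (Sum.inl j)).erase (Sum.inr i)).erase k₀).image lin
  have hk₀j : k₀ ≠ Sum.inl j := fun h => hk₀ (h ▸ hej)
  have hk₀i : k₀ ≠ Sum.inr i := fun h => hk₀ (h ▸ hei)
  have hcard : s.card ≤ 3 := by
    refine Finset.card_image_le.trans ?_
    rw [Finset.card_erase_of_mem (by simp [hk₀j, hk₀i]), Finset.card_erase_of_mem (by simp),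
      Finset.card_erase_of_mem (Finset.mem_univ _)]
    simp
  have hup := IsRegularLocalRing.spanFinrank_maximalIdeal_le_card s ?_ ?_
  · omega
  · intro z hz
    obtain ⟨k, -, rfl⟩ := Finset.mem_image.1 hz
    refine Ideal.sub_mem _ ?_ ?_
    · rw [Algebra.smul_def]
      exact Ideal.mul_mem_left _ _ (hym k)
    · rw [Algebra.smul_def]
      exact Ideal.mul_mem_left _ _ (hym k₀)
  intro P hP hsP
  have hlin : ∀ k, lin k ∈ P := by
    intro k
    by_cases hkj : k = Sum.inl j
    · subst hkj
      simp [lin, hej, hyj]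
    by_cases hki : k = Sum.inr i
    · subst hki
      simp [lin, hei, hyi]
    by_cases hk : k = k₀
    · subst hk
      simp [lin]
    exact hsP _ (Finset.mem_image_of_mem _ (by simp [hkj, hki, hk]))
  have hmem := aeval_sub_mem_of_line hym hFy (by simpa [e] using hrF) hk₀ hP hlin
  intro z hz
  obtain ⟨d, a, b, ha, hb, hbp, hzab⟩ := mem_localRing.1 z.2
  have hap := (mem_maximalIdeal_iff ha hb hbp z hzab).1 hz
  have hzb : z * aeval y b = aeval y a := by
    ext
    have hb0 : ((aeval y b : V.localRing p) : V.Frac) ≠ 0 := by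
      intro h0
      have := hy hb
      rw [h0, mul_zero] at this
      exact toFrac_ne_zero.2 (notMem_of_eval_ne_zero p hbp) this
    rw [MulMemClass.coe_mul, hzab, frac_def, hy ha, hy hb,
      mul_div_mul_left _ _ (chartChar_ne_zero hU hZ d), div_mul_cancel₀ _ hb0]
  have ha₀ : eval y₀ a = 0 := by
    have := hy₀ ha
    rw [hap] at this
    exact (mul_eq_zero_iff_left (chartChar_ne_zero hpj hxhat d)).1 this.symm
  have hb₀ : eval y₀ b ≠ 0 := by
    intro h
    have := hy₀ hb
    rw [h, mul_zero] at this
    exact hbp this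
  have haP := hmem a
  rw [ha₀, map_zero, sub_zero, ← hzb] at haP
  refine (hP.mem_or_mem haP).resolve_right fun hbP => ?_
  have h1 := P.sub_mem hbP (hmem b)
  rw [sub_sub_cancel] at h1
  exact hP.ne_top (P.eq_top_of_isUnit_mem h1 ((IsUnit.mk0 _ hb₀).map _))

end Subvariety

/-! ### Hypersurfaces are singular along the curve of quotient singularities -/

theorem Point.exists_inl_ne_zero (x : W.Point) : ∃ j, x.coords (Sum.inl j) ≠ 0 :=
  (Quotient.out x).2.1

theorem Point.exists_inr_ne_zero (x : W.Point) : ∃ i, x.coords (Sum.inr i) ≠ 0 :=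
  (Quotient.out x).2.2

/-- If only the variable `x_t` of weight `2` does not vanish at `x`, then `x` is fixed by the
element `(1, -1)` of the torus, so only polynomials of even degree in the `xᵢ` can be nonzero at
`x`. -/
theorem IsBihom.even_of_eval_ne_zero {t : Fin 4} (hb : ∀ i, W.b i = if i = t then 2 else 1)
    {x : Fin 2 ⊕ Fin 4 → ℂ} (hx : ∀ i, i ≠ t → x (Sum.inr i) = 0) {a : Cox} {d : ℤ × ℤ}
    (ha : W.IsBihom a d) (h : eval x a ≠ 0) : Even d.2 := by
  have h1 := ha.eval_torus 1 (-1) x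
  have h2 : (fun k => (((1 : ℂˣ) ^ (W.wt k).1 * (-1 : ℂˣ) ^ (W.wt k).2 : ℂˣ) : ℂ) * x k) = x := by
    funext k
    rcases k with j | i
    · simp [wt]
    · by_cases hi : i = t
      · simp [wt, hb, hi]
      · rw [hx i hi, mul_zero]
  rw [h2] at h1
  by_contra hodd
  rw [Int.not_even_iff_odd] at hodd
  rw [hodd.neg_one_zpow] at h1
  simp only [one_zpow, one_mul, Units.val_neg, Units.val_one, neg_mul] at h1
  exact h (self_eq_neg.1 h1)

namespace Subvariety

variable {V : W.Subvariety}

/-- At a point where only the variable of weight `2` does not vanish, `𝓕` is locally the product of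
a line and a quotient `ℂ³ / ±1`. The six quadratic monomials on `ℂ³` satisfy modulo the equation of
`V` at most one linear relation in the cotangent space, so the embedding dimension is at least
`5`. -/
theorem five_le_spanFinrank_of_vertex {F : Cox} {dF : ℤ × ℤ} (hF : W.IsBihom F dF)
    (hdF : Even dF.2) (hV : V.ideal = Ideal.span {F}) (p : V.Pt)
    [IsLocalRing (V.localRing p)] [IsNoetherianRing (V.localRing p)] {t : Fin 4}
    (hb : ∀ i, W.b i = if i = t then 2 else 1) (hp : ∀ i, i ≠ t → p.1.coords (Sum.inr i) = 0) :
    5 ≤ (IsLocalRing.maximalIdeal (V.localRing p)).spanFinrank := by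
  obtain ⟨j, hpj⟩ := p.1.exists_inl_ne_zero
  have hpt : p.1.coords (Sum.inr t) ≠ 0 := by
    obtain ⟨i, hi⟩ := p.1.exists_inr_ne_zero
    by_cases h : i = t
    · exact h ▸ hi
    · exact absurd (hp i h) hi
  set x := p.1.coords with hx
  have hFp : eval x F = 0 := p.2 F (hV ▸ Ideal.mem_span_singleton_self F)
  have heven : ∀ {d}, Admissible p d → Even d.2 := by
    rintro d ⟨b, hbd, hbp⟩
    exact hbd.even_of_eval_ne_zero hb hp hbp
  -- First derivatives of polynomials of even degree vanish by parity.
  have hder : ∀ {d a} (i : Fin 4), i ≠ t → Even d.2 → W.IsBihom a d →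
      eval x (pderiv (Sum.inr i) a) = 0 := by
    intro d a i hi hd ha
    by_contra hne
    have h1 : W.IsBihom (pderiv (Sum.inr i) a) (d - W.wt (Sum.inr i)) :=
      IsWeightedHomogeneous.pderiv ha (sub_add_cancel _ _)
    have h2 := h1.even_of_eval_ne_zero hb hp hne
    simp only [Prod.snd_sub, wt, hb, if_neg hi, Nat.cast_one] at h2
    exact absurd (hd.sub h2) (by simp)
  let ι := {q : Fin 4 × Fin 4 // q.1 ≠ t ∧ q.2 ≠ t ∧ q.1 ≤ q.2}
  have hι : Fintype.card ι = 6 := by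
    clear * -
    revert t
    decide
  -- The Hessian at `x` with respect to the variables other than `x_t`.
  let ℓ₀ : Cox →ₗ[ℂ] (ι → ℂ) := LinearMap.pi fun q => (aeval x).toLinearMap ∘ₗ
    (pderiv (Sum.inr q.1.1)).toLinearMap ∘ₗ (pderiv (Sum.inr q.1.2)).toLinearMap
  have hℓ₀ : ∀ a q, ℓ₀ a q = eval x (pderiv (Sum.inr q.1.1) (pderiv (Sum.inr q.1.2) a)) :=
    fun a q => rfl
  have hmul : ∀ d e a b, Even d.2 → Even e.2 → W.IsBihom a d → W.IsBihom b e →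
      ℓ₀ (a * b) = eval x b • ℓ₀ a + eval x a • ℓ₀ b := by
    intro d e a b hd he ha hb'
    funext q
    simp only [hℓ₀, Derivation.leibniz, smul_eq_mul, map_add, map_mul, Pi.add_apply, Pi.smul_apply,
      hder q.1.1 q.2.1 hd ha, hder q.1.1 q.2.1 he hb', hder q.1.2 q.2.2.1 hd ha,
      hder q.1.2 q.2.2.1 he hb']
    ring
  -- The Hessian of `F` spans the only relation between the quadratic monomials.
  let S : Submodule ℂ (ι → ℂ) := Submodule.span ℂ {ℓ₀ F}
  have hE : 5 ≤ Module.finrank ℂ ((ι → ℂ) ⧸ S) := by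
    have h1 := S.finrank_quotient_add_finrank
    rw [Module.finrank_fintype_fun_eq_card, hι] at h1
    have h2 : Module.finrank ℂ S ≤ 1 := (finrank_span_le_card _).trans (by simp)
    omega
  refine hE.trans (finrank_le_spanFinrank_maximalIdeal (p := p) (S.mkQ ∘ₗ ℓ₀) ?_ ?_ ?_)
  · intro d e a b hd he ha hb'
    rw [LinearMap.comp_apply, hmul d e a b (heven hd) (heven he) ha hb', map_add, map_smul,
      map_smul]
    rfl
  · intro d a hd ha haV
    rw [hV] at haV
    obtain ⟨q, hq, rfl⟩ := exists_bihom_of_mem_span_singleton hF ha haV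
    have hqe : Even (d - dF).2 := (heven hd).sub hdF
    rw [LinearMap.comp_apply, hmul _ _ F q hdF hqe hF hq, hFp, zero_smul, add_zero, map_smul]
    have : S.mkQ (ℓ₀ F) = 0 := by
      rw [Submodule.mkQ_apply, Submodule.Quotient.mk_eq_zero]
      exact Submodule.mem_span_singleton_self _
    rw [this, smul_zero]
  · intro N hN
    have hsingle : ∀ q : ι, S.mkQ (Pi.single q (1 : ℂ)) ∈ N := by
      rintro ⟨⟨k, l⟩, hk, hl, hkl⟩
      simp only at hk hl hkl
      have hbk : W.b k = 1 := by simp [hb, hk]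
      have hbl : W.b l = 1 := by simp [hb, hl]
      have hbt : W.b t = 2 := by simp [hb]
      have hadm : Admissible p (0, 2) := by
        refine ⟨W.xhat j t, ?_, ?_⟩
        · have := isBihom_xhat (W := W) j t
          rwa [hbt] at this
        · rw [eval_xhat]
          exact mul_ne_zero hpt (pow_ne_zero _ hpj)
      have h1 := hN (0, 2) (W.xhat j k * W.xhat j l) hadm (by
        have := (isBihom_xhat (W := W) j k).mul (isBihom_xhat j l)
        rw [hbk, hbl] at this
        exact this) (by rw [← hx, map_mul, eval_xhat, hp k hk, zero_mul, zero_mul])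
      let c : ℂ := x (Sum.inl j) ^ W.a k * x (Sum.inl j) ^ W.a l
      have hc : c ≠ 0 := mul_ne_zero (pow_ne_zero _ hpj) (pow_ne_zero _ hpj)
      have h2 : ℓ₀ (W.xhat j k * W.xhat j l) =
          (if k = l then 2 * c else c) • Pi.single ⟨(k, l), hk, hl, hkl⟩ (1 : ℂ) := by
        funext ⟨⟨k', l'⟩, hk', hl', hkl'⟩
        simp only at hk' hl' hkl'
        have hXj : ∀ i : Fin 4, pderiv (Sum.inr i) (X (Sum.inl j) : Cox) = 0 := fun i =>
          pderiv_X_of_ne (by simp)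
        have hX : ∀ i i' : Fin 4, pderiv (Sum.inr i) (X (Sum.inr i') : Cox) =
            C (if i = i' then 1 else 0) := by
          intro i i'
          by_cases h : i = i'
          · simp [h]
          · rw [pderiv_X_of_ne (by simpa using Ne.symm h), if_neg h, C_0]
        have hs : (Pi.single (M := fun _ : ι => ℂ) ⟨(k, l), hk, hl, hkl⟩ 1
            ⟨(k', l'), hk', hl', hkl'⟩ : ℂ) = if k' = k ∧ l' = l then 1 else 0 := by
          rw [Pi.single_apply]
          exact if_congr (by rw [Subtype.mk.injEq, Prod.mk.injEq]) rfl rfl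
        rw [hℓ₀, Pi.smul_apply, hs]
        simp only [xhat, Derivation.leibniz, Derivation.leibniz_pow, hXj, hX, smul_eq_mul,
          mul_zero, smul_zero, zero_add, add_zero, map_add, map_mul, map_pow, eval_X, eval_C,
          pderiv_C]
        by_cases h1 : k' = k <;> by_cases h2 : l' = l <;> by_cases h3 : k = l <;>
          by_cases h4 : k' = l <;> by_cases h5 : l' = k <;>
          first
          | (exfalso; omega)
          | (simp [h1, h2, h3, h4, h5, Ne.symm h3]; done)
          | (simp [h1, h2, h3, h4, c] <;> ring1)
      rw [LinearMap.comp_apply, h2, map_smul] at h1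
      refine (N.smul_mem_iff ?_).1 h1
      split_ifs
      · exact mul_ne_zero two_ne_zero hc
      · exact hc
    rw [eq_top_iff]
    intro f _
    obtain ⟨f, rfl⟩ := S.mkQ_surjective f
    rw [pi_eq_sum_univ' f, map_sum]
    exact N.sum_mem fun k _ => by
      rw [map_smul]
      exact N.smul_mem _ (hsingle k)

end Subvariety

theorem exists_bihom_of_mem_span_range {ι : Type*} [Fintype ι] {g : ι → Cox} {δ : ι → ℤ × ℤ}
    (hg : ∀ i, W.IsBihom (g i) (δ i)) {a : Cox} {e : ℤ × ℤ} (ha : W.IsBihom a e)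
    (h : a ∈ Ideal.span (Set.range g)) :
    ∃ q : ι → Cox, (∀ i, W.IsBihom (q i) (e - δ i)) ∧ a = ∑ i, g i * q i := by
  obtain ⟨q, rfl⟩ := Ideal.mem_span_range_iff_exists_fun.1 h
  refine ⟨fun i => weightedHomogeneousComponent W.wt (e - δ i) (q i),
    fun i => isBihom_component _ _, ?_⟩
  rw [← component_self ha, map_sum]
  refine Finset.sum_congr rfl fun i _ => ?_
  rw [← component_mul (hg i), add_sub_cancel, mul_comm]

/-- Equations of the torus orbit of a point `x` at which only `X (inl 0)`, `X (inl 1)` and `x_t` do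
not vanish. -/
def vertexEq (x : Fin 2 ⊕ Fin 4 → ℂ) (j : Fin 2) (t : Fin 4) (l : Fin 4) : Cox :=
  if l = t then X (Sum.inl (1 - j)) - C (x (Sum.inl (1 - j)) / x (Sum.inl j)) * X (Sum.inl j)
  else X (Sum.inr l)

theorem isBihom_vertexEq (x : Fin 2 ⊕ Fin 4 → ℂ) (j : Fin 2) (t : Fin 4) (l : Fin 4) :
    W.IsBihom (vertexEq x j t l) (if l = t then (1, 0) else W.wt (Sum.inr l)) := by
  by_cases h : l = t
  · simp only [vertexEq, h, if_true]
    exact (isBihom_X (W := W) (Sum.inl (1 - j))).sub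
      ((isBihom_X (W := W) (Sum.inl j)).C_mul _)
  · simp only [vertexEq, h, if_false]
    exact isBihom_X _

/-- A bihomogeneous polynomial vanishing at `x` vanishes on the closure of the orbit of `x`. -/
theorem IsBihom.mem_span_vertexEq {t : Fin 4} (ht : W.b t = 2) {x : Fin 2 ⊕ Fin 4 → ℂ}
    (hx : ∀ i, i ≠ t → x (Sum.inr i) = 0) {j : Fin 2} (hxj : x (Sum.inl j) ≠ 0)
    (hxt : x (Sum.inr t) ≠ 0) {a : Cox} {d : ℤ × ℤ} (ha : W.IsBihom a d) (h0 : eval x a = 0) :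
    a ∈ Ideal.span (Set.range (vertexEq x j t)) := by
  let I := Ideal.span (Set.range (vertexEq x j t))
  have hI : ∀ l, vertexEq x j t l ∈ I := fun l => Ideal.subset_span ⟨l, rfl⟩
  let θX : Fin 2 ⊕ Fin 4 → Cox := Sum.elim
    (fun j' => C (x (Sum.inl j') / x (Sum.inl j)) * X (Sum.inl j))
    (fun l => if l = t then X (Sum.inr t) else 0)
  have hmod : a - aeval θX a ∈ I := by
    rw [← Ideal.Quotient.eq_zero_iff_mem, map_sub, sub_eq_zero]
    suffices h : (Ideal.Quotient.mkₐ ℂ I) = (Ideal.Quotient.mkₐ ℂ I).comp (aeval θX) from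
      DFunLike.congr_fun h a
    refine MvPolynomial.algHom_ext fun k => ?_
    rw [AlgHom.comp_apply, aeval_X, ← sub_eq_zero, ← map_sub]
    refine Ideal.Quotient.eq_zero_iff_mem.2 ?_
    rcases k with j' | l
    · by_cases hj : j' = j
      · simp [θX, hj, hxj]
      · have h1 : j' = 1 - j := by
          revert hj; clear * -; revert j' j; decide
        have := hI t
        rwa [vertexEq, if_pos rfl, ← h1] at this
    · by_cases hl : l = t
      · simp [θX, hl]
      · have := hI l
        rw [vertexEq, if_neg hl] at this
        simpa [θX, hl] using this
  have hθ : aeval θX a = 0 := by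
    have hmul : aeval θX a * (X (Sum.inl j) * X (Sum.inr t)) = 0 := by
      refine MvPolynomial.funext fun z => ?_
      rw [map_mul, map_mul, eval_X, eval_X, map_zero]
      by_cases hz : z (Sum.inl j) * z (Sum.inr t) = 0
      · rw [hz, mul_zero]
      have hzj := left_ne_zero_of_mul hz
      have hzt := right_ne_zero_of_mul hz
      let s : ℂˣ := Units.mk0 _ (div_ne_zero hzj hxj)
      obtain ⟨r, hr⟩ := IsAlgClosed.exists_pow_nat_eq
        (z (Sum.inr t) * (s : ℂ) ^ W.a t / x (Sum.inr t)) (n := 2) two_pos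
      have hr0 : r ≠ 0 := by
        rintro rfl
        rw [zero_pow two_ne_zero, eq_comm] at hr
        exact div_ne_zero (mul_ne_zero hzt (pow_ne_zero _ s.ne_zero)) hxt hr
      have h1 := ha.eval_torus s (Units.mk0 r hr0) x
      rw [h0, mul_zero] at h1
      have h2 : eval z (aeval θX a) = eval (fun k => eval z (θX k)) a := by
        change aeval z _ = aeval _ a
        rw [comp_aeval_apply]
        rfl
      rw [h2]
      refine mul_eq_zero_of_left ?_ _
      rw [← h1]
      congr 2
      funext k
      rcases k with j' | l
      · simp only [θX, Sum.elim_inl, map_mul, eval_C, eval_X, wt, zpow_one, zpow_zero, mul_one, s,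
          Units.val_mk0]
        field_simp
      · by_cases hl : l = t
        · subst hl
          simp only [θX, Sum.elim_inr, if_true, eval_X, wt, ht, zpow_neg, zpow_natCast,
            Units.val_mul, Units.val_inv_eq_inv_val, Units.val_pow_eq_pow_val, Nat.cast_ofNat,
            Units.val_zpow_eq_zpow_val, Units.val_mk0]
          rw [show r ^ (2 : ℤ) = r ^ 2 by norm_cast, hr]
          have := pow_ne_zero (W.a l) s.ne_zero
          field_simp
        · simp [θX, hl, hx l hl]
    exact (mul_eq_zero_iff_right (mul_ne_zero (X_ne_zero _) (X_ne_zero _))).1 hmul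
  rwa [hθ, sub_zero] at hmod

namespace Subvariety

variable {V : W.Subvariety}

theorem toFrac_xhat (j : Fin 2) (l : Fin 4) :
    V.toFrac (W.xhat j l) = V.toFrac (X (Sum.inr l)) * V.toFrac (X (Sum.inl j)) ^ W.a l := by
  simp [xhat]

/-- A hypersurface through a point at which only the variable of weight `2` does not vanish is
singular there: its local ring has dimension at most `4`, and embedding dimension at least `5`. -/
theorem not_isRegularLocalRing_of_vertex {F : Cox} {dF : ℤ × ℤ} (hF : W.IsBihom F dF)
    (hdF : Even dF.2) (hV : V.ideal = Ideal.span {F}) (p : V.Pt) {t : Fin 4}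
    (hb : ∀ i, W.b i = if i = t then 2 else 1) (hp : ∀ i, i ≠ t → p.1.coords (Sum.inr i) = 0) :
    ¬ IsRegularLocalRing (V.localRing p) := by
  intro hreg
  have hlow := five_le_spanFinrank_of_vertex hF hdF hV p hb hp
  obtain ⟨j, hpj⟩ := p.1.exists_inl_ne_zero
  have hpt : p.1.coords (Sum.inr t) ≠ 0 := by
    obtain ⟨i, hi⟩ := p.1.exists_inr_ne_zero
    by_cases h : i = t
    · exact h ▸ hi
    · exact absurd (hp i h) hi
  have hbt : W.b t = 2 := by simp [hb]
  set x := p.1.coords with hx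
  have hxt : eval x (W.xhat j t) ≠ 0 := by
    rw [eval_xhat]
    exact mul_ne_zero hpt (pow_ne_zero _ hpj)
  have hxj : eval x (X (Sum.inl j)) ≠ 0 := by simpa using hpj
  have hT : V.toFrac (W.xhat j t) ≠ 0 := toFrac_ne_zero.2 (notMem_of_eval_ne_zero p hxt)
  have hU : V.toFrac (X (Sum.inl j)) ≠ 0 := toFrac_ne_zero.2 (notMem_of_eval_ne_zero p hxj)
  have hsq : ∀ l, l ≠ t → W.IsBihom (W.xhat j l ^ 2) (0, (W.b t : ℤ)) := by
    intro l hl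
    have := (isBihom_xhat (W := W) j l).pow 2
    have h : 2 • ((0 : ℤ), (W.b l : ℤ)) = (0, (W.b t : ℤ)) := by
      ext <;> simp [hb, hl]
    exact h ▸ this
  -- The squares of three coordinates, and a coordinate on the base.
  let σ : Fin 4 → V.localRing p := fun l =>
    if hl : l = t then ⟨V.frac (vertexEq x j t t) (X (Sum.inl j)), (1, 0), _, _, by
        have := isBihom_vertexEq (W := W) x j t t
        rwa [if_pos rfl] at this, isBihom_X (W := W) (Sum.inl j), hxj, rfl⟩
    else ⟨V.frac (W.xhat j l ^ 2) (W.xhat j t), _, _, _, hsq l hl, isBihom_xhat j t, hxt, rfl⟩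
  classical
  have hup := IsRegularLocalRing.spanFinrank_maximalIdeal_le_card (Finset.univ.image σ) ?_ ?_
  · have := Finset.card_image_le (s := Finset.univ) (f := σ)
    simp only [Finset.card_univ, Fintype.card_fin] at this
    omega
  · intro z hz
    obtain ⟨l, -, rfl⟩ := Finset.mem_image.1 hz
    by_cases hl : l = t
    · simp only [σ, hl, dite_true]
      have h1 := isBihom_vertexEq (W := W) x j t t
      rw [if_pos rfl] at h1
      refine (mem_maximalIdeal_iff h1 (isBihom_X (W := W) (Sum.inl j)) hxj _ rfl).2 ?_
      rw [← hx]
      simp only [vertexEq, if_true, map_sub, map_mul, eval_X, eval_C]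
      rw [div_mul_cancel₀ _ hpj, sub_self]
    · simp only [σ, hl, dite_false]
      refine (mem_maximalIdeal_iff (hsq l hl) (isBihom_xhat j t) hxt _ rfl).2 ?_
      rw [← hx, map_pow, eval_xhat, hp l hl, zero_mul, zero_pow two_ne_zero]
  intro P hP hsP z hz
  obtain ⟨d, a, b, ha, hb', hbp, hzab⟩ := mem_localRing.1 z.2
  have hap := (mem_maximalIdeal_iff ha hb' hbp z hzab).1 hz
  obtain ⟨q, hq, haq⟩ := exists_bihom_of_mem_span_range (isBihom_vertexEq (W := W) x j t) ha
    (ha.mem_span_vertexEq hbt hp hpj hpt hap)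
  have hterm : ∀ l, W.IsBihom (vertexEq x j t l * q l) d := by
    intro l
    have := (isBihom_vertexEq (W := W) x j t l).mul (hq l)
    rwa [add_sub_cancel] at this
  let ζ : Fin 4 → V.localRing p := fun l =>
    ⟨V.frac (vertexEq x j t l * q l) b, d, _, b, hterm l, hb', hbp, rfl⟩
  have hzζ : z = ∑ l, ζ l := by
    ext
    rw [hzab, haq, AddSubmonoidClass.coe_finsetSum]
    simp only [ζ, frac_def, map_sum, Finset.sum_div]
  rw [hzζ]
  refine P.sum_mem fun l _ => ?_
  have hσ : σ l ∈ P := hsP _ (Finset.mem_image_of_mem _ (Finset.mem_univ _))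
  have hB : V.toFrac b ≠ 0 := toFrac_ne_zero.2 (notMem_of_eval_ne_zero p hbp)
  by_cases hl : l = t
  · subst hl
    have hq' := hq l
    rw [if_pos rfl] at hq'
    have hm : W.IsBihom (X (Sum.inl j) * q l) d := by
      have := (isBihom_X (W := W) (Sum.inl j)).mul hq'
      rwa [show W.wt (Sum.inl j) = (1, 0) from rfl, add_sub_cancel] at this
    have h1 : ζ l = σ l * ⟨V.frac (X (Sum.inl j) * q l) b, d, _, b, hm, hb', hbp, rfl⟩ := by
      ext
      simp only [ζ, σ, dite_true, MulMemClass.coe_mul, frac_def, map_mul]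
      field_simp
    rw [h1]
    exact P.mul_mem_right _ hσ
  · have hq' := hq l
    rw [if_neg hl] at hq'
    -- `xₗ` itself is not a function near `p`, but the square of a multiple of it is a multiple of
    -- the function `xₗ²`, which lies in `P`.
    refine hP.mem_of_pow_mem 2 ?_
    have hm : W.IsBihom (W.xhat j t * q l ^ 2) (2 • d + ((2 * W.a l : ℕ) : ℤ) • (1, 0)) := by
      refine IsBihom.congr ((isBihom_xhat (W := W) j t).mul (hq'.pow 2)) ?_
      ext <;> simp [wt, hb, hl] <;> ring
    have hm' : W.IsBihom (b ^ 2 * X (Sum.inl j) ^ (2 * W.a l))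
        (2 • d + ((2 * W.a l : ℕ) : ℤ) • (1, 0)) := by
      refine IsBihom.congr ((hb'.pow 2).mul ((isBihom_X (W := W) (Sum.inl j)).pow (2 * W.a l))) ?_
      ext <;> simp [wt]
    have hmp : eval x (b ^ 2 * X (Sum.inl j) ^ (2 * W.a l)) ≠ 0 := by
      rw [map_mul, map_pow, map_pow]
      exact mul_ne_zero (pow_ne_zero _ hbp) (pow_ne_zero _ hxj)
    have h1 : ζ l ^ 2 = σ l * ⟨V.frac (W.xhat j t * q l ^ 2) (b ^ 2 * X (Sum.inl j) ^ (2 * W.a l)),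
        _, _, _, hm, hm', hmp, rfl⟩ := by
      ext
      simp only [ζ, σ, hl, dite_false, MulMemClass.coe_mul, SubmonoidClass.coe_pow, frac_def,
        map_mul, map_pow, vertexEq, if_false, toFrac_xhat j l]
      field_simp
      ring
    rw [h1]
    exact P.mul_mem_right _ hσ

end Subvariety

end ScrollData

/-! ### Orders of rational functions on smooth rational curves -/

theorem Ring.ord_eq_one_of_isMaximal {R : Type*} [CommRing R] {x : R}
    (h : (Ideal.span {x}).IsMaximal) : Ring.ord R x = 1 := by
  rw [Ring.ord, Module.length_eq_one_iff]
  exact isSimpleModule_iff_isCoatom.2 h.out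

namespace ScrollData

variable {W : ScrollData}

namespace Subvariety

/-- A parametrization `ψ` of the curve `C` near the smooth point `p`, by a variable that vanishes
at `p` and is itself the restriction of a rational function `Z₁ / Z₀` on `C`. -/
structure IsLocalParam (C : W.Subvariety) (p : C.Pt) (ψ : Cox →ₐ[ℂ] Polynomial ℂ) : Prop where
  mem_iff : ∀ d a, W.IsBihom a d → (a ∈ C.ideal ↔ ψ a = 0)
  eval_iff : ∀ d a, W.IsBihom a d → (eval p.1.coords a = 0 ↔ (ψ a).eval 0 = 0)
  exists_coord : ∃ e Z₀ Z₁, W.IsBihom Z₀ e ∧ W.IsBihom Z₁ e ∧ ψ Z₀ = 1 ∧ ψ Z₁ = Polynomial.X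

namespace IsLocalParam

variable {C : W.Subvariety} {p : C.Pt} {ψ : Cox →ₐ[ℂ] Polynomial ℂ}

/-- Every polynomial in the parameter is the restriction of a bihomogeneous polynomial. -/
theorem exists_homogenization {e : ℤ × ℤ} {Z₀ Z₁ : Cox} (h₀ : W.IsBihom Z₀ e)
    (h₁ : W.IsBihom Z₁ e) (hψ₀ : ψ Z₀ = 1) (hψ₁ : ψ Z₁ = Polynomial.X) (A : Polynomial ℂ) {N : ℕ}
    (hN : A.natDegree ≤ N) : ∃ a, W.IsBihom a (N • e) ∧ ψ a = A := by
  refine ⟨∑ i ∈ Finset.range (N + 1), C (A.coeff i) * (Z₁ ^ i * Z₀ ^ (N - i)), ?_, ?_⟩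
  · refine IsWeightedHomogeneous.sum _ _ _ fun i hi => IsWeightedHomogeneous.C_mul ?_ _
    refine IsBihom.congr ((h₁.pow i).mul (h₀.pow (N - i))) ?_
    rw [← add_nsmul, Nat.add_sub_cancel' (Nat.lt_succ_iff.1 (Finset.mem_range.1 hi))]
  · rw [map_sum]
    conv_rhs => rw [A.as_sum_range_C_mul_X_pow' (Nat.lt_succ_of_le hN)]
    refine Finset.sum_congr rfl fun i _ => ?_
    rw [map_mul, map_mul, map_pow, map_pow, hψ₀, hψ₁, one_pow, mul_one]
    congr 1
    exact ψ.commutes _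

/-- An element of the local ring is a power of the parameter times a unit. -/
theorem exists_eq_pow_mul (h : IsLocalParam C p ψ) {e : ℤ × ℤ} {Z₀ Z₁ : Cox}
    (h₀ : W.IsBihom Z₀ e) (h₁ : W.IsBihom Z₁ e) (hψ₀ : ψ Z₀ = 1) (hψ₁ : ψ Z₁ = Polynomial.X)
    (π : C.localRing p) (hπ : (π : C.Frac) = C.frac Z₁ Z₀) {α : C.localRing p} {d : ℤ × ℤ}
    {a b : Cox} (ha : W.IsBihom a d) (hb : W.IsBihom b d) (haC : a ∉ C.ideal)
    (hbp : eval p.1.coords b ≠ 0) (hα : (α : C.Frac) = C.frac a b) :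
    ∃ υ, IsUnit υ ∧ α = π ^ (ψ a).rootMultiplicity 0 * υ := by
  have ha0 : ψ a ≠ 0 := fun h' => haC ((h.mem_iff d a ha).2 h')
  obtain ⟨q, hq, hq0⟩ := Polynomial.exists_eq_pow_rootMultiplicity_mul_and_not_dvd (ψ a) ha0 0
  rw [Polynomial.dvd_iff_isRoot, Polynomial.IsRoot.def] at hq0
  rw [Polynomial.C_0, sub_zero] at hq
  set n := (ψ a).rootMultiplicity 0
  let N := max q.natDegree (ψ b).natDegree
  obtain ⟨A, hA, hAq⟩ := exists_homogenization h₀ h₁ hψ₀ hψ₁ q (N := N) (le_max_left _ _)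
  obtain ⟨B, hB, hBb⟩ := exists_homogenization h₀ h₁ hψ₀ hψ₁ (ψ b) (N := N) (le_max_right _ _)
  have hAp : eval p.1.coords A ≠ 0 := by rwa [Ne, h.eval_iff _ _ hA, hAq]
  have hBp : eval p.1.coords B ≠ 0 := by rwa [Ne, h.eval_iff _ _ hB, hBb, ← h.eval_iff _ _ hb]
  have hZ₀ : Z₀ ∉ C.ideal := by
    rw [h.mem_iff _ _ h₀, hψ₀]
    exact one_ne_zero
  have hbC := notMem_of_eval_ne_zero p hbp
  have hBC := notMem_of_eval_ne_zero p hBp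
  let υ : C.localRing p := ⟨C.frac A B, _, A, B, hA, hB, hBp, rfl⟩
  refine ⟨υ, (isUnit_localRing_iff hA hB hBp υ rfl).2 hAp, ?_⟩
  ext
  have hpow : C.frac Z₁ Z₀ ^ n = C.frac (Z₁ ^ n) (Z₀ ^ n) := by
    simp only [frac_def, map_pow, div_pow]
  rw [MulMemClass.coe_mul, SubmonoidClass.coe_pow, hα, hπ, hpow, frac_mul_frac,
    frac_eq_frac hbC (mul_notMem (fun h' => hZ₀ (C.prime.mem_of_pow_mem _ h')) hBC)]
  have hd1 : W.IsBihom (a * (Z₀ ^ n * B)) (d + (n • e + N • e)) :=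
    IsWeightedHomogeneous.mul ha ((h₀.pow n).mul hB)
  have hd2 : W.IsBihom (Z₁ ^ n * A * b) (d + (n • e + N • e)) := by
    rw [add_comm]
    exact IsWeightedHomogeneous.mul ((h₁.pow n).mul hA) hb
  rw [h.mem_iff _ _ (hd1.sub hd2)]
  simp only [map_sub, map_mul, map_pow, hψ₀, hψ₁, hAq, hBb, one_pow, one_mul]
  rw [hq]
  ring

theorem ord_eq (h : IsLocalParam C p ψ) {α : C.localRing p} {d : ℤ × ℤ} {a b : Cox}
    (ha : W.IsBihom a d) (hb : W.IsBihom b d) (haC : a ∉ C.ideal) (hbp : eval p.1.coords b ≠ 0)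
    (hα : (α : C.Frac) = C.frac a b) :
    Ring.ord (C.localRing p) α = ((ψ a).rootMultiplicity 0 : ℕ) := by
  obtain ⟨e, Z₀, Z₁, h₀, h₁, hψ₀, hψ₁⟩ := h.exists_coord
  have hZ₀ : eval p.1.coords Z₀ ≠ 0 := by
    rw [Ne, h.eval_iff _ _ h₀, hψ₀]
    simp
  have hZ₁ : Z₁ ∉ C.ideal := by
    rw [h.mem_iff _ _ h₁, hψ₁]
    exact Polynomial.X_ne_zero
  let π : C.localRing p := ⟨C.frac Z₁ Z₀, e, Z₁, Z₀, h₁, h₀, hZ₀, rfl⟩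
  have hπ0 : π ≠ 0 := by
    intro h0
    have h1 : C.frac Z₁ Z₀ = 0 := congrArg Subtype.val h0
    rw [frac_def] at h1
    exact div_ne_zero (toFrac_ne_zero.2 hZ₁)
      (toFrac_ne_zero.2 (notMem_of_eval_ne_zero p hZ₀)) h1
  have hmax : (Ideal.span {π}).IsMaximal := by
    rw [Ideal.isMaximal_iff]
    constructor
    · rw [← Ideal.eq_top_iff_one, Ideal.span_singleton_eq_top,
        isUnit_localRing_iff h₁ h₀ hZ₀ π rfl, not_not, h.eval_iff _ _ h₁, hψ₁]
      simp
    · intro J x hJ hx hxJ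
      obtain ⟨d', a', b', ha', hb', hbp', hx'⟩ := mem_localRing.1 x.2
      have haC' : a' ∉ C.ideal := by
        intro haC'
        apply hx
        have : x = 0 := by
          ext
          rw [hx', frac_def, toFrac_eq_zero.2 haC', zero_div]
          rfl
        rw [this]
        exact Ideal.zero_mem _
      obtain ⟨υ, hυ, hxυ⟩ := h.exists_eq_pow_mul h₀ h₁ hψ₀ hψ₁ π rfl ha' hb' haC' hbp' hx'
      rcases Nat.eq_zero_or_pos ((ψ a').rootMultiplicity 0) with h0 | h0
      · rw [h0, pow_zero, one_mul] at hxυ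
        rw [← Ideal.eq_top_iff_one]
        exact J.eq_top_of_isUnit_mem hxJ (hxυ ▸ hυ)
      · refine absurd (Ideal.mem_span_singleton.2 ?_) hx
        rw [hxυ]
        exact Dvd.dvd.mul_right (dvd_pow_self _ h0.ne') _
  have hπ1 := Ring.ord_eq_one_of_isMaximal hmax
  obtain ⟨υ, hυ, hαυ⟩ := h.exists_eq_pow_mul h₀ h₁ hψ₀ hψ₁ π rfl ha hb haC hbp hα
  rw [hαυ, Ring.ord_mul_of_isUnit_right hυ, Ring.ord_pow (mem_nonZeroDivisors_of_ne_zero hπ0), hπ1]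
  simp

/-- The order of a rational function at a point with a local parametrization. -/
theorem ordAt_frac (h : IsLocalParam C p ψ) {d : ℤ × ℤ} {a b : Cox} (ha : W.IsBihom a d)
    (hb : W.IsBihom b d) (haC : a ∉ C.ideal) (hbC : b ∉ C.ideal) :
    C.ordAt p (C.frac a b) =
      ((ψ a).rootMultiplicity 0 : ℤ) - ((ψ b).rootMultiplicity 0 : ℤ) := by
  obtain ⟨e, Z₀, Z₁, h₀, h₁, hψ₀, hψ₁⟩ := h.exists_coord
  have hZ₀ : eval p.1.coords Z₀ ≠ 0 := by
    rw [Ne, h.eval_iff _ _ h₀, hψ₀]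
    simp
  let N := max (ψ a).natDegree (ψ b).natDegree
  obtain ⟨A, hA, hAa⟩ := exists_homogenization h₀ h₁ hψ₀ hψ₁ (ψ a) (N := N) (le_max_left _ _)
  obtain ⟨B, hB, hBb⟩ := exists_homogenization h₀ h₁ hψ₀ hψ₁ (ψ b) (N := N) (le_max_right _ _)
  have hAC : A ∉ C.ideal := by rwa [h.mem_iff _ _ hA, hAa, ← h.mem_iff _ _ ha]
  have hBC : B ∉ C.ideal := by rwa [h.mem_iff _ _ hB, hBb, ← h.mem_iff _ _ hb]
  have hZN : eval p.1.coords (Z₀ ^ N) ≠ 0 := by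
    rw [map_pow]
    exact pow_ne_zero _ hZ₀
  have hZC := notMem_of_eval_ne_zero p hZN
  let α₀ : C.localRing p := ⟨C.frac A (Z₀ ^ N), N • e, A, Z₀ ^ N, hA, h₀.pow N, hZN, rfl⟩
  let β₀ : C.localRing p := ⟨C.frac B (Z₀ ^ N), N • e, B, Z₀ ^ N, hB, h₀.pow N, hZN, rfl⟩
  have hne : ∀ {A : Cox}, A ∉ C.ideal → C.frac A (Z₀ ^ N) ≠ 0 := fun hA' =>
    div_ne_zero (toFrac_ne_zero.2 hA') (toFrac_ne_zero.2 hZC)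
  have hex : ∃ n : ℤ, ∃ α β : C.localRing p, α ≠ 0 ∧ β ≠ 0 ∧
      C.frac a b * (β : C.Frac) = (α : C.Frac) ∧
      n = ((Ring.ord (C.localRing p) α).toNat : ℤ) - ((Ring.ord (C.localRing p) β).toNat : ℤ) := by
    refine ⟨_, α₀, β₀, fun h' => hne hAC (congrArg Subtype.val h'),
      fun h' => hne hBC (congrArg Subtype.val h'), ?_, rfl⟩
    simp only [α₀, β₀]
    rw [frac_mul_frac, frac_eq_frac (mul_notMem hbC hZC) hZC]
    have hd1 : W.IsBihom (a * B * Z₀ ^ N) (d + N • e + N • e) :=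
      IsWeightedHomogeneous.mul (ha.mul hB) (h₀.pow N)
    have hd2 : W.IsBihom (A * (b * Z₀ ^ N)) (d + N • e + N • e) :=
      IsBihom.congr (IsWeightedHomogeneous.mul hA (hb.mul (h₀.pow N))) (by abel)
    rw [h.mem_iff _ _ (hd1.sub hd2)]
    simp only [map_sub, map_mul, map_pow, hψ₀, hAa, hBb, one_pow, mul_one]
    ring
  obtain ⟨α, β, hα0, hβ0, hχ, hn⟩ := Classical.epsilon_spec hex
  refine hn.trans ?_
  obtain ⟨d₁, a₁, b₁, ha₁, hb₁, hbp₁, hα⟩ := mem_localRing.1 α.2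
  obtain ⟨d₂, a₂, b₂, ha₂, hb₂, hbp₂, hβ⟩ := mem_localRing.1 β.2
  have hnot : ∀ {γ : C.localRing p} {a' b' : Cox}, γ ≠ 0 → (γ : C.Frac) = C.frac a' b' →
      a' ∉ C.ideal := by
    intro γ a' b' hγ hγ' ha'
    apply hγ
    ext
    rw [hγ', frac_def, toFrac_eq_zero.2 ha', zero_div]
    rfl
  have haC₁ := hnot hα0 hα
  have haC₂ := hnot hβ0 hβ
  rw [h.ord_eq ha₁ hb₁ haC₁ hbp₁ hα, h.ord_eq ha₂ hb₂ haC₂ hbp₂ hβ,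
    ENat.toNat_natCast, ENat.toNat_natCast]
  rw [hα, hβ, frac_mul_frac, frac_eq_frac (mul_notMem hbC (notMem_of_eval_ne_zero p hbp₂))
    (notMem_of_eval_ne_zero p hbp₁)] at hχ
  have hd1 : W.IsBihom (a * a₂ * b₁) (d + d₂ + d₁) := IsWeightedHomogeneous.mul (ha.mul ha₂) hb₁
  have hd2 : W.IsBihom (a₁ * (b * b₂)) (d + d₂ + d₁) :=
    IsBihom.congr (IsWeightedHomogeneous.mul ha₁ (hb.mul hb₂)) (by abel)
  rw [h.mem_iff _ _ (hd1.sub hd2), map_sub, sub_eq_zero] at hχ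
  simp only [map_mul] at hχ
  have hz : ∀ {d' : ℤ × ℤ} {c : Cox}, W.IsBihom c d' → c ∉ C.ideal → ψ c ≠ 0 :=
    fun hc hcC h' => hcC ((h.mem_iff _ _ hc).2 h')
  have hroot : ∀ {d' : ℤ × ℤ} {c : Cox}, W.IsBihom c d' → eval p.1.coords c ≠ 0 →
      (ψ c).rootMultiplicity 0 = 0 := fun hc hcp =>
    Polynomial.rootMultiplicity_eq_zero fun h' => hcp ((h.eval_iff _ _ hc).2 h')
  have hm := congrArg (Polynomial.rootMultiplicity 0) hχ
  have hb₁' := hz hb₁ (notMem_of_eval_ne_zero p hbp₁)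
  have hb₂' := hz hb₂ (notMem_of_eval_ne_zero p hbp₂)
  rw [Polynomial.rootMultiplicity_mul (mul_ne_zero (mul_ne_zero (hz ha haC) (hz ha₂ haC₂)) hb₁'),
    Polynomial.rootMultiplicity_mul (mul_ne_zero (hz ha haC) (hz ha₂ haC₂)),
    Polynomial.rootMultiplicity_mul (mul_ne_zero (hz ha₁ haC₁) (mul_ne_zero (hz hb hbC) hb₂')),
    Polynomial.rootMultiplicity_mul (mul_ne_zero (hz hb hbC) hb₂'),
    hroot hb₁ hbp₁, hroot hb₂ hbp₂] at hm
  omega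

end IsLocalParam

end Subvariety

end ScrollData

/-! ### Smooth rational curves -/

/-- If `B(z) = zⁿ A(1/z)`, then `n` is the sum of the degree of `A` and of the order of `B` at
`0`. -/
theorem Polynomial.rootMultiplicity_zero_add_natDegree {A B : Polynomial ℂ} {n : ℤ} (hA : A ≠ 0)
    (h : ∀ z : ℂ, z ≠ 0 → B.eval z = z ^ n * A.eval z⁻¹) :
    (B.rootMultiplicity 0 : ℤ) + A.natDegree = n := by
  have hrev : ∀ z : ℂ, z ≠ 0 → A.reverse.eval z = z ^ A.natDegree * A.eval z⁻¹ := by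
    intro z hz
    have hz' : z⁻¹ ≠ 0 := inv_ne_zero hz
    let _ : Invertible z⁻¹ := invertibleOfNonzero hz'
    have := A.eval₂_reverse_mul_pow (RingHom.id ℂ) z⁻¹
    rw [invOf_eq_inv, inv_inv] at this
    change A.reverse.eval z * _ = A.eval z⁻¹ at this
    rw [← this, inv_pow, mul_comm, mul_assoc, inv_mul_cancel₀ (pow_ne_zero _ hz), mul_one]
  have hrev0 : A.reverse.eval 0 ≠ 0 := by
    rw [← Polynomial.coeff_zero_eq_eval_zero, Polynomial.coeff_zero_reverse]
    exact Polynomial.leadingCoeff_ne_zero.2 hA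
  have hrevne : A.reverse ≠ 0 := fun h0 => hrev0 (by rw [h0, Polynomial.eval_zero])
  -- Clear the negative exponents in `B(z) z^deg A = zⁿ A.reverse(z)`.
  have key : B * Polynomial.X ^ (A.natDegree + (-n).toNat) =
      A.reverse * Polynomial.X ^ n.toNat := by
    refine Polynomial.eq_of_infinite_eval_eq _ _ (Set.Infinite.mono ?_
      (Set.Finite.infinite_compl (Set.finite_singleton (0 : ℂ))))
    intro z hz
    have hz : z ≠ 0 := hz
    simp only [Set.mem_ofPred_eq, Polynomial.eval_mul, Polynomial.eval_pow, Polynomial.eval_X,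
      h z hz, hrev z hz]
    have h1 : z ^ n * z ^ (-n).toNat = z ^ n.toNat := by
      rw [← zpow_natCast, ← zpow_natCast, ← zpow_add₀ hz]
      congr 1
      omega
    rw [pow_add, ← h1]
    ring
  have hB : B ≠ 0 := by
    rintro rfl
    rw [zero_mul, eq_comm] at key
    exact mul_ne_zero hrevne (pow_ne_zero _ Polynomial.X_ne_zero) key
  have hX : ∀ m : ℕ, (Polynomial.X ^ m : Polynomial ℂ).rootMultiplicity 0 = m := by
    intro m
    have := Polynomial.rootMultiplicity_X_sub_C_pow (0 : ℂ) m
    rwa [Polynomial.C_0, sub_zero] at this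
  have := congrArg (Polynomial.rootMultiplicity 0) key
  rw [Polynomial.rootMultiplicity_mul (mul_ne_zero hB (pow_ne_zero _ Polynomial.X_ne_zero)),
    Polynomial.rootMultiplicity_mul (mul_ne_zero hrevne (pow_ne_zero _ Polynomial.X_ne_zero)), hX,
    hX,
    Polynomial.rootMultiplicity_eq_zero (p := A.reverse) hrev0] at this
  omega

namespace ScrollData

variable {W : ScrollData}

/-- A parametrized curve in `𝓕` isomorphic to `ℙ¹`. The coordinates on the affine line in `ℙ¹`
are the polynomials `par k`; those on the neighbourhood of infinity are `parInf k`, as polynomials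
in the inverse `z⁻¹` of the parameter. A bihomogeneous polynomial of bidegree `d` has degree `deg d`
on the curve; `Z₁ / Z₀` restricts to the parameter. -/
structure RatCurve (W : ScrollData) where
  deg : ℤ × ℤ →+ ℤ
  par : Fin 2 ⊕ Fin 4 → Polynomial ℂ
  parInf : Fin 2 ⊕ Fin 4 → Polynomial ℂ
  eval_parInf : ∀ k (z : ℂ), z ≠ 0 → (parInf k).eval z = z ^ deg (W.wt k) * (par k).eval z⁻¹
  par_inl : par (Sum.inl 0) = 1
  index : Fin 4
  par_index : par (Sum.inr index) = 1
  parInf_inl : ∃ j, (parInf (Sum.inl j)).eval 0 ≠ 0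
  parInf_inr : ∃ i, (parInf (Sum.inr i)).eval 0 ≠ 0
  bideg : ℤ × ℤ
  Z₀ : Cox
  Z₁ : Cox
  isBihom_Z₀ : W.IsBihom Z₀ bideg
  isBihom_Z₁ : W.IsBihom Z₁ bideg
  par_Z₀ : aeval par Z₀ = 1
  par_Z₁ : aeval par Z₁ = Polynomial.X
  parInf_Z₀ : aeval parInf Z₀ = Polynomial.X
  parInf_Z₁ : aeval parInf Z₁ = 1
  exhausts : ∀ x : W.Stable, (∀ d f, W.IsBihom f d → aeval par f = 0 → eval x.1 f = 0) →
    ∃ s t : ℂˣ,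
      (∃ z, ∀ k, (par k).eval z = ((s ^ (W.wt k).1 * t ^ (W.wt k).2 : ℂˣ) : ℂ) * x.1 k) ∨
      (∀ k, (parInf k).eval 0 = ((s ^ (W.wt k).1 * t ^ (W.wt k).2 : ℂˣ) : ℂ) * x.1 k)

namespace RatCurve

variable (Γ : RatCurve W)

/-- Restriction of polynomials to the curve, keeping track of the bidegree. -/
def gradedRestr : Cox →ₐ[ℂ] AddMonoidAlgebra (Polynomial ℂ) (ℤ × ℤ) :=
  aeval fun k => AddMonoidAlgebra.single (W.wt k) (Γ.par k)

variable {Γ} in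
theorem gradedRestr_of_isBihom {a : Cox} {d : ℤ × ℤ} (ha : W.IsBihom a d) :
    Γ.gradedRestr a = AddMonoidAlgebra.single d (aeval Γ.par a) := by
  have h := ha.aeval_mul (A := AddMonoidAlgebra (Polynomial ℂ) (ℤ × ℤ))
    (c := fun e => AddMonoidAlgebra.single e 1) rfl
    (fun d e => by rw [AddMonoidAlgebra.single_mul_single, one_mul])
    (fun k => AddMonoidAlgebra.singleZeroAlgHom (R := ℂ) (Γ.par k))
  rw [← comp_aeval_apply] at h
  simp only [AddMonoidAlgebra.singleZeroAlgHom_apply, AddMonoidAlgebra.single_mul_single, add_zero,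
    one_mul] at h
  exact h

theorem gradedRestr_eq_zero_iff {f : Cox} : Γ.gradedRestr f = 0 ↔
    ∀ d, aeval Γ.par (weightedHomogeneousComponent W.wt d f) = 0 := by
  obtain ⟨s, hs⟩ := sum_component (W := W) f
  constructor
  · intro h d
    have hc : ∀ e, weightedHomogeneousComponent W.wt e f = 0 ∨ e ∈ s := by
      intro e
      by_contra! he
      apply he.1
      rw [hs, map_sum]
      refine Finset.sum_eq_zero fun e' he' => ?_
      refine IsWeightedHomogeneous.weightedHomogeneousComponent_ne
        e (isBihom_component f e') fun h => he.2 (h ▸ he')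
    rcases hc d with hd | hd
    · rw [hd, map_zero]
    · rw [hs, map_sum, Finset.sum_congr rfl fun e _ =>
        gradedRestr_of_isBihom (Γ := Γ) (isBihom_component f e)] at h
      have h1 := congrArg (fun u => u.coeff d) h
      classical
      simpa [Finsupp.single_apply, hd] using h1
  · intro h
    rw [hs, map_sum]
    refine Finset.sum_eq_zero fun d _ => ?_
    rw [gradedRestr_of_isBihom (isBihom_component f d), h d]
    simp

/-- The curve as a subvariety of `𝓕`. -/
def toSubvariety : W.Subvariety where
  ideal := RingHom.ker Γ.gradedRestr
  prime := RingHom.ker_isPrime _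
  bihom f hf d := by
    rw [RingHom.mem_ker] at hf ⊢
    rw [gradedRestr_of_isBihom (isBihom_component f d), Γ.gradedRestr_eq_zero_iff.1 hf d]
    simp
  relevant h := by
    have hmem : (X (Sum.inl 0) * X (Sum.inr Γ.index) : Cox) ∈ irrelevantIdeal :=
      ⟨Ideal.mul_mem_right _ _ (Ideal.subset_span ⟨0, rfl⟩),
        Ideal.mul_mem_left _ _ (Ideal.subset_span ⟨Γ.index, rfl⟩)⟩
    have h0 := RingHom.mem_ker.1 (h hmem)
    rw [gradedRestr_of_isBihom
      (IsWeightedHomogeneous.mul (isBihom_X (W := W) _) (isBihom_X _))] at h0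
    simp only [map_mul, aeval_X, Γ.par_inl, Γ.par_index, mul_one] at h0
    exact one_ne_zero (AddMonoidAlgebra.single_eq_zero.1 h0)

variable {Γ}

theorem mem_ideal_iff {a : Cox} {d : ℤ × ℤ} (ha : W.IsBihom a d) :
    a ∈ Γ.toSubvariety.ideal ↔ aeval Γ.par a = 0 := by
  change Γ.gradedRestr a = 0 ↔ _
  rw [gradedRestr_of_isBihom ha, AddMonoidAlgebra.single_eq_zero]

theorem eval_restr (z : ℂ) (a : Cox) :
    (aeval Γ.par a).eval z = eval (fun k => (Γ.par k).eval z) a := by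
  change Polynomial.aeval z _ = aeval _ a
  rw [comp_aeval_apply]
  rfl

theorem eval_restrInf (a : Cox) (z : ℂ) :
    (aeval Γ.parInf a).eval z = eval (fun k => (Γ.parInf k).eval z) a := by
  change Polynomial.aeval z _ = aeval _ a
  rw [comp_aeval_apply]
  rfl

theorem eval_restrInf_of_ne_zero {a : Cox} {d : ℤ × ℤ} (ha : W.IsBihom a d) {z : ℂ} (hz : z ≠ 0) :
    (aeval Γ.parInf a).eval z = z ^ Γ.deg d * (aeval Γ.par a).eval z⁻¹ := by
  rw [eval_restrInf, eval_restr]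
  have h := ha.aeval_mul (c := fun e => z ^ Γ.deg e) (by simp)
    (fun d e => by rw [map_add, zpow_add₀ hz]) (fun k => (Γ.par k).eval z⁻¹)
  rw [← funext fun k => Γ.eval_parInf k z hz] at h
  exact h

theorem restrInf_eq_zero_iff {a : Cox} {d : ℤ × ℤ} (ha : W.IsBihom a d) :
    aeval Γ.parInf a = 0 ↔ aeval Γ.par a = 0 := by
  have hinf := Set.Finite.infinite_compl (Set.finite_singleton (0 : ℂ))
  constructor
  · intro h
    refine Polynomial.eq_of_infinite_eval_eq _ _ (hinf.mono fun z hz => ?_)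
    have hz : z ≠ 0 := hz
    have h1 := eval_restrInf_of_ne_zero (Γ := Γ) ha (inv_ne_zero hz)
    rw [h, inv_inv, Polynomial.eval_zero, eq_comm] at h1
    rw [Set.mem_ofPred_eq, Polynomial.eval_zero]
    exact (mul_eq_zero_iff_left (zpow_ne_zero _ (inv_ne_zero hz))).1 h1
  · intro h
    refine Polynomial.eq_of_infinite_eval_eq _ _ (hinf.mono fun z hz => ?_)
    rw [Set.mem_ofPred_eq, eval_restrInf_of_ne_zero ha hz, h]
    simp

variable (Γ)

/-- The parametrization of the curve by `ℙ¹ = ℂ ∪ {∞}`. -/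
def param : Option ℂ → W.Stable
  | some z => ⟨fun k => (Γ.par k).eval z, ⟨0, by simp [Γ.par_inl]⟩, Γ.index, by simp [Γ.par_index]⟩
  | none => ⟨fun k => (Γ.parInf k).eval 0, Γ.parInf_inl, Γ.parInf_inr⟩

/-- Restriction of polynomials to the curve, in terms of a parameter vanishing at a given point. -/
def chart : Option ℂ → Cox →ₐ[ℂ] Polynomial ℂ
  | some z => (Polynomial.aeval (Polynomial.X + Polynomial.C z)).comp (aeval Γ.par)
  | none => aeval Γ.parInf

theorem chart_some (z : ℂ) (a : Cox) :
    Γ.chart (some z) a = (aeval Γ.par a).comp (Polynomial.X + Polynomial.C z) := rfl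

theorem chart_none (a : Cox) : Γ.chart none a = aeval Γ.parInf a := rfl

theorem eval_chart_zero (o : Option ℂ) (a : Cox) :
    (Γ.chart o a).eval 0 = eval (Γ.param o).1 a := by
  cases o with
  | none => exact eval_restrInf a 0
  | some z =>
    rw [chart_some, Polynomial.eval_comp]
    simp only [Polynomial.eval_add, Polynomial.eval_X, Polynomial.eval_C, zero_add]
    exact eval_restr z a

variable {Γ}

theorem chart_eq_zero_iff {a : Cox} {d : ℤ × ℤ} (ha : W.IsBihom a d) (o : Option ℂ) :
    Γ.chart o a = 0 ↔ a ∈ Γ.toSubvariety.ideal := by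
  rw [mem_ideal_iff ha]
  cases o with
  | none => exact restrInf_eq_zero_iff ha
  | some z =>
    rw [chart_some]
    refine ⟨fun h => ?_, fun h => by rw [h, Polynomial.zero_comp]⟩
    have := congrArg (fun q => q.comp (Polynomial.X - Polynomial.C z)) h
    simpa [Polynomial.comp_assoc] using this

variable (Γ)

/-- The points of the curve. -/
def pt (o : Option ℂ) : Γ.toSubvariety.Pt := ⟨Quotient.mk _ (Γ.param o), fun f hf =>
  eval_eq_zero_of_components fun d => by
    rw [Point.eval_coords_mk _ (isBihom_component f d), ← eval_chart_zero,
      (chart_eq_zero_iff (isBihom_component f d) o).2 (Γ.toSubvariety.bihom f hf d),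
      Polynomial.eval_zero]⟩

variable {Γ}

theorem eval_pt_iff {a : Cox} {d : ℤ × ℤ} (ha : W.IsBihom a d) (o : Option ℂ) :
    eval (Γ.pt o).1.coords a = 0 ↔ eval (Γ.param o).1 a = 0 := Point.eval_coords_mk _ ha

theorem isLocalParam (o : Option ℂ) :
    Subvariety.IsLocalParam Γ.toSubvariety (Γ.pt o) (Γ.chart o) where
  mem_iff d a ha := (chart_eq_zero_iff ha o).symm
  eval_iff d a ha := by rw [eval_pt_iff ha, eval_chart_zero]
  exists_coord := by
    cases o with
    | none => exact ⟨_, _, _, Γ.isBihom_Z₁, Γ.isBihom_Z₀, Γ.parInf_Z₁, Γ.parInf_Z₀⟩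
    | some z =>
      refine ⟨_, Γ.Z₀, Γ.Z₁ - C z * Γ.Z₀, Γ.isBihom_Z₀,
        Γ.isBihom_Z₁.sub (Γ.isBihom_Z₀.C_mul z), ?_, ?_⟩
      · rw [chart_some, Γ.par_Z₀, Polynomial.one_comp]
      · rw [chart_some, map_sub, map_mul, Γ.par_Z₀, Γ.par_Z₁, mul_one, Polynomial.sub_comp,
          Polynomial.X_comp, aeval_C]
        simp

theorem pt_bijective : Function.Bijective Γ.pt := by
  constructor
  · have hZ : ∀ z w : ℂ, Γ.pt (some z) = Γ.pt (some w) → z = w := by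
      intro z w h
      have hb := Γ.isBihom_Z₁.sub (Γ.isBihom_Z₀.C_mul z)
      have h1 : eval (Γ.pt (some z)).1.coords (Γ.Z₁ - C z * Γ.Z₀) = 0 := by
        rw [eval_pt_iff hb]
        simp only [param, ← eval_restr, map_sub, map_mul, Γ.par_Z₁, Γ.par_Z₀]
        simp
      rw [h, eval_pt_iff hb] at h1
      simp only [param, ← eval_restr, map_sub, map_mul, Γ.par_Z₁, Γ.par_Z₀] at h1
      simp only [aeval_C, Polynomial.algebraMap_eq, mul_one, Polynomial.eval_one,
        Polynomial.eval_X, Polynomial.eval_C] at h1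
      exact (sub_eq_zero.1 h1).symm
    have hZ' : ∀ z : ℂ, Γ.pt (some z) ≠ Γ.pt none := by
      intro z h
      have h1 : eval (Γ.pt none).1.coords Γ.Z₀ = 0 := by
        rw [eval_pt_iff Γ.isBihom_Z₀]
        simp only [param, ← eval_restrInf, Γ.parInf_Z₀, Polynomial.eval_X]
      rw [← h, eval_pt_iff Γ.isBihom_Z₀] at h1
      simp only [param, ← eval_restr, Γ.par_Z₀, Polynomial.eval_one, one_ne_zero] at h1
    rintro (_ | z) (_ | w) h
    · rfl
    · exact absurd h.symm (hZ' w)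
    · exact absurd h (hZ' z)
    · rw [hZ z w h]
  · rintro ⟨x, hx⟩
    obtain ⟨s, t, h⟩ := Γ.exhausts (Quotient.out x)
      fun d f hf h0 => hx f ((mem_ideal_iff hf).2 h0)
    rcases h with ⟨z, h⟩ | h
    · refine ⟨some z, Subtype.ext ?_⟩
      change Quotient.mk _ _ = x
      rw [← Quotient.out_eq x]
      exact Quotient.sound (Setoid.symm (⟨s, t, h⟩ : W.torusRel _ _))
    · refine ⟨none, Subtype.ext ?_⟩
      change Quotient.mk _ _ = x
      rw [← Quotient.out_eq x]
      exact Quotient.sound (Setoid.symm (⟨s, t, h⟩ : W.torusRel _ _))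

/-- A bihomogeneous polynomial of bidegree `d` has `deg d` zeros on the curve. -/
theorem sum_rootMultiplicity {a : Cox} {d : ℤ × ℤ} (ha : W.IsBihom a d)
    (haC : a ∉ Γ.toSubvariety.ideal) :
    (Function.support fun o => ((Γ.chart o a).rootMultiplicity 0 : ℤ)).Finite ∧
      ∑ᶠ o, ((Γ.chart o a).rootMultiplicity 0 : ℤ) = Γ.deg d := by
  classical
  have ha0 : aeval Γ.par a ≠ 0 := fun h => haC ((mem_ideal_iff ha).2 h)
  have hsome : ∀ z, (Γ.chart (some z) a).rootMultiplicity 0 = (aeval Γ.par a).roots.count z := by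
    intro z
    rw [Polynomial.count_roots, chart_some, ← Polynomial.rootMultiplicity_eq_rootMultiplicity]
  have hsupp : (Function.support fun o => ((Γ.chart o a).rootMultiplicity 0 : ℤ)) ⊆
      (Finset.insertNone (aeval Γ.par a).roots.toFinset : Set (Option ℂ)) := by
    rintro (_ | z) hz
    · exact Finset.mem_coe.2 (Finset.none_mem_insertNone)
    · refine Finset.mem_coe.2 (Finset.some_mem_insertNone.2 ?_)
      rw [Function.mem_support, hsome] at hz
      rw [Multiset.mem_toFinset, ← Multiset.count_pos]
      omega
  refine ⟨(Finset.finite_toSet _).subset hsupp, ?_⟩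
  rw [finsum_eq_sum_of_support_subset _ hsupp, Finset.sum_insertNone]
  simp only [hsome]
  rw [← Nat.cast_sum, Multiset.toFinset_sum_count_eq, IsAlgClosed.card_roots_eq_natDegree,
    chart_none]
  exact Polynomial.rootMultiplicity_zero_add_natDegree ha0 fun z hz =>
    eval_restrInf_of_ne_zero ha hz

end RatCurve

/-! ### Degrees of Cartier divisors on smooth rational curves -/

namespace Subvariety

variable {V : W.Subvariety}

theorem cartier_mono {S U : Set V.Pt} (h : S ⊆ U) : V.cartier U ≤ V.cartier S :=
  fun _ hφ p hp => let ⟨d, k, hk, hkp, H⟩ := hφ p (h hp); ⟨d, k, hk, hkp, fun q hq => H q (h hq)⟩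

theorem principal_mono {S U : Set V.Pt} (h : S ⊆ U) : V.principal U ≤ V.principal S :=
  fun _ ⟨c, hc⟩ => ⟨c, fun p hp => hc p (h hp)⟩

end Subvariety

namespace RatCurve

open Subvariety

variable (Γ : RatCurve W) {V : W.Subvariety}

/-- The order of vanishing of a polynomial at a point of the curve. -/
def mult (o : Option ℂ) (a : Cox) : ℤ := (Γ.chart o a).rootMultiplicity 0

/-- The order at a point of the curve of the restriction of a rational function on `V`. -/
def ord (o : Option ℂ) (c : (V.functionField)ˣ) : ℤ :=
  Γ.toSubvariety.ordAt (Γ.pt o) (V.restrict Γ.toSubvariety (unitVal c))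

/-- The rational function `c` on `V` has neither zero nor pole along the curve. -/
def IsGeneric (c : (V.functionField)ˣ) : Prop :=
  ∃ (d : ℤ × ℤ) (a b : Cox), W.IsBihom a d ∧ W.IsBihom b d ∧ a ∉ Γ.toSubvariety.ideal ∧
    b ∉ Γ.toSubvariety.ideal ∧ unitVal c = V.frac a b

variable {Γ}

theorem mult_nonneg (o : Option ℂ) (a : Cox) : 0 ≤ Γ.mult o a := Int.natCast_nonneg _

theorem mult_eq_zero {a : Cox} {d : ℤ × ℤ} (ha : W.IsBihom a d) {o : Option ℂ}
    (h : eval (Γ.pt o).1.coords a ≠ 0) : Γ.mult o a = 0 := by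
  rw [Ne, eval_pt_iff ha, ← eval_chart_zero] at h
  rw [mult, Polynomial.rootMultiplicity_eq_zero h, Nat.cast_zero]

theorem mult_mul {a b : Cox} {d e : ℤ × ℤ} (ha : W.IsBihom a d) (hb : W.IsBihom b e)
    (haC : a ∉ Γ.toSubvariety.ideal) (hbC : b ∉ Γ.toSubvariety.ideal) (o : Option ℂ) :
    Γ.mult o (a * b) = Γ.mult o a + Γ.mult o b := by
  rw [mult, map_mul, Polynomial.rootMultiplicity_mul, Nat.cast_add]
  · rfl
  · exact mul_ne_zero (fun h => haC ((chart_eq_zero_iff ha o).1 h))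
      fun h => hbC ((chart_eq_zero_iff hb o).1 h)

theorem ord_of_frac (hC : V.ideal ≤ Γ.toSubvariety.ideal) (o : Option ℂ) {c : (V.functionField)ˣ}
    {d : ℤ × ℤ} {a b : Cox} (ha : W.IsBihom a d) (hb : W.IsBihom b d)
    (haC : a ∉ Γ.toSubvariety.ideal) (hbC : b ∉ Γ.toSubvariety.ideal)
    (h : unitVal c = V.frac a b) : Γ.ord o c = Γ.mult o a - Γ.mult o b := by
  rw [ord, h, restrict_frac hC ha hb hbC, (isLocalParam o).ordAt_frac ha hb haC hbC]
  rfl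

theorem IsGeneric.mul {c c' : (V.functionField)ˣ} (h : Γ.IsGeneric c) (h' : Γ.IsGeneric c') :
    Γ.IsGeneric (c * c') := by
  obtain ⟨d, a, b, ha, hb, haC, hbC, h⟩ := h
  obtain ⟨d', a', b', ha', hb', haC', hbC', h'⟩ := h'
  exact ⟨_, _, _, ha.mul ha', hb.mul hb', mul_notMem haC haC', mul_notMem hbC hbC', by
    rw [map_mul, h, h', frac_mul_frac]⟩

theorem IsGeneric.inv {c : (V.functionField)ˣ} (h : Γ.IsGeneric c) : Γ.IsGeneric c⁻¹ := by
  obtain ⟨d, a, b, ha, hb, haC, hbC, h⟩ := h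
  exact ⟨_, _, _, hb, ha, hbC, haC, by rw [unitVal_inv, h, inv_frac]⟩

theorem IsGeneric.div {c c' : (V.functionField)ˣ} (h : Γ.IsGeneric c) (h' : Γ.IsGeneric c') :
    Γ.IsGeneric (c / c') := by
  rw [div_eq_mul_inv]
  exact h.mul h'.inv

theorem ord_mul (hC : V.ideal ≤ Γ.toSubvariety.ideal) (o : Option ℂ) {c c' : (V.functionField)ˣ}
    (h : Γ.IsGeneric c) (h' : Γ.IsGeneric c') : Γ.ord o (c * c') = Γ.ord o c + Γ.ord o c' := by
  obtain ⟨d, a, b, ha, hb, haC, hbC, h⟩ := h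
  obtain ⟨d', a', b', ha', hb', haC', hbC', h'⟩ := h'
  rw [ord_of_frac hC o ha hb haC hbC h, ord_of_frac hC o ha' hb' haC' hbC' h',
    ord_of_frac hC o (ha.mul ha') (hb.mul hb') (mul_notMem haC haC') (mul_notMem hbC hbC')
      (by rw [map_mul, h, h', frac_mul_frac]),
    mult_mul ha ha' haC haC', mult_mul hb hb' hbC hbC']
  ring

theorem isGeneric_of_isUnitAt (hC : V.ideal ≤ Γ.toSubvariety.ideal) {o : Option ℂ}
    {c : (V.functionField)ˣ} (h : V.IsUnitAt ((Γ.pt o).incl hC) c) : Γ.IsGeneric c := by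
  obtain ⟨d, a, b, ha, hb, hap, hbp, h⟩ := isUnitAt_iff.1 h
  exact ⟨d, a, b, ha, hb, notMem_of_eval_ne_zero (Γ.pt o) hap,
    notMem_of_eval_ne_zero (Γ.pt o) hbp, h⟩

theorem ord_of_isUnitAt (hC : V.ideal ≤ Γ.toSubvariety.ideal) {o : Option ℂ}
    {c : (V.functionField)ˣ} (h : V.IsUnitAt ((Γ.pt o).incl hC) c) : Γ.ord o c = 0 := by
  obtain ⟨d, a, b, ha, hb, hap, hbp, h⟩ := isUnitAt_iff.1 h
  rw [ord_of_frac hC o ha hb (notMem_of_eval_ne_zero (Γ.pt o) hap)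
    (notMem_of_eval_ne_zero (Γ.pt o) hbp) h, mult_eq_zero ha hap, mult_eq_zero hb hbp, sub_zero]

/-- A rational function has as many zeros as poles on the curve. -/
theorem finsum_ord_eq_zero (hC : V.ideal ≤ Γ.toSubvariety.ideal) {c : (V.functionField)ˣ}
    (h : Γ.IsGeneric c) : (Function.support fun o => Γ.ord o c).Finite ∧
      ∑ᶠ o, Γ.ord o c = 0 := by
  obtain ⟨d, a, b, ha, hb, haC, hbC, h⟩ := h
  have key : (fun o => Γ.ord o c) = fun o => Γ.mult o a - Γ.mult o b :=
    funext fun o => ord_of_frac hC o ha hb haC hbC h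
  obtain ⟨fa, sa⟩ := sum_rootMultiplicity ha haC
  obtain ⟨fb, sb⟩ := sum_rootMultiplicity hb hbC
  rw [key]
  refine ⟨(fa.union fb).subset (Function.support_sub _ _), ?_⟩
  exact (finsum_sub_distrib fa fb).trans (sub_eq_zero.2 (sa.trans sb.symm))

variable (Γ)

/-- The points of the curve, as points of `V`. -/
def points (hC : V.ideal ≤ Γ.toSubvariety.ideal) : Set V.Pt :=
  Set.range fun o => (Γ.pt o).incl hC

/-- The intersection number with the curve, with a fixed choice of the base point. -/
def degree (hC : V.ideal ≤ Γ.toSubvariety.ideal) (φ : V.Pt → (V.functionField)ˣ) : ℤ :=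
  V.intersectionNumber Γ.toSubvariety hC (Γ.pt none) φ

variable {Γ} (hC : V.ideal ≤ Γ.toSubvariety.ideal) {φ ψ : V.Pt → (V.functionField)ˣ}

theorem degree_def (φ : V.Pt → (V.functionField)ˣ) : Γ.degree hC φ =
    ∑ᶠ o, Γ.ord o (φ ((Γ.pt o).incl hC) / φ ((Γ.pt none).incl hC)) :=
  (finsum_eq_of_bijective Γ.pt pt_bijective fun _ => rfl).symm

/-- Two local equations of a Cartier divisor differ by a rational function that has neither zero
nor pole along the curve: near a general point of the curve they both are local equations. -/
theorem isGeneric_div (hφ : φ ∈ V.cartier (Γ.points hC)) (o o' : Option ℂ) :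
    Γ.IsGeneric (φ ((Γ.pt o).incl hC) / φ ((Γ.pt o').incl hC)) := by
  obtain ⟨d, h, hh, hp, H⟩ := hφ _ ⟨o, rfl⟩
  obtain ⟨d', h', hh', hp', H'⟩ := hφ _ ⟨o', rfl⟩
  have hne : h * h' ∉ Γ.toSubvariety.ideal := mul_notMem (notMem_of_eval_ne_zero (Γ.pt o) hp)
    (notMem_of_eval_ne_zero (Γ.pt o') hp')
  obtain ⟨r, hr⟩ : ∃ r, eval (Γ.pt r).1.coords (h * h') ≠ 0 := by
    by_contra! hall
    apply hne
    rw [mem_ideal_iff (hh.mul hh')]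
    refine Polynomial.funext fun z => ?_
    rw [eval_restr, Polynomial.eval_zero]
    exact (eval_pt_iff (hh.mul hh') (some z)).1 (hall (some z))
  rw [map_mul] at hr
  have h1 := isGeneric_of_isUnitAt hC (H _ ⟨r, rfl⟩ (left_ne_zero_of_mul hr))
  have h2 := isGeneric_of_isUnitAt hC (H' _ ⟨r, rfl⟩ (right_ne_zero_of_mul hr))
  have := h2.div h1
  rwa [div_div_div_cancel_left] at this

/-- The degree can be computed after subtracting the divisor of a rational function `c`. -/
theorem degree_eq (hφ : φ ∈ V.cartier (Γ.points hC)) {c : (V.functionField)ˣ}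
    (hc : Γ.IsGeneric (φ ((Γ.pt none).incl hC) / c)) :
    (∀ o, Γ.IsGeneric (φ ((Γ.pt o).incl hC) / c)) ∧
    (Function.support fun o => Γ.ord o (φ ((Γ.pt o).incl hC) / c)).Finite ∧
      Γ.degree hC φ = ∑ᶠ o, Γ.ord o (φ ((Γ.pt o).incl hC) / c) := by
  set o₀ : Option ℂ := none
  have hg := fun o => isGeneric_div hC hφ o o₀
  have hgc : ∀ o, φ ((Γ.pt o).incl hC) / c =
      φ ((Γ.pt o).incl hC) / φ ((Γ.pt o₀).incl hC) * (φ ((Γ.pt o₀).incl hC) / c) :=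
    fun o => (div_mul_div_cancel _ _ _).symm
  have hfin : (Function.support fun o =>
      Γ.ord o (φ ((Γ.pt o).incl hC) / φ ((Γ.pt o₀).incl hC))).Finite := by
    obtain ⟨d, h, hh, hp, H⟩ := hφ _ ⟨o₀, rfl⟩
    refine (sum_rootMultiplicity hh (notMem_of_eval_ne_zero (Γ.pt o₀) hp)).1.subset fun o ho => ?_
    rw [Function.mem_support] at ho ⊢
    intro h0
    refine ho (ord_of_isUnitAt hC (H _ ⟨o, rfl⟩ fun h1 => ?_))
    have h1 : eval (Γ.pt o).1.coords h = 0 := h1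
    rw [eval_pt_iff hh, ← eval_chart_zero] at h1
    have hne := (chart_eq_zero_iff hh o).not.2 (notMem_of_eval_ne_zero (Γ.pt o₀) hp)
    exact (Polynomial.rootMultiplicity_pos hne).2 h1 |>.ne' (by exact_mod_cast h0)
  obtain ⟨fc, sc⟩ := finsum_ord_eq_zero hC hc
  have hsum : (fun o => Γ.ord o (φ ((Γ.pt o).incl hC) / c)) = fun o =>
      Γ.ord o (φ ((Γ.pt o).incl hC) / φ ((Γ.pt o₀).incl hC)) +
        Γ.ord o (φ ((Γ.pt o₀).incl hC) / c) :=
    funext fun o => by rw [hgc, ord_mul hC o (hg o) hc]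
  refine ⟨fun o => hgc o ▸ (hg o).mul hc, ?_, ?_⟩
  · rw [hsum]
    exact (hfin.union fc).subset (Function.support_add _ _)
  · rw [hsum, finsum_add_distrib hfin fc, sc, add_zero, degree_def]

theorem degree_mul (hφ : φ ∈ V.cartier (Γ.points hC)) (hψ : ψ ∈ V.cartier (Γ.points hC)) :
    Γ.degree hC (φ * ψ) = Γ.degree hC φ + Γ.degree hC ψ := by
  have h1 := (degree_eq hC hφ (isGeneric_div hC hφ none none)).2.1
  have h2 := (degree_eq hC hψ (isGeneric_div hC hψ none none)).2.1
  rw [degree_def, degree_def, degree_def, ← finsum_add_distrib h1 h2]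
  refine finsum_congr fun o => ?_
  rw [← ord_mul hC o (isGeneric_div hC hφ o none) (isGeneric_div hC hψ o none), div_mul_div_comm]
  rfl

theorem degree_eq_zero_of_principal (hφ : φ ∈ V.cartier (Γ.points hC))
    (hφ' : φ ∈ V.principal (Γ.points hC)) : Γ.degree hC φ = 0 := by
  obtain ⟨c, hc⟩ := hφ'
  rw [(degree_eq hC hφ (isGeneric_of_isUnitAt hC (hc _ ⟨none, rfl⟩))).2.2]
  exact finsum_eq_zero_of_forall_eq_zero fun o => ord_of_isUnitAt hC (hc _ ⟨o, rfl⟩)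

/-- An effective divisor whose support does not contain the curve has nonnegative degree. -/
theorem degree_nonneg (hφ : φ ∈ V.cartier (Γ.points hC))
    (h : ∀ o, ∃ (d : ℤ × ℤ) (a b : Cox), W.IsBihom a d ∧ W.IsBihom b d ∧
      a ∉ Γ.toSubvariety.ideal ∧ eval (Γ.pt o).1.coords b ≠ 0 ∧
      unitVal (φ ((Γ.pt o).incl hC)) = V.frac a b) : 0 ≤ Γ.degree hC φ := by
  have hg : Γ.IsGeneric (φ ((Γ.pt none).incl hC) / 1) := by
    obtain ⟨d, a, b, ha, hb, haC, hbp, h⟩ := h none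
    exact ⟨d, a, b, ha, hb, haC, notMem_of_eval_ne_zero (Γ.pt none) hbp, by rw [div_one, h]⟩
  rw [(degree_eq hC hφ hg).2.2]
  refine finsum_nonneg fun o => ?_
  obtain ⟨d, a, b, ha, hb, haC, hbp, h⟩ := h o
  rw [div_one, ord_of_frac hC o ha hb haC (notMem_of_eval_ne_zero (Γ.pt o) hbp) h,
    mult_eq_zero hb hbp, sub_zero]
  exact mult_nonneg o a

/-- If the local equations are of the form `s m' / m` with a fixed fraction `s` and
bihomogeneous `m, m'` of bidegrees `d, d'` that do not vanish at the point, the divisor has the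
degree of a section of `𝒪(d - d')`. -/
theorem degree_eq_of_ratio {d d' : ℤ × ℤ}
    (m m' : Option ℂ → Cox) (hm : ∀ o, W.IsBihom (m o) d) (hm' : ∀ o, W.IsBihom (m' o) d')
    (hmp : ∀ o, eval (Γ.pt o).1.coords (m o) ≠ 0) (hmp' : ∀ o, eval (Γ.pt o).1.coords (m' o) ≠ 0)
    (h : ∀ o, unitVal (φ ((Γ.pt o).incl hC) / φ ((Γ.pt none).incl hC)) =
      V.frac (m none * m' o) (m o * m' none)) :
    Γ.degree hC φ = Γ.deg d - Γ.deg d' := by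
  have hn := fun o => notMem_of_eval_ne_zero (Γ.pt o) (hmp o)
  have hn' := fun o => notMem_of_eval_ne_zero (Γ.pt o) (hmp' o)
  obtain ⟨fd, sd⟩ := sum_rootMultiplicity (hm none) (hn none)
  obtain ⟨fd', sd'⟩ := sum_rootMultiplicity (hm' none) (hn' none)
  rw [degree_def, ← sd, ← sd', ← finsum_sub_distrib fd fd']
  refine finsum_congr fun o => ?_
  rw [ord_of_frac hC o ((hm none).mul (hm' o)) ((hm o).mul (hm' none))
    (mul_notMem (hn none) (hn' o)) (mul_notMem (hn o) (hn' none)) (h o),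
    mult_mul (hm none) (hm' o) (hn none) (hn' o), mult_mul (hm o) (hm' none) (hn o) (hn' none),
    mult_eq_zero (hm o) (hmp o), mult_eq_zero (hm' o) (hmp' o), add_zero, zero_add]
  rfl

variable (Γ)

/-- The rational parameter of the curve. -/
def coordinate : Γ.toSubvariety.functionField :=
  ⟨Γ.toSubvariety.frac Γ.Z₁ Γ.Z₀, Γ.bideg, Γ.Z₁, Γ.Z₀, Γ.isBihom_Z₁, Γ.isBihom_Z₀, by
    rw [mem_ideal_iff Γ.isBihom_Z₀, Γ.par_Z₀]
    exact one_ne_zero, rfl⟩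

theorem Z₀_notMem : Γ.Z₀ ∉ Γ.toSubvariety.ideal := by
  rw [mem_ideal_iff Γ.isBihom_Z₀, Γ.par_Z₀]
  exact one_ne_zero

theorem exists_homogenization (A : Polynomial ℂ) {N : ℕ} (hN : A.natDegree ≤ N) :
    ∃ a, W.IsBihom a (N • Γ.bideg) ∧ aeval Γ.par a = A ∧
      (Polynomial.aeval Γ.coordinate A).1 = Γ.toSubvariety.frac a (Γ.Z₀ ^ N) := by
  have hZ := toFrac_ne_zero.2 Γ.Z₀_notMem
  refine ⟨∑ i ∈ Finset.range (N + 1), C (A.coeff i) * (Γ.Z₁ ^ i * Γ.Z₀ ^ (N - i)), ?_, ?_, ?_⟩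
  · refine IsWeightedHomogeneous.sum _ _ _ fun i hi => IsWeightedHomogeneous.C_mul ?_ _
    have := (Γ.isBihom_Z₁.pow i).mul (Γ.isBihom_Z₀.pow (N - i))
    rwa [← add_nsmul, Nat.add_sub_cancel' (Nat.lt_succ_iff.1 (Finset.mem_range.1 hi))] at this
  · simp only [map_sum, map_mul, map_pow, Γ.par_Z₀, Γ.par_Z₁, one_pow, mul_one, aeval_C]
    exact (A.as_sum_range_C_mul_X_pow' (Nat.lt_succ_of_le hN)).symm
  · change Γ.toSubvariety.functionField.val _ = _
    rw [← Polynomial.aeval_algHom_apply, A.aeval_eq_sum_range' (Nat.lt_succ_of_le hN), frac_def,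
      map_sum, Finset.sum_div]
    refine Finset.sum_congr rfl fun i hi => ?_
    have hi := Nat.lt_succ_iff.1 (Finset.mem_range.1 hi)
    rw [map_mul, map_mul, map_pow, map_pow, map_pow, ← pow_sub_mul_pow _ hi,
      mul_comm (_ ^ (N - i)) (_ ^ i), ← mul_assoc, mul_div_mul_right _ _ (pow_ne_zero _ hZ),
      Algebra.smul_def, mul_div_assoc, ← div_pow]
    congr 1

theorem aeval_coordinate_ne_zero {A : Polynomial ℂ} (hA : A ≠ 0) :
    Polynomial.aeval Γ.coordinate A ≠ 0 := by
  obtain ⟨a, ha, hpa, ea⟩ := Γ.exists_homogenization A le_rfl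
  intro h
  rw [h, frac_def] at ea
  rcases div_eq_zero_iff.1 ea.symm with h0 | h0
  · exact hA (hpa ▸ (mem_ideal_iff ha).1 (toFrac_eq_zero.1 h0))
  · rw [map_pow] at h0
    exact Γ.Z₀_notMem (toFrac_eq_zero.1 (eq_zero_of_pow_eq_zero h0))

theorem frac_mul_aeval_coordinate {a b : Cox} {d : ℤ × ℤ} (ha : W.IsBihom a d)
    (hb : W.IsBihom b d) (hbC : b ∉ Γ.toSubvariety.ideal) :
    Γ.toSubvariety.frac a b * (Polynomial.aeval Γ.coordinate (aeval Γ.par b)).1 =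
      (Polynomial.aeval Γ.coordinate (aeval Γ.par a)).1 := by
  let N := max (aeval Γ.par a).natDegree (aeval Γ.par b).natDegree
  obtain ⟨a', ha', hpa, ea⟩ := Γ.exists_homogenization (aeval Γ.par a) (le_max_left _ _ : _ ≤ N)
  obtain ⟨b', hb', hpb, eb⟩ := Γ.exists_homogenization (aeval Γ.par b) (le_max_right _ _ : _ ≤ N)
  have hbC' : b' ∉ Γ.toSubvariety.ideal := by rwa [mem_ideal_iff hb', hpb, ← mem_ideal_iff hb]
  have hb0 := toFrac_ne_zero.2 hbC
  have hb0' := toFrac_ne_zero.2 hbC'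
  have h : Γ.toSubvariety.frac a b = Γ.toSubvariety.frac a' b' := by
    have h1 : W.IsBihom (a * b' - a' * b) (d + N • Γ.bideg) :=
      (IsWeightedHomogeneous.mul ha hb').sub
        (IsBihom.congr (IsWeightedHomogeneous.mul ha' hb) (add_comm _ _))
    rw [frac_eq_frac hbC hbC', mem_ideal_iff h1, map_sub, map_mul, map_mul, hpa, hpb, sub_self]
  rw [ea, eb, h, frac_def, frac_def, frac_def]
  field_simp

open Algebra in
theorem dim_eq_one : Γ.toSubvariety.dim = 1 := by
  apply le_antisymm
  · have : Algebra.IsAlgebraic (Algebra.adjoin ℂ {Γ.coordinate}) Γ.toSubvariety.functionField := by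
      constructor
      rintro ⟨_, d, a, b, ha, hb, hbC, rfl⟩
      have hmem : ∀ A : Polynomial ℂ, Polynomial.aeval Γ.coordinate A ∈
          Algebra.adjoin ℂ {Γ.coordinate} := fun A => by
        rw [Algebra.adjoin_singleton_eq_range_aeval]
        exact ⟨A, rfl⟩
      have key := Γ.frac_mul_aeval_coordinate ha hb hbC
      refine ⟨Polynomial.X * Polynomial.C ⟨_, hmem (aeval Γ.par b)⟩ -
        Polynomial.C ⟨_, hmem (aeval Γ.par a)⟩, ?_, ?_⟩
      · intro h
        have h1 := congrArg (fun q => q.coeff 1) h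
        simp only [Polynomial.coeff_sub, Polynomial.coeff_X_mul, Polynomial.coeff_C_zero,
          Polynomial.coeff_C_succ, Polynomial.coeff_zero] at h1
        exact Γ.aeval_coordinate_ne_zero (fun h0 => hbC ((mem_ideal_iff hb).2 h0))
          ((sub_zero _).symm.trans (congrArg Subtype.val h1))
      · simp only [map_sub, map_mul, Polynomial.aeval_X, Polynomial.aeval_C]
        rw [sub_eq_zero]
        exact Subtype.ext key
    exact (Algebra.IsAlgebraic.trdeg_le_cardinalMk ℂ {Γ.coordinate}).trans
      (Cardinal.mk_singleton _).le
  · rw [Cardinal.one_le_iff_ne_zero, Subvariety.dim, trdeg_ne_zero_iff]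
    refine ⟨Γ.coordinate, ?_⟩
    rintro ⟨A, hA, h⟩
    exact Γ.aeval_coordinate_ne_zero hA h

end RatCurve

/-! ### Vertical curves and sections -/

/-- The index `t` is the one with `b_t = 2`, and `t`, `l` are the indices `2`, `3` in some order. -/
structure IsFrame (W : ScrollData) (t l : Fin 4) : Prop where
  b_eq : ∀ i, W.b i = if i = t then 2 else 1
  fst_ne_zero : t ≠ 0
  fst_ne_one : t ≠ 1
  snd_ne_zero : l ≠ 0
  snd_ne_one : l ≠ 1
  ne : l ≠ t

namespace IsFrame

variable {t l : Fin 4}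

theorem cases (h : W.IsFrame t l) (i : Fin 4) : i = 0 ∨ i = 1 ∨ i = t ∨ i = l := by
  obtain ⟨-, h1, h2, h3, h4, h5⟩ := h
  revert i t l
  decide

theorem b_fst (h : W.IsFrame t l) : W.b t = 2 := by rw [h.b_eq, if_pos rfl]

theorem b_of_ne (h : W.IsFrame t l) {i : Fin 4} (hi : i ≠ t) : W.b i = 1 := by
  rw [h.b_eq, if_neg hi]

theorem a_zero_le_a_one (h : W.IsFrame t l) : W.a 0 ≤ W.a 1 := by
  have := W.ordered 0 1 (by decide)
  rwa [h.b_of_ne h.fst_ne_zero.symm, h.b_of_ne h.fst_ne_one.symm, mul_one, mul_one] at this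

end IsFrame

/-- The torus moves a point with `X (inl j) ≠ 0` to the slice `X (inl j) = 1`. -/
theorem exists_normalize (x : W.Stable) {j : Fin 2} (hj : x.1 (Sum.inl j) ≠ 0) (τ : ℂˣ) :
    ∃ s : ℂˣ, (∀ j', ((s ^ (W.wt (Sum.inl j')).1 * τ ^ (W.wt (Sum.inl j')).2 : ℂˣ) : ℂ) *
        x.1 (Sum.inl j') = x.1 (Sum.inl j') / x.1 (Sum.inl j)) ∧
      ∀ i, ((s ^ (W.wt (Sum.inr i)).1 * τ ^ (W.wt (Sum.inr i)).2 : ℂˣ) : ℂ) * x.1 (Sum.inr i) =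
        (τ : ℂ) ^ W.b i * eval x.1 (W.xhat j i) := by
  refine ⟨(Units.mk0 _ hj)⁻¹, fun j' => ?_, fun i => ?_⟩
  · simp [wt, div_eq_inv_mul]
  · simp [wt, eval_xhat]
    ring

/-- The coordinates of the curve `x₁ = z`, `x_t = c₀ + c₁ z + c₂ z²`, `x_l = 0` in the fibre
`v = τ u`, where `x₀ = u = 1`. -/
def verticalPar (t : Fin 4) (τ c₀ c₁ c₂ : ℂ) : Fin 2 ⊕ Fin 4 → Polynomial ℂ :=
  Sum.elim ![1, Polynomial.C τ] fun i => if i = 0 then 1 else if i = 1 then Polynomial.X else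
    if i = t then Polynomial.C c₀ + Polynomial.C c₁ * Polynomial.X +
      Polynomial.C c₂ * Polynomial.X ^ 2 else 0

/-- The coordinates at infinity of the same curve, where `x₁ = u = 1`. -/
def verticalParInf (t : Fin 4) (τ c₀ c₁ c₂ : ℂ) : Fin 2 ⊕ Fin 4 → Polynomial ℂ :=
  Sum.elim ![1, Polynomial.C τ] fun i => if i = 0 then Polynomial.X else if i = 1 then 1 else
    if i = t then Polynomial.C c₂ + Polynomial.C c₁ * Polynomial.X +
      Polynomial.C c₀ * Polynomial.X ^ 2 else 0

/-- The curve `x_t = c₀ x₀² + c₁ x₀ x₁ + c₂ x₁²`, `x_l = 0` in the fibre `v = τ u`. The variables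
`x₀`, `x₁` are the `X (inr 0)`, `X (inr 1)` of weight `1`; the other two variables
have the indices `t`, `l`. -/
def verticalCurve {t l : Fin 4} (h : W.IsFrame t l) (τ c₀ c₁ c₂ : ℂ) : RatCurve W where
  deg := AddMonoidHom.snd ℤ ℤ
  par := verticalPar t τ c₀ c₁ c₂
  parInf := verticalParInf t τ c₀ c₁ c₂
  eval_parInf := by
    have h0 := h.fst_ne_zero
    have h1 := h.fst_ne_one
    rintro (j | i) z hz
    · fin_cases j <;> simp [verticalPar, verticalParInf, wt]
    · rcases h.cases i with rfl | rfl | rfl | rfl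
      · simp [verticalPar, verticalParInf, wt, h.b_of_ne h0.symm]
      · simp [verticalPar, verticalParInf, wt, h.b_of_ne h1.symm, hz]
      · simp [verticalPar, verticalParInf, wt, h.b_fst, h0, h1]
        field_simp
        ring
      · simp [verticalPar, verticalParInf, h.snd_ne_zero, h.snd_ne_one, h.ne]
  par_inl := rfl
  index := 0
  par_index := rfl
  parInf_inl := ⟨0, by simp [verticalParInf]⟩
  parInf_inr := ⟨1, by simp [verticalParInf]⟩
  bideg := W.wt (Sum.inr 0)
  Z₀ := X (Sum.inr 0)
  Z₁ := X (Sum.inr 1) * X (Sum.inl 0) ^ (W.a 1 - W.a 0)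
  isBihom_Z₀ := isBihom_X _
  isBihom_Z₁ := by
    refine IsBihom.congr ((isBihom_X _).mul ((isBihom_X _).pow _)) ?_
    have := h.a_zero_le_a_one
    ext
    · simp [wt]
      omega
    · simp [wt, h.b_of_ne h.fst_ne_zero.symm, h.b_of_ne h.fst_ne_one.symm]
  par_Z₀ := by simp [verticalPar]
  par_Z₁ := by simp [verticalPar]
  parInf_Z₀ := by simp [verticalParInf]
  parInf_Z₁ := by simp [verticalParInf]
  exhausts := by
    intro x hx
    have h0 := h.fst_ne_zero
    have h1 := h.fst_ne_one
    have b0 := h.b_of_ne h0.symm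
    have b1 := h.b_of_ne h1.symm
    have hv : x.1 (Sum.inl 1) = τ * x.1 (Sum.inl 0) := by
      have := hx (1, 0) (X (Sum.inl 1) - C τ * X (Sum.inl 0))
        (IsWeightedHomogeneous.sub (isBihom_X (W := W) (Sum.inl 1))
          (IsWeightedHomogeneous.C_mul (isBihom_X (W := W) (Sum.inl 0)) τ))
        (by simp [verticalPar])
      simpa [sub_eq_zero] using this
    have hu : x.1 (Sum.inl 0) ≠ 0 := by
      obtain ⟨j, hj⟩ := x.2.1
      intro h0
      rw [h0, mul_zero] at hv
      fin_cases j
      · exact hj h0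
      · exact hj hv
    have hl : x.1 (Sum.inr l) = 0 := by
      have := hx _ _ (isBihom_X (W := W) (Sum.inr l))
        (by simp [verticalPar, h.snd_ne_zero, h.snd_ne_one, h.ne])
      simpa using this
    have ht : eval x.1 (W.xhat 0 t) = c₀ * eval x.1 (W.xhat 0 0) ^ 2 +
        c₁ * (eval x.1 (W.xhat 0 0) * eval x.1 (W.xhat 0 1)) + c₂ * eval x.1 (W.xhat 0 1) ^ 2 := by
      have hb : W.IsBihom (W.xhat 0 t - (C c₀ * W.xhat 0 0 ^ 2 +
          C c₁ * (W.xhat 0 0 * W.xhat 0 1) + C c₂ * W.xhat 0 1 ^ 2)) (0, 2) := by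
        refine IsWeightedHomogeneous.sub (IsBihom.congr (isBihom_xhat 0 t) (by simp [h.b_fst]))
          (IsWeightedHomogeneous.add (IsWeightedHomogeneous.add ?_ ?_) ?_) <;>
          refine IsWeightedHomogeneous.C_mul ?_ _
        · exact IsBihom.congr ((isBihom_xhat 0 0).pow 2) (by simp [b0])
        · exact IsBihom.congr ((isBihom_xhat 0 0).mul (isBihom_xhat 0 1)) (by simp [b0, b1])
        · exact IsBihom.congr ((isBihom_xhat 0 1).pow 2) (by simp [b1])
      have := hx _ _ hb (by simp [verticalPar, xhat, h0, h1])
      simpa [sub_eq_zero] using this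
    by_cases hx0 : x.1 (Sum.inr 0) = 0
    · have hx0' : eval x.1 (W.xhat 0 0) = 0 := by simp [eval_xhat, hx0]
      have hx1 : eval x.1 (W.xhat 0 1) ≠ 0 := by
        intro hx1
        rw [hx0', hx1] at ht
        obtain ⟨i, hi⟩ := x.2.2
        rcases h.cases i with rfl | rfl | rfl | rfl
        · exact hi hx0
        · simp [eval_xhat, hi, hu] at hx1
        · simp [eval_xhat, hi, hu] at ht
        · exact hi hl
      obtain ⟨s, hs, hs'⟩ := exists_normalize x hu (Units.mk0 _ hx1)⁻¹
      refine ⟨s, (Units.mk0 _ hx1)⁻¹, Or.inr ?_⟩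
      rintro (j | i)
      · rw [hs]
        fin_cases j
        · simp [verticalParInf, hu]
        · simp [verticalParInf, hu, hv]
      · rw [hs']
        rcases h.cases i with rfl | rfl | rfl | rfl
        · simp [verticalParInf, hx0', b0]
        · simp [verticalParInf, b1, hx1]
        · simp [verticalParInf, h0, h1, h.b_fst, ht, hx0']
          field_simp
        · simp [verticalParInf, h.snd_ne_zero, h.snd_ne_one, h.ne, eval_xhat, hl]
    · have hx0' : eval x.1 (W.xhat 0 0) ≠ 0 := by simp [eval_xhat, hx0, hu]
      obtain ⟨s, hs, hs'⟩ := exists_normalize x hu (Units.mk0 _ hx0')⁻¹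
      refine ⟨s, (Units.mk0 _ hx0')⁻¹, Or.inl ⟨eval x.1 (W.xhat 0 1) / eval x.1 (W.xhat 0 0), ?_⟩⟩
      rintro (j | i)
      · rw [hs]
        fin_cases j
        · simp [verticalPar, hu]
        · simp [verticalPar, hu, hv]
      · rw [hs']
        rcases h.cases i with rfl | rfl | rfl | rfl
        · simp [verticalPar, hx0', b0]
        · simp [verticalPar, b1, div_eq_inv_mul]
        · simp [verticalPar, h0, h1, h.b_fst, ht]
          field_simp
        · simp [verticalPar, h.snd_ne_zero, h.snd_ne_one, h.ne, eval_xhat, hl]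

/-- The section `x₀ = c (v - τ u)ⁿ x₁`, `x_t = x_l = 0` of `𝓕 → ℙ¹`, where
`n = W.a 1 - W.a 0 ≥ 0` is the difference of the weights of `x₀` and `x₁`. -/
def sectionCurve {t l : Fin 4} (h : W.IsFrame t l) (τ c : ℂ) : RatCurve W where
  deg := AddMonoidHom.fst ℤ ℤ + (W.a 1 : ℤ) • AddMonoidHom.snd ℤ ℤ
  par := Sum.elim ![1, Polynomial.X] ![Polynomial.C c *
    (Polynomial.X - Polynomial.C τ) ^ (W.a 1 - W.a 0), 1, 0, 0]
  parInf := Sum.elim ![Polynomial.X, 1] ![Polynomial.C c *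
    (1 - Polynomial.C τ * Polynomial.X) ^ (W.a 1 - W.a 0), 1, 0, 0]
  eval_parInf := by
    have b0 := h.b_of_ne h.fst_ne_zero.symm
    have b1 := h.b_of_ne h.fst_ne_one.symm
    rintro (j | i) z hz
    · fin_cases j <;> simp [wt, hz]
    · fin_cases i
      · have h1 : -(W.a 0 : ℤ) + W.a 1 = ((W.a 1 - W.a 0 : ℕ) : ℤ) := by
          have := h.a_zero_le_a_one
          omega
        have h2 : 1 - τ * z = z * (z⁻¹ - τ) := by
          field_simp
        simp [wt, b0, h1, h2, mul_pow]
        ring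
      · simp [wt, b1]
      · simp
      · simp
  par_inl := rfl
  index := 1
  par_index := rfl
  parInf_inl := ⟨1, by simp⟩
  parInf_inr := ⟨1, by simp⟩
  bideg := (1, 0)
  Z₀ := X (Sum.inl 0)
  Z₁ := X (Sum.inl 1)
  isBihom_Z₀ := isBihom_X _
  isBihom_Z₁ := isBihom_X _
  par_Z₀ := by simp
  par_Z₁ := by simp
  parInf_Z₀ := by simp
  parInf_Z₁ := by simp
  exhausts := by
    intro x hx
    have b0 := h.b_of_ne h.fst_ne_zero.symm
    have b1 := h.b_of_ne h.fst_ne_one.symm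
    have ha := h.a_zero_le_a_one
    have h0 : x.1 (Sum.inr 0) = c * (x.1 (Sum.inl 1) - τ * x.1 (Sum.inl 0)) ^ (W.a 1 - W.a 0) *
        x.1 (Sum.inr 1) := by
      have hb : W.IsBihom (X (Sum.inr 0) - C c * ((X (Sum.inl 1) - C τ * X (Sum.inl 0)) ^
          (W.a 1 - W.a 0) * X (Sum.inr 1))) (W.wt (Sum.inr 0)) := by
        refine IsWeightedHomogeneous.sub (isBihom_X _) (IsWeightedHomogeneous.C_mul
          (IsBihom.congr (IsWeightedHomogeneous.mul (IsWeightedHomogeneous.pow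
            (IsWeightedHomogeneous.sub (isBihom_X (W := W) (Sum.inl 1))
              (IsWeightedHomogeneous.C_mul (isBihom_X (W := W) (Sum.inl 0)) τ)) _)
            (isBihom_X (Sum.inr 1))) ?_) _)
        ext
        · simp [wt]
          omega
        · simp [wt, b0, b1]
      have := hx _ _ hb (by simp)
      simpa [sub_eq_zero, mul_assoc] using this
    have h2 : x.1 (Sum.inr 2) = 0 := by
      simpa using hx _ _ (isBihom_X (W := W) (Sum.inr 2)) (by simp)
    have h3 : x.1 (Sum.inr 3) = 0 := by
      simpa using hx _ _ (isBihom_X (W := W) (Sum.inr 3)) (by simp)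
    have h1 : x.1 (Sum.inr 1) ≠ 0 := by
      intro h1
      rw [h1, mul_zero] at h0
      obtain ⟨i, hi⟩ := x.2.2
      fin_cases i
      exacts [hi h0, hi h1, hi h2, hi h3]
    by_cases hu : x.1 (Sum.inl 0) = 0
    · have hv : x.1 (Sum.inl 1) ≠ 0 := by
        obtain ⟨j, hj⟩ := x.2.1
        fin_cases j
        exacts [absurd hu hj, hj]
      have hx1 : eval x.1 (W.xhat 1 1) ≠ 0 := by simp [eval_xhat, h1, hv]
      obtain ⟨s, hs, hs'⟩ := exists_normalize x hv (Units.mk0 _ hx1)⁻¹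
      refine ⟨s, (Units.mk0 _ hx1)⁻¹, Or.inr ?_⟩
      rintro (j | i)
      · rw [hs]
        fin_cases j <;> simp [hu, hv]
      · rw [hs']
        fin_cases i
        · simp [b0, eval_xhat, h0, hu]
          rw [← Nat.sub_add_cancel ha, Nat.add_sub_cancel, pow_add]
          field_simp
        · simp [b1, hx1]
        · simp [eval_xhat, h2]
        · simp [eval_xhat, h3]
    · have hx1 : eval x.1 (W.xhat 0 1) ≠ 0 := by simp [eval_xhat, h1, hu]
      obtain ⟨s, hs, hs'⟩ := exists_normalize x hu (Units.mk0 _ hx1)⁻¹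
      refine ⟨s, (Units.mk0 _ hx1)⁻¹, Or.inl ⟨x.1 (Sum.inl 1) / x.1 (Sum.inl 0), ?_⟩⟩
      rintro (j | i)
      · rw [hs]
        fin_cases j <;> simp [hu]
      · rw [hs']
        fin_cases i
        · have h4 : x.1 (Sum.inl 1) / x.1 (Sum.inl 0) - τ =
              (x.1 (Sum.inl 1) - τ * x.1 (Sum.inl 0)) / x.1 (Sum.inl 0) := by
            field_simp
          simp [b0, eval_xhat, h0]
          rw [h4, div_pow, ← Nat.sub_add_cancel ha, Nat.add_sub_cancel, pow_add]
          field_simp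
        · simp [b1, hx1]
        · simp [eval_xhat, h2]
        · simp [eval_xhat, h3]

/-! ### Hypersurfaces with finitely many singular points -/

theorem IsBihom.sum_mul_b_eq {a : Cox} {d : ℤ × ℤ} (ha : W.IsBihom a d)
    {m : Fin 2 ⊕ Fin 4 →₀ ℕ} (hm : coeff m a ≠ 0) :
    ∑ i, (m (Sum.inr i) : ℤ) * W.b i = d.2 := by
  have h := congrArg Prod.snd (ha hm)
  rw [Finsupp.weight_apply, Finsupp.sum_fintype _ _ (by simp), Fintype.sum_sum_type, Prod.snd_add,
    Prod.snd_sum, Prod.snd_sum] at h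
  simpa [wt] using h

theorem IsBihom.eq_zero_of_snd_neg {a : Cox} {d : ℤ × ℤ} (ha : W.IsBihom a d) (hd : d.2 < 0) :
    a = 0 := by
  by_contra h
  obtain ⟨m, hm⟩ := exists_coeff_ne_zero h
  have := ha.sum_mul_b_eq hm
  have h0 : 0 ≤ ∑ i, (m (Sum.inr i) : ℤ) * W.b i := Finset.sum_nonneg fun i _ => by positivity
  omega

/-- A polynomial of degree `2` in the `xᵢ` is the sum of a multiple of the variable `x_t` of
weight `2` and of a polynomial in the other variables. -/
theorem IsBihom.eval_eq_add {t : Fin 4} (hb : ∀ i, W.b i = if i = t then 2 else 1) {a : Cox}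
    {d : ℤ × ℤ} (ha : W.IsBihom a d) (hd : d.2 = 2) {x y P : Fin 2 ⊕ Fin 4 → ℂ}
    (hy : ∀ j, y (Sum.inl j) = x (Sum.inl j)) (hP : ∀ j, P (Sum.inl j) = x (Sum.inl j))
    (hyt : y (Sum.inr t) = 0) (hyi : ∀ i, i ≠ t → y (Sum.inr i) = x (Sum.inr i))
    (hPt : P (Sum.inr t) = 1) (hPi : ∀ i, i ≠ t → P (Sum.inr i) = 0) :
    eval x a = x (Sum.inr t) * eval P a + eval y a := by
  rw [eval_eq' x, eval_eq' P, eval_eq' y, Finset.mul_sum, ← Finset.sum_add_distrib]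
  refine Finset.sum_congr rfl fun m hm => ?_
  have hs := ha.sum_mul_b_eq (mem_support_iff.1 hm)
  rw [hd, Fintype.sum_eq_add_sum_compl t, hb t, if_pos rfl] at hs
  have hnn : ∀ i ∈ ({t}ᶜ : Finset (Fin 4)), 0 ≤ (m (Sum.inr i) : ℤ) * W.b i :=
    fun i _ => by positivity
  simp only [Fintype.prod_sum_type, hy, hP]
  suffices h : ∏ i, x (Sum.inr i) ^ m (Sum.inr i) = x (Sum.inr t) *
      ∏ i, P (Sum.inr i) ^ m (Sum.inr i) + ∏ i, y (Sum.inr i) ^ m (Sum.inr i) by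
    rw [h]
    ring
  by_cases hmt : m (Sum.inr t) = 0
  · have hP0 : ∏ i, P (Sum.inr i) ^ m (Sum.inr i) = 0 := by
      obtain ⟨i, hi, hi0⟩ : ∃ i ∈ ({t}ᶜ : Finset (Fin 4)), (m (Sum.inr i) : ℤ) * W.b i ≠ 0 := by
        by_contra! h0
        rw [Finset.sum_eq_zero h0, hmt] at hs
        simp at hs
      have hmi : m (Sum.inr i) ≠ 0 := fun h0 => hi0 (by simp [h0])
      refine Finset.prod_eq_zero (Finset.mem_univ i) ?_
      rw [hPi i (by simpa using hi), zero_pow hmi]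
    rw [hP0, mul_zero, zero_add]
    refine Finset.prod_congr rfl fun i _ => ?_
    by_cases hi : i = t
    · rw [hi, hmt, pow_zero, pow_zero]
    · rw [hyi i hi]
  · have hnn' := Finset.sum_nonneg hnn
    have h1 : m (Sum.inr t) = 1 := by
      push_cast at hs
      omega
    have h0 : ∀ i, i ≠ t → m (Sum.inr i) = 0 := by
      intro i hi
      have := (Finset.sum_eq_zero_iff_of_nonneg hnn).1 (by rw [h1] at hs; push_cast at hs; omega) i
        (by simpa using hi)
      rw [hb, if_neg hi] at this
      simpa using this
    have hprod : ∀ z : Fin 2 ⊕ Fin 4 → ℂ, ∏ i, z (Sum.inr i) ^ m (Sum.inr i) = z (Sum.inr t) := by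
      intro z
      rw [Fintype.prod_eq_single t fun i hi => by rw [h0 i hi, pow_zero], h1, pow_one]
    rw [hprod, hprod, hprod, hPt, hyt, mul_one, add_zero]

/-- The coordinate point `x_t = 1` in the fibre `v = τ u`. -/
def vertex (t : Fin 4) (τ : ℂ) : W.Stable :=
  ⟨Sum.elim ![1, τ] fun i => if i = t then 1 else 0, ⟨0, by simp⟩, ⟨t, by simp⟩⟩

namespace Subvariety

variable {V : W.Subvariety} {F : Cox} {τ : ℂ}

/-- The fibre `v = τ u` contains no singular points of `V`. -/
def IsSmoothFibre (V : W.Subvariety) (τ : ℂ) : Prop :=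
  ∀ p : V.Pt, p.1.coords (Sum.inl 1) = τ * p.1.coords (Sum.inl 0) → p ∈ V.regularLocus

theorem exists_isSmoothFibre (hsing : (V.regularLocusᶜ).Finite) : ∃ τ, V.IsSmoothFibre τ := by
  obtain ⟨τ, hτ⟩ := (hsing.image fun p : V.Pt =>
    p.1.coords (Sum.inl 1) / p.1.coords (Sum.inl 0)).exists_notMem
  refine ⟨τ, fun p hp => ?_⟩
  by_contra hreg
  have hu : p.1.coords (Sum.inl 0) ≠ 0 := by
    intro hu
    obtain ⟨j, hj⟩ := p.1.exists_inl_ne_zero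
    rw [hu, mul_zero] at hp
    fin_cases j
    exacts [hj hu, hj hp]
  exact hτ ⟨p, hreg, by rw [div_eq_iff hu, hp]⟩

/-- If `F` vanished there, `V` would be singular at this point of the fibre. -/
theorem eval_vertex_ne_zero {d : ℤ × ℤ} (hF : W.IsBihom F d) (hd : Even d.2)
    (hV : V.ideal = Ideal.span {F}) (hτ : V.IsSmoothFibre τ) {t : Fin 4}
    (hb : ∀ i, W.b i = if i = t then 2 else 1) :
    eval (vertex (W := W) t τ).1 F ≠ 0 := by
  intro h0
  have hp : ∀ f ∈ V.ideal, eval (Point.coords (W := W) (Quotient.mk _ (vertex t τ))) f = 0 := by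
    intro f hf
    rw [hV] at hf
    obtain ⟨q, rfl⟩ := Ideal.mem_span_singleton'.1 hf
    rw [map_mul, (Point.eval_coords_mk (W := W) _ hF).2 h0, mul_zero]
  refine not_isRegularLocalRing_of_vertex hF hd hV ⟨_, hp⟩ hb (fun i hi => ?_) (hτ ⟨_, hp⟩ ?_)
  · have := (Point.eval_coords_mk (W := W) (vertex t τ) (isBihom_X (Sum.inr i))).2
      (by simp [vertex, hi])
    simpa using this
  · have := (Point.eval_coords_mk (W := W) (vertex t τ) (a := X (Sum.inl 1) - C τ * X (Sum.inl 0))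
      (IsWeightedHomogeneous.sub (isBihom_X (W := W) (Sum.inl 1))
        (IsWeightedHomogeneous.C_mul (isBihom_X (W := W) (Sum.inl 0)) τ))).2 (by simp [vertex])
    simpa [sub_eq_zero] using this

/-- If `t` were not `2` or `3`, the curve of points `x_t = 1` would lie on `V` and meet the smooth
fibre. -/
theorem exists_isFrame {d : ℤ × ℤ} (hF : W.IsBihom F d) (hd : Even d.2)
    (hV : V.ideal = Ideal.span {F}) (hτ : V.IsSmoothFibre τ)
    (hmem : F ∈ Ideal.span {(X (Sum.inr 2) : Cox), X (Sum.inr 3)}) :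
    ∃ t l, W.IsFrame t l ∧ ((t = 2 ∧ l = 3) ∨ (t = 3 ∧ l = 2)) := by
  obtain ⟨t, hb⟩ := W.weights
  have hne := eval_vertex_ne_zero hF hd hV hτ hb
  obtain ⟨q, r, rfl⟩ := Ideal.mem_span_pair.1 hmem
  have ht : t = 2 ∨ t = 3 := by
    by_contra! h
    apply hne
    simp [vertex, h.1.symm, h.2.symm]
  rcases ht with rfl | rfl
  · exact ⟨2, 3, ⟨hb, by decide, by decide, by decide, by decide, by decide⟩, Or.inl ⟨rfl, rfl⟩⟩
  · exact ⟨3, 2, ⟨hb, by decide, by decide, by decide, by decide, by decide⟩, Or.inr ⟨rfl, rfl⟩⟩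

/-- `V` is the irreducible hypersurface `x_t A = x_l B` of degree `4` in the `xᵢ`, where `b_t = 2`,
so it contains the surface `x_t = x_l = 0`. -/
structure IsHypersurface (V : W.Subvariety) (t l : Fin 4) (d : ℤ) (A B : Cox) : Prop where
  frame : W.IsFrame t l
  isBihom : W.IsBihom (X (Sum.inr t) * A - X (Sum.inr l) * B) (d, 4)
  isBihom_fst : W.IsBihom A ((d, 4) - W.wt (Sum.inr t))
  isBihom_snd : W.IsBihom B ((d, 4) - W.wt (Sum.inr l))
  ne_zero : X (Sum.inr t) * A - X (Sum.inr l) * B ≠ 0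
  ideal_eq : V.ideal = Ideal.span {X (Sum.inr t) * A - X (Sum.inr l) * B}

namespace IsHypersurface

variable {t l : Fin 4} {d : ℤ} {A B : Cox}

theorem mem_ideal (h : V.IsHypersurface t l d A B) :
    X (Sum.inr t) * A - X (Sum.inr l) * B ∈ V.ideal :=
  h.ideal_eq ▸ Ideal.mem_span_singleton_self _

/-- The equation of `V` divides no nonzero form of degree less than `4` in the `xᵢ`. -/
theorem notMem_of_snd_lt (h : V.IsHypersurface t l d A B) {a : Cox} {e : ℤ × ℤ}
    (ha : W.IsBihom a e) (ha0 : a ≠ 0) (he : e.2 < 4) : a ∉ V.ideal := by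
  intro hmem
  rw [h.ideal_eq] at hmem
  obtain ⟨q, hq, rfl⟩ := exists_bihom_of_mem_span_singleton h.isBihom ha hmem
  exact ha0 (by rw [hq.eq_zero_of_snd_neg (by simpa using he), mul_zero])

theorem X_notMem (h : V.IsHypersurface t l d A B) (k : Fin 2 ⊕ Fin 4) : X k ∉ V.ideal := by
  refine h.notMem_of_snd_lt (isBihom_X k) (X_ne_zero k) ?_
  rcases k with j | i
  · simp [wt]
  · simp only [wt, h.frame.b_eq]
    split_ifs <;> simp

/-- `x_t²` occurs in the equation, as the point `x_t = 1` of a general fibre does not lie on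
`V`. -/
theorem eval_vertex_ne_zero (h : V.IsHypersurface t l d A B) (hτ : V.IsSmoothFibre τ) :
    eval (vertex (W := W) t τ).1 A ≠ 0 := by
  have := Subvariety.eval_vertex_ne_zero h.isBihom ⟨2, rfl⟩ h.ideal_eq hτ h.frame.b_eq
  simpa [vertex, h.frame.ne] using this

theorem fst_notMem (h : V.IsHypersurface t l d A B) (hτ : V.IsSmoothFibre τ) : A ∉ V.ideal := by
  refine h.notMem_of_snd_lt h.isBihom_fst ?_ ?_
  · rintro rfl
    exact h.eval_vertex_ne_zero hτ (map_zero _)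
  · simp [wt, h.frame.b_fst]

/-- At a point of `x_t = x_l = 0` where `A` and `B` vanish all partial derivatives of the equation
vanish. -/
theorem ne_zero_or_ne_zero (h : V.IsHypersurface t l d A B) {p : V.Pt} (hp : p ∈ V.regularLocus)
    (ht : p.1.coords (Sum.inr t) = 0) (hl : p.1.coords (Sum.inr l) = 0) :
    eval p.1.coords A ≠ 0 ∨ eval p.1.coords B ≠ 0 := by
  by_contra! hAB
  obtain ⟨j, hj⟩ := p.1.exists_inl_ne_zero
  obtain ⟨i, hi⟩ := p.1.exists_inr_ne_zero
  have hit : i ≠ t := by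
    rintro rfl
    exact hi ht
  refine not_isRegularLocalRing_of_pderiv_eq_zero h.isBihom h.ne_zero h.ideal_eq p
    (h.frame.b_of_ne hit) hj hi (fun k => ?_) hp
  simp [ht, hl, hAB.1, hAB.2]

theorem ideal_le_of_mem (h : V.IsHypersurface t l d A B) {I : Ideal Cox}
    (ht : X (Sum.inr t) * A ∈ I) (hl : X (Sum.inr l) ∈ I) : V.ideal ≤ I := by
  rw [h.ideal_eq, Ideal.span_singleton_le_iff_mem]
  exact I.sub_mem ht (I.mul_mem_right _ hl)

end IsHypersurface

end Subvariety

/-! ### The curves on the hypersurface -/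

open Subvariety RatCurve

section Curves

variable {t l : Fin 4} {τ c₀ c₁ c₂ c : ℂ}

theorem isBihom_snd_sub_mul_fst (τ : ℂ) :
    W.IsBihom (X (Sum.inl 1) - C τ * X (Sum.inl 0)) (1, 0) :=
  IsWeightedHomogeneous.sub (isBihom_X (W := W) (Sum.inl 1))
    (IsWeightedHomogeneous.C_mul (isBihom_X (W := W) (Sum.inl 0)) τ)

theorem verticalCurve_snd_mem (h : W.IsFrame t l) :
    X (Sum.inr l) ∈ (verticalCurve h τ c₀ c₁ c₂).toSubvariety.ideal := by
  rw [mem_ideal_iff (isBihom_X _)]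
  simp [verticalCurve, verticalPar, h.snd_ne_zero, h.snd_ne_one, h.ne]

theorem verticalCurve_fst_mem_iff (h : W.IsFrame t l) :
    X (Sum.inr t) ∈ (verticalCurve h τ c₀ c₁ c₂).toSubvariety.ideal ↔ c₀ = 0 ∧ c₁ = 0 ∧ c₂ = 0 := by
  rw [mem_ideal_iff (isBihom_X _)]
  simp only [verticalCurve, aeval_X, verticalPar, Sum.elim_inr, h.fst_ne_zero, h.fst_ne_one,
    if_false, if_true]
  constructor
  · intro h0
    have := fun n => congrArg (fun q => Polynomial.coeff q n) h0
    simp only [Polynomial.coeff_add, Polynomial.coeff_C_mul, Polynomial.coeff_X,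
      Polynomial.coeff_X_pow, Polynomial.coeff_C, Polynomial.coeff_zero] at this
    exact ⟨by simpa using this 0, by simpa using this 1, by simpa using this 2⟩
  · rintro ⟨rfl, rfl, rfl⟩
    simp

theorem verticalCurve_points_subset (h : W.IsFrame t l) {V : W.Subvariety}
    (hτ : V.IsSmoothFibre τ) (hC : V.ideal ≤ (verticalCurve h τ c₀ c₁ c₂).toSubvariety.ideal) :
    (verticalCurve h τ c₀ c₁ c₂).points hC ⊆ V.regularLocus := by
  rintro _ ⟨o, rfl⟩
  apply hτ
  have hmem : X (Sum.inl 1) - C τ * X (Sum.inl 0) ∈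
      (verticalCurve h τ c₀ c₁ c₂).toSubvariety.ideal := by
    rw [mem_ideal_iff (isBihom_snd_sub_mul_fst τ)]
    simp [verticalCurve, verticalPar]
  have := ((verticalCurve h τ c₀ c₁ c₂).pt o).2 _ hmem
  change eval (((verticalCurve h τ c₀ c₁ c₂).pt o).incl hC).1.coords _ = 0 at this
  simpa [sub_eq_zero] using this

theorem sectionCurve_mem (h : W.IsFrame t l) {i : Fin 4} (h0 : i ≠ 0) (h1 : i ≠ 1) :
    X (Sum.inr i) ∈ (sectionCurve h τ c).toSubvariety.ideal := by
  rw [mem_ideal_iff (isBihom_X _)]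
  fin_cases i
  · exact absurd rfl h0
  · exact absurd rfl h1
  · simp [sectionCurve]
  · simp [sectionCurve]

/-- A general section of this form avoids the singular points. -/
theorem exists_sectionCurve_points_subset (h : W.IsFrame t l) {V : W.Subvariety}
    (hsing : (V.regularLocusᶜ).Finite) (hτ : V.IsSmoothFibre τ) :
    ∃ c, ∀ hC : V.ideal ≤ (sectionCurve h τ c).toSubvariety.ideal,
      (sectionCurve h τ c).points hC ⊆ V.regularLocus := by
  -- Outside the fibre `v = τ u` a point lies on at most one of the sections.
  obtain ⟨c, hc⟩ := (hsing.image fun p : V.Pt => p.1.coords (Sum.inr 0) /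
    ((p.1.coords (Sum.inl 1) - τ * p.1.coords (Sum.inl 0)) ^ (W.a 1 - W.a 0) *
      p.1.coords (Sum.inr 1))).exists_notMem
  refine ⟨c, fun hC => ?_⟩
  rintro _ ⟨o, rfl⟩
  by_contra hreg
  set p := ((sectionCurve h τ c).pt o).incl hC
  have hv : p.1.coords (Sum.inl 1) - τ * p.1.coords (Sum.inl 0) ≠ 0 :=
    fun h0 => hreg (hτ p (sub_eq_zero.1 h0))
  have h1 : p.1.coords (Sum.inr 1) ≠ 0 := by
    have : eval p.1.coords (X (Sum.inr 1)) ≠ 0 := by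
      change eval ((sectionCurve h τ c).pt o).1.coords _ ≠ 0
      rw [Ne, eval_pt_iff (isBihom_X _)]
      cases o <;> simp [param, sectionCurve]
    simpa using this
  have hb : W.IsBihom (X (Sum.inr 0) - C c * ((X (Sum.inl 1) - C τ * X (Sum.inl 0)) ^
      (W.a 1 - W.a 0) * X (Sum.inr 1))) (W.wt (Sum.inr 0)) := by
    refine IsWeightedHomogeneous.sub (isBihom_X _) (IsWeightedHomogeneous.C_mul
      (IsBihom.congr (IsWeightedHomogeneous.mul (IsWeightedHomogeneous.pow
        (isBihom_snd_sub_mul_fst τ) _) (isBihom_X (Sum.inr 1))) ?_) _)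
    have := h.a_zero_le_a_one
    ext
    · simp [wt]
      omega
    · simp [wt, h.b_of_ne h.fst_ne_zero.symm, h.b_of_ne h.fst_ne_one.symm]
  have hmem := ((sectionCurve h τ c).pt o).2 _ ((mem_ideal_iff hb).2 (by simp [sectionCurve]))
  refine hc ⟨p, hreg, ?_⟩
  rw [div_eq_iff (mul_ne_zero (pow_ne_zero _ hv) h1)]
  change eval p.1.coords _ = 0 at hmem
  simpa [sub_eq_zero] using hmem

end Curves

namespace Subvariety.IsHypersurface

variable {V : W.Subvariety} {t l : Fin 4} {d : ℤ} {A B : Cox} {τ : ℂ}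

/-- Otherwise `A` would vanish identically on the line `x_t = x_l = 0` in the fibre `v = τ u`, and
`V` would be singular at the zeros of the cubic form `B` on this line. -/
theorem fst_notMem_line (h : V.IsHypersurface t l d A B) (hτ : V.IsSmoothFibre τ) :
    A ∉ (verticalCurve h.frame τ 0 0 0).toSubvariety.ideal := by
  intro hA
  set Γ := verticalCurve h.frame τ 0 0 0
  have hl : X (Sum.inr l) ∈ Γ.toSubvariety.ideal := verticalCurve_snd_mem h.frame
  have ht : X (Sum.inr t) ∈ Γ.toSubvariety.ideal :=
    (verticalCurve_fst_mem_iff h.frame).2 ⟨rfl, rfl, rfl⟩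
  have hC : V.ideal ≤ Γ.toSubvariety.ideal := h.ideal_le_of_mem (Ideal.mul_mem_right _ _ ht) hl
  obtain ⟨o, ho⟩ : ∃ o, eval (Γ.pt o).1.coords B = 0 := by
    by_cases hB : B ∈ Γ.toSubvariety.ideal
    · exact ⟨none, (Γ.pt none).2 B hB⟩
    · by_contra! h0
      have h1 : ∑ᶠ o, Γ.mult o B = Γ.deg ((d, 4) - W.wt (Sum.inr l)) :=
        (sum_rootMultiplicity h.isBihom_snd hB).2
      rw [finsum_eq_zero_of_forall_eq_zero fun o => mult_eq_zero h.isBihom_snd (h0 o)] at h1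
      simp [Γ, verticalCurve, wt, h.frame.b_of_ne h.frame.ne] at h1
  have ht0 := (Γ.pt o).2 _ ht
  have hl0 := (Γ.pt o).2 _ hl
  rw [eval_X] at ht0 hl0
  rcases h.ne_zero_or_ne_zero
    (verticalCurve_points_subset h.frame hτ hC ⟨o, rfl⟩) ht0 hl0 with h0 | h0
  · exact h0 ((Γ.pt o).2 A hA)
  · exact h0 ho

/-- The residual intersection of `V` with `x_l = 0` in the fibre `v = τ u` is the conic `A = 0`. -/
theorem exists_conic (h : V.IsHypersurface t l d A B) (hτ : V.IsSmoothFibre τ) :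
    ∃ c₀ c₁ c₂, A ∈ (verticalCurve h.frame τ c₀ c₁ c₂).toSubvariety.ideal ∧
      X (Sum.inr t) ∉ (verticalCurve h.frame τ c₀ c₁ c₂).toSubvariety.ideal := by
  have hA := h.fst_notMem_line hτ
  have hc := h.eval_vertex_ne_zero hτ
  set e := eval (vertex (W := W) t τ).1 A
  have hdeg : ((d, 4) - W.wt (Sum.inr t)).2 = 2 := by simp [wt, h.frame.b_fst]
  rw [mem_ideal_iff h.isBihom_fst] at hA
  set q := aeval (verticalCurve h.frame τ 0 0 0).par A with hq
  -- `A` has degree `2` on the line `x_t = x_l = 0` of the fibre.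
  have hq2 : q.natDegree < 3 := by
    have := Polynomial.rootMultiplicity_zero_add_natDegree hA fun z hz =>
      eval_restrInf_of_ne_zero (Γ := verticalCurve h.frame τ 0 0 0) h.isBihom_fst hz
    have h2 : (verticalCurve h.frame τ 0 0 0).deg ((d, 4) - W.wt (Sum.inr t)) = 2 := hdeg
    rw [h2] at this
    omega
  have hqs : q = ∑ i ∈ Finset.range 3, Polynomial.C (q.coeff i) * Polynomial.X ^ i :=
    q.as_sum_range_C_mul_X_pow' hq2
  -- On the fibre of `x_l = 0` the form `A` is `e x_t + q(x₀, x₁)`.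
  refine ⟨-q.coeff 0 / e, -q.coeff 1 / e, -q.coeff 2 / e, ?_, ?_⟩
  · rw [mem_ideal_iff h.isBihom_fst]
    refine Polynomial.funext fun z => ?_
    rw [eval_restr, Polynomial.eval_zero, h.isBihom_fst.eval_eq_add h.frame.b_eq hdeg
      (y := fun k => ((verticalCurve h.frame τ 0 0 0).par k).eval z) (P := (vertex (W := W) t τ).1),
      ← eval_restr, ← hq, hqs]
    · simp [verticalCurve, verticalPar, h.frame.fst_ne_zero, h.frame.fst_ne_one,
        Finset.sum_range_succ]
      field_simp
      ring
    · intro j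
      simp [verticalCurve, verticalPar]
    · intro j
      fin_cases j <;> simp [verticalCurve, verticalPar, vertex]
    · simp [verticalCurve, verticalPar, h.frame.fst_ne_zero, h.frame.fst_ne_one]
    · intro i hi
      simp [verticalCurve, verticalPar, hi]
    · simp [vertex]
    · intro i hi
      simp [vertex, hi]
  · rw [verticalCurve_fst_mem_iff]
    rintro ⟨h0, h1, h2⟩
    simp only [div_eq_zero_iff, hc, or_false, neg_eq_zero] at h0 h1 h2
    apply hA
    rw [hqs]
    simp [Finset.sum_range_succ, h0, h1, h2]

end Subvariety.IsHypersurface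

/-! ### The line bundles and the surface `x_t = x_l = 0` -/

/-- The index of a variable among `u`, `v` that does not vanish at the point. -/
def Point.inlIndex (x : W.Point) : Fin 2 := x.exists_inl_ne_zero.choose

theorem Point.inlIndex_spec (x : W.Point) : x.coords (Sum.inl x.inlIndex) ≠ 0 :=
  x.exists_inl_ne_zero.choose_spec

/-- The index of a variable among the `xᵢ` that does not vanish at the point. -/
def Point.inrIndex (x : W.Point) : Fin 4 := x.exists_inr_ne_zero.choose

theorem Point.inrIndex_spec (x : W.Point) : x.coords (Sum.inr x.inrIndex) ≠ 0 :=
  x.exists_inr_ne_zero.choose_spec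

theorem Point.eval_xhat_ne_zero (x : W.Point) :
    eval x.coords (W.xhat x.inlIndex x.inrIndex) ≠ 0 := by
  rw [eval_xhat]
  exact mul_ne_zero x.inrIndex_spec (pow_ne_zero _ x.inlIndex_spec)

/-- The numerator of a fraction of bidegree `(n, 1)` that is invertible at the point, provided
`X (inr x.inrIndex)` has weight `1`. The powers `n.toNat` and `(-n).toNat` in the numerator and the
denominator allow for both signs of `n`. -/
def Point.twistNum (n : ℤ) (x : W.Point) : Cox :=
  W.xhat x.inlIndex x.inrIndex * X (Sum.inl x.inlIndex) ^ n.toNat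

/-- The denominator of the fraction with numerator `twistNum n`. -/
def Point.twistDen (n : ℤ) (x : W.Point) : Cox := X (Sum.inl x.inlIndex) ^ (-n).toNat

theorem Point.eval_twistNum_ne_zero (n : ℤ) (x : W.Point) :
    eval x.coords (x.twistNum n) ≠ 0 := by
  rw [twistNum, map_mul, map_pow, eval_X]
  exact mul_ne_zero x.eval_xhat_ne_zero (pow_ne_zero _ x.inlIndex_spec)

theorem Point.eval_twistDen_ne_zero (n : ℤ) (x : W.Point) :
    eval x.coords (x.twistDen n) ≠ 0 := by
  rw [twistDen, map_pow, eval_X]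
  exact pow_ne_zero _ x.inlIndex_spec

theorem Point.isBihom_twistNum (n : ℤ) {x : W.Point} (hx : W.b x.inrIndex = 1) :
    W.IsBihom (x.twistNum n) ((n.toNat : ℤ), 1) :=
  IsBihom.congr ((isBihom_xhat _ _).mul ((isBihom_X (Sum.inl x.inlIndex)).pow _))
    (by simp [wt, hx])

theorem Point.isBihom_twistDen (n : ℤ) (x : W.Point) :
    W.IsBihom (x.twistDen n) (((-n).toNat : ℤ), 0) :=
  IsBihom.congr ((isBihom_X (Sum.inl x.inlIndex)).pow _) (by simp [wt])

namespace Subvariety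

variable {V : W.Subvariety}

/-- The divisor of a section `s` of `𝒪(d)` on `V` has the degree of `𝒪(d)` on every curve. Its local
equation at `p` is `s / m` for a polynomial `m` that does not vanish at `p`. -/
theorem exists_cartier_degree_eq {d : ℤ × ℤ} {s : Cox} (hs : W.IsBihom s d) (hsV : s ∉ V.ideal)
    (hm : ∀ p : V.Pt, ∃ m, W.IsBihom m d ∧ eval p.1.coords m ≠ 0) :
    ∃ φ ∈ V.cartier Set.univ, ∀ (Γ : RatCurve W) (hC : V.ideal ≤ Γ.toSubvariety.ideal),
      Γ.degree hC φ = Γ.deg d := by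
  choose m hm hmp using hm
  have hn := fun p => notMem_of_eval_ne_zero p (hmp p)
  have key : ∀ p q, unitVal (mkUnit s (m q) hs (hm q) hsV (hn q) /
      mkUnit s (m p) hs (hm p) hsV (hn p)) = V.frac (m p) (m q) := by
    intro p q
    rw [unitVal_div, unitVal_mkUnit, unitVal_mkUnit, frac_def, frac_def, frac_def]
    have h1 := toFrac_ne_zero.2 hsV
    have h2 := toFrac_ne_zero.2 (hn p)
    have h3 := toFrac_ne_zero.2 (hn q)
    field_simp
  set φ : V.Pt → (V.functionField)ˣ := fun p => mkUnit s (m p) hs (hm p) hsV (hn p)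
  have key' : ∀ p q, unitVal (φ q / φ p) = V.frac (m p) (m q) := key
  clear_value φ
  refine ⟨φ, fun p _ => ⟨d, m p, hm p, hmp p, fun q _ hq => ?_⟩, fun Γ hC => ?_⟩
  · exact isUnitAt_iff.2 ⟨d, m p, m q, hm p, hm q, hq, hmp q, key' p q⟩
  · have h0 : ∀ o, eval (Γ.pt o).1.coords (1 : Cox) ≠ 0 := fun o => by simp
    have := RatCurve.degree_eq_of_ratio (φ := φ) hC (fun o => m ((Γ.pt o).incl hC)) (fun _ => 1)
      (fun o => hm _) (fun _ => isWeightedHomogeneous_one ℂ W.wt)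
      (fun o => hmp ((Γ.pt o).incl hC)) h0
      (fun o => by rw [key', mul_one, mul_one])
    rwa [map_zero, sub_zero] at this

/-- If `x_k A = x_l B` on `V` and `A(p) ≠ 0`, then `x_l` generates the ideal of `x_k = x_l = 0` at
`p`. -/
theorem idealAt_eq_span {k l : Fin 2 ⊕ Fin 4} {A B T T' : Cox} {d e e' : ℤ × ℤ}
    (hrel : X k * A - X l * B ∈ V.ideal) (hA : W.IsBihom A (d - W.wt k))
    (hB : W.IsBihom B (d - W.wt l)) (hT : W.IsBihom T e) (hT' : W.IsBihom T' e')
    (hd : W.wt l + e = d - W.wt k + e') {p : V.Pt} (hAp : eval p.1.coords A ≠ 0)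
    (hTp : eval p.1.coords T ≠ 0) (hTp' : eval p.1.coords T' ≠ 0) :
    ∃ z : V.localRing p, (z : V.Frac) = V.frac (X l * T) (A * T') ∧
      V.idealAt (Ideal.span {X k, X l}) p = Ideal.span {z} := by
  have hne : eval p.1.coords (A * T') ≠ 0 := by
    rw [map_mul]
    exact mul_ne_zero hAp hTp'
  have hbih : W.IsBihom (X l * T) (d - W.wt k + e') :=
    IsBihom.congr (IsWeightedHomogeneous.mul (isBihom_X l) hT) hd
  refine ⟨⟨_, mem_localRing.2 ⟨_, _, _, hbih, hA.mul hT', hne, rfl⟩⟩, rfl, le_antisymm ?_ ?_⟩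
  · refine Ideal.span_le.2 ?_
    rintro y ⟨c, a, b, ha, hb, haJ, hbp, hy⟩
    obtain ⟨q, r, hq, hr, rfl⟩ := exists_bihom_of_mem_span_pair ha haJ
    have hnum : W.IsBihom ((B * q + A * r) * T') (d - W.wt k - W.wt l + c + e') :=
      IsWeightedHomogeneous.mul (IsWeightedHomogeneous.add
        (IsBihom.congr (hB.mul hq) (by abel)) (IsBihom.congr (hA.mul hr) (by abel))) hT'
    have hden : W.IsBihom (b * T) (d - W.wt k - W.wt l + c + e') :=
      IsBihom.congr (hb.mul hT) (by rw [← add_left_inj (W.wt l), add_assoc, add_comm e, hd]; abel)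
    have hdne : eval p.1.coords (b * T) ≠ 0 := by
      rw [map_mul]
      exact mul_ne_zero hbp hTp
    refine Ideal.mem_span_singleton'.2
      ⟨⟨_, mem_localRing.2 ⟨_, _, _, hnum, hden, hdne, rfl⟩⟩, Subtype.ext ?_⟩
    rw [hy]
    have h1 := toFrac_ne_zero.2 (notMem_of_eval_ne_zero p hAp)
    have h2 := toFrac_ne_zero.2 (notMem_of_eval_ne_zero p hTp)
    have h3 := toFrac_ne_zero.2 (notMem_of_eval_ne_zero p hTp')
    have h4 := toFrac_ne_zero.2 (notMem_of_eval_ne_zero p hbp)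
    have h5 := toFrac_eq_zero.2 hrel
    simp only [map_sub, map_mul] at h5
    change V.frac _ _ * V.frac _ _ = V.frac _ _
    simp only [frac_def, map_mul, map_add]
    field_simp
    linear_combination (-(V.toFrac q)) * h5
  · rw [Ideal.span_singleton_le_iff_mem]
    exact Ideal.subset_span ⟨_, _, _, hbih, hA.mul hT', Ideal.mul_mem_right _ _
      (Ideal.subset_span (Set.mem_insert_of_mem _ rfl)), hne, rfl⟩

namespace IsHypersurface

variable {t l : Fin 4} {d : ℤ} {A B : Cox}

theorem b_inrIndex (h : V.IsHypersurface t l d A B) {p : V.Pt} (ht : p.1.coords (Sum.inr t) = 0) :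
    W.b p.1.inrIndex = 1 :=
  h.frame.b_of_ne fun h0 => p.1.inrIndex_spec (h0 ▸ ht)

/-- `x_l / A` has bidegree `(-n, -1)`, where `n = d + a_t + a_l`. -/
theorem wt_add (h : V.IsHypersurface t l d A B) :
    W.wt (Sum.inr l) + (((d + W.a t + W.a l).toNat : ℤ), 1) =
      (d, 4) - W.wt (Sum.inr t) + (((-(d + W.a t + W.a l)).toNat : ℤ), 0) := by
  ext
  · simp [wt]
    omega
  · simp [wt, h.frame.b_fst, h.frame.b_of_ne h.frame.ne]

/-- `x_t / B` has bidegree `(-n, -1)`, where `n = d + a_t + a_l`. -/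
theorem wt_add' (h : V.IsHypersurface t l d A B) :
    W.wt (Sum.inr t) + (((d + W.a t + W.a l).toNat : ℤ), 1) =
      (d, 4) - W.wt (Sum.inr l) + (((-(d + W.a t + W.a l)).toNat : ℤ), 0) := by
  have := h.wt_add
  rw [sub_add_eq_add_sub, eq_sub_iff_add_eq] at this ⊢
  rw [← this]
  abel

open Classical in
/-- Local equations, at the nonsingular points of `V`, of the surface `x_t = x_l = 0`. Off the
surface this is `1`; on the surface it is `x_l / A`, which equals `x_t / B` on `V`, times an
invertible fraction that makes it of bidegree `0`. -/
def surfaceEq (h : V.IsHypersurface t l d A B) (hA : A ∉ V.ideal) (p : V.Pt) :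
    (V.functionField)ˣ :=
  if hp : p.1.coords (Sum.inr t) = 0 ∧ p.1.coords (Sum.inr l) = 0 then
    mkUnit (X (Sum.inr l) * p.1.twistNum (d + W.a t + W.a l))
      (A * p.1.twistDen (d + W.a t + W.a l))
      (IsBihom.congr (IsWeightedHomogeneous.mul (isBihom_X _)
        (Point.isBihom_twistNum _ (h.b_inrIndex hp.1))) h.wt_add)
      (h.isBihom_fst.mul (Point.isBihom_twistDen _ _))
      (mul_notMem (h.X_notMem _) (notMem_of_eval_ne_zero p (Point.eval_twistNum_ne_zero _ _)))
      (mul_notMem hA (notMem_of_eval_ne_zero p (Point.eval_twistDen_ne_zero _ _)))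
  else 1

theorem surfaceEq_of_mem (h : V.IsHypersurface t l d A B) (hA : A ∉ V.ideal) {p : V.Pt}
    (ht : p.1.coords (Sum.inr t) = 0) (hl : p.1.coords (Sum.inr l) = 0) :
    unitVal (h.surfaceEq hA p) = V.frac (X (Sum.inr l) * p.1.twistNum (d + W.a t + W.a l))
      (A * p.1.twistDen (d + W.a t + W.a l)) := by
  rw [surfaceEq, dif_pos ⟨ht, hl⟩]
  rfl

theorem surfaceEq_of_mem' (h : V.IsHypersurface t l d A B) (hA : A ∉ V.ideal) (hB : B ∉ V.ideal)
    {p : V.Pt} (ht : p.1.coords (Sum.inr t) = 0) (hl : p.1.coords (Sum.inr l) = 0) :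
    unitVal (h.surfaceEq hA p) = V.frac (X (Sum.inr t) * p.1.twistNum (d + W.a t + W.a l))
      (B * p.1.twistDen (d + W.a t + W.a l)) := by
  have hT := notMem_of_eval_ne_zero p (Point.eval_twistDen_ne_zero (d + W.a t + W.a l) p.1)
  rw [h.surfaceEq_of_mem hA ht hl, frac_eq_frac (mul_notMem hA hT) (mul_notMem hB hT)]
  have := V.ideal.mul_mem_left (-(p.1.twistNum (d + W.a t + W.a l) *
    p.1.twistDen (d + W.a t + W.a l))) h.mem_ideal
  convert this using 1
  ring

theorem surfaceEq_of_notMem (h : V.IsHypersurface t l d A B) (hA : A ∉ V.ideal) {p : V.Pt}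
    (hp : ¬ (p.1.coords (Sum.inr t) = 0 ∧ p.1.coords (Sum.inr l) = 0)) :
    h.surfaceEq hA p = 1 := by
  rw [surfaceEq, dif_neg hp]

theorem surfaceEq_mem_cartier (h : V.IsHypersurface t l d A B) (hA : A ∉ V.ideal) :
    h.surfaceEq hA ∈ V.cartier V.regularLocus := by
  intro p hp
  by_cases hD : p.1.coords (Sum.inr t) = 0 ∧ p.1.coords (Sum.inr l) = 0
  · set n := d + W.a t + W.a l with hn
    have hT := Point.isBihom_twistNum n (h.b_inrIndex hD.1)
    have hT' := Point.isBihom_twistDen n p.1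
    have hTp := Point.eval_twistNum_ne_zero n p.1
    have hTp' := Point.eval_twistDen_ne_zero n p.1
    -- The two cases `A(p) ≠ 0` and `B(p) ≠ 0` differ by exchanging `t` and `l`.
    have key : ∀ (i j : Fin 4) (E G : Cox) (e : ℤ × ℤ), W.IsBihom E e → X (Sum.inr i) * E -
        X (Sum.inr j) * G ∈ V.ideal → W.wt (Sum.inr j) + ((n.toNat : ℤ), 1) =
          e + (((-n).toNat : ℤ), 0) → (∀ q : V.Pt, (q.1.coords (Sum.inr t) = 0 ∧
          q.1.coords (Sum.inr l) = 0) ↔ q.1.coords (Sum.inr i) = 0 ∧ q.1.coords (Sum.inr j) = 0) →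
        (∀ q : V.Pt, q.1.coords (Sum.inr t) = 0 → q.1.coords (Sum.inr l) = 0 →
          unitVal (h.surfaceEq hA q) =
            V.frac (X (Sum.inr j) * q.1.twistNum n) (E * q.1.twistDen n)) →
        eval p.1.coords E ≠ 0 → ∃ (d : ℤ × ℤ) (k : Cox), W.IsBihom k d ∧ p.NonvanishingAt k ∧
          ∀ q ∈ V.regularLocus, q.NonvanishingAt k →
            V.IsUnitAt q (h.surfaceEq hA q / h.surfaceEq hA p) := by
      intro i j E G e hE hrel he hiff hval hEp
      refine ⟨_, _, (hE.mul hT).mul hT', ?_, fun q _ hq => ?_⟩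
      · simp only [Pt.NonvanishingAt, map_mul]
        exact mul_ne_zero (mul_ne_zero hEp hTp) hTp'
      simp only [Pt.NonvanishingAt, map_mul, mul_ne_zero_iff] at hq
      obtain ⟨⟨hEq, hTq⟩, hTq'⟩ := hq
      have n1 := toFrac_ne_zero.2 (notMem_of_eval_ne_zero p hEp)
      have n2 := toFrac_ne_zero.2 (notMem_of_eval_ne_zero p hTp)
      have n3 := toFrac_ne_zero.2 (notMem_of_eval_ne_zero p hTp')
      have n4 := toFrac_ne_zero.2 (h.X_notMem (Sum.inr j))
      by_cases hDq : q.1.coords (Sum.inr t) = 0 ∧ q.1.coords (Sum.inr l) = 0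
      · have hSq := Point.eval_twistNum_ne_zero n q.1
        have hSq' := Point.eval_twistDen_ne_zero n q.1
        have n5 := toFrac_ne_zero.2 (notMem_of_eval_ne_zero q hSq)
        have n6 := toFrac_ne_zero.2 (notMem_of_eval_ne_zero q hSq')
        refine isUnitAt_iff.2 ⟨_, q.1.twistNum n * p.1.twistDen n, p.1.twistNum n * q.1.twistDen n,
          (Point.isBihom_twistNum n (h.b_inrIndex hDq.1)).mul hT',
          hT.mul (Point.isBihom_twistDen n q.1), ?_, ?_, ?_⟩
        · rw [map_mul]
          exact mul_ne_zero hSq hTq'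
        · rw [map_mul]
          exact mul_ne_zero hTq hSq'
        · rw [unitVal_div, hval q hDq.1 hDq.2, hval p hD.1 hD.2]
          simp only [frac_def, map_mul]
          field_simp
      · have hjq : q.1.coords (Sum.inr j) ≠ 0 := by
          intro hj
          have hi := q.2 _ hrel
          simp only [map_sub, map_mul, eval_X, hj, zero_mul, sub_zero, mul_eq_zero, hEq,
            or_false] at hi
          exact hDq ((hiff q).2 ⟨hi, hj⟩)
        refine isUnitAt_iff.2 ⟨_, E * p.1.twistDen n, X (Sum.inr j) * p.1.twistNum n,
          hE.mul hT', IsBihom.congr (IsWeightedHomogeneous.mul (isBihom_X _) hT) he, ?_, ?_, ?_⟩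
        · rw [map_mul]
          exact mul_ne_zero hEq hTq'
        · rw [map_mul, eval_X]
          exact mul_ne_zero hjq hTq
        · rw [unitVal_div, h.surfaceEq_of_notMem hA hDq, hval p hD.1 hD.2, map_one, one_div,
            inv_frac]
    rcases h.ne_zero_or_ne_zero hp hD.1 hD.2 with hAp | hBp
    · exact key t l A B _ h.isBihom_fst h.mem_ideal h.wt_add (fun q => Iff.rfl)
        (fun q => h.surfaceEq_of_mem hA) hAp
    · refine key l t B A _ h.isBihom_snd ?_ h.wt_add' (fun q => and_comm)
        (fun q => h.surfaceEq_of_mem' hA (notMem_of_eval_ne_zero p hBp)) hBp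
      rw [← neg_sub]
      exact V.ideal.neg_mem h.mem_ideal
  · have key : ∀ i, (i = t ∨ i = l) → p.1.coords (Sum.inr i) ≠ 0 → ∃ (d : ℤ × ℤ) (k : Cox),
        W.IsBihom k d ∧ p.NonvanishingAt k ∧ ∀ q ∈ V.regularLocus, q.NonvanishingAt k →
          V.IsUnitAt q (h.surfaceEq hA q / h.surfaceEq hA p) := by
      refine fun i hi hpi => ⟨_, _, isBihom_X (Sum.inr i), by simpa [Pt.NonvanishingAt] using hpi,
        fun q _ hq => ?_⟩
      simp only [Pt.NonvanishingAt, eval_X] at hq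
      rw [h.surfaceEq_of_notMem hA hD, h.surfaceEq_of_notMem hA, div_one]
      · exact IsUnitAt.one q
      · rintro ⟨h1, h2⟩
        rcases hi with rfl | rfl
        exacts [hq h1, hq h2]
    by_cases ht : p.1.coords (Sum.inr t) = 0
    · exact key l (Or.inr rfl) fun hl => hD ⟨ht, hl⟩
    · exact key t (Or.inl rfl) ht

/-- At a nonsingular point of `V` the surface `x_t = x_l = 0` is the divisor of `surfaceEq`. -/
theorem idealAt_surface (h : V.IsHypersurface t l d A B) (hA : A ∉ V.ideal) {p : V.Pt}
    (hp : p ∈ V.regularLocus) : ∃ z : V.localRing p, (z : V.Frac) = unitVal (h.surfaceEq hA p) ∧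
      V.idealAt (Ideal.span {X (Sum.inr t), X (Sum.inr l)}) p = Ideal.span {z} := by
  by_cases hD : p.1.coords (Sum.inr t) = 0 ∧ p.1.coords (Sum.inr l) = 0
  · have hT := Point.isBihom_twistNum (d + W.a t + W.a l) (h.b_inrIndex hD.1)
    have hT' := Point.isBihom_twistDen (d + W.a t + W.a l) p.1
    have hTp := Point.eval_twistNum_ne_zero (d + W.a t + W.a l) p.1
    have hTp' := Point.eval_twistDen_ne_zero (d + W.a t + W.a l) p.1
    rcases h.ne_zero_or_ne_zero hp hD.1 hD.2 with hAp | hBp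
    · rw [h.surfaceEq_of_mem hA hD.1 hD.2]
      exact idealAt_eq_span h.mem_ideal h.isBihom_fst h.isBihom_snd hT hT' h.wt_add hAp hTp hTp'
    · rw [h.surfaceEq_of_mem' hA (notMem_of_eval_ne_zero p hBp) hD.1 hD.2, Set.pair_comm]
      refine idealAt_eq_span ?_ h.isBihom_snd h.isBihom_fst hT hT' h.wt_add' hBp hTp hTp'
      rw [← neg_sub]
      exact V.ideal.neg_mem h.mem_ideal
  · refine ⟨1, by rw [h.surfaceEq_of_notMem hA hD, map_one]; rfl, ?_⟩
    rw [Ideal.span_singleton_one, Ideal.eq_top_iff_one]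
    have key : ∀ i, X (Sum.inr i) ∈ ({X (Sum.inr t), X (Sum.inr l)} : Set Cox) →
        p.1.coords (Sum.inr i) ≠ 0 →
        (1 : V.localRing p) ∈ V.idealAt (Ideal.span {X (Sum.inr t), X (Sum.inr l)}) p := by
      intro i hi hpi
      refine Ideal.subset_span ⟨_, _, _, isBihom_X _, isBihom_X _, Ideal.subset_span hi,
        by simpa [Pt.NonvanishingAt] using hpi, ?_⟩
      rw [frac_def, div_self (toFrac_ne_zero.2 (h.X_notMem _))]
      rfl
    by_cases ht : p.1.coords (Sum.inr t) = 0
    · exact key l (by simp) fun hl => hD ⟨ht, hl⟩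
    · exact key t (by simp) ht

end IsHypersurface

end Subvariety

end ScrollData

/-! ### Rank estimates -/

/-- The matrix of values of `I₁, I₂, I₃` on `e₁, e₂, e₃` is nonsingular, as it has the shape
`0 + -`, `0 + +`, `* ? ?` with `* ≠ 0`. -/
theorem three_le_rank_of_homs {G : Type} [CommGroup G] (N : Subgroup G)
    (I₁ I₂ I₃ : G →* Multiplicative ℤ) (h₁ : N ≤ I₁.ker) (h₂ : N ≤ I₂.ker) (h₃ : N ≤ I₃.ker)
    (e₁ e₂ e₃ : G) (h₁₁ : (I₁ e₁).toAdd = 0) (h₁₂ : 0 < (I₁ e₂).toAdd) (h₁₃ : (I₁ e₃).toAdd < 0)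
    (h₂₁ : (I₂ e₁).toAdd = 0) (h₂₂ : 0 < (I₂ e₂).toAdd) (h₂₃ : 0 ≤ (I₂ e₃).toAdd)
    (h₃₁ : (I₃ e₁).toAdd ≠ 0) : 3 ≤ Module.rank ℤ (Additive (G ⧸ N)) := by
  have key : ∀ (I : G →* Multiplicative ℤ), N ≤ I.ker → ∃ J : Additive (G ⧸ N) →ₗ[ℤ] ℤ,
      ∀ g : G, J (Additive.ofMul (g : G ⧸ N)) = (I g).toAdd := fun I hI =>
    ⟨(MonoidHom.toAdditiveLeft (QuotientGroup.lift N I hI)).toIntLinearMap, fun g => rfl⟩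
  obtain ⟨J₁, hJ₁⟩ := key I₁ h₁
  obtain ⟨J₂, hJ₂⟩ := key I₂ h₂
  obtain ⟨J₃, hJ₃⟩ := key I₃ h₃
  have hli : LinearIndependent ℤ ![Additive.ofMul (e₁ : G ⧸ N), Additive.ofMul (e₂ : G ⧸ N),
      Additive.ofMul (e₃ : G ⧸ N)] := by
    rw [Fintype.linearIndependent_iff]
    intro g hg
    simp only [Fin.sum_univ_three, Matrix.cons_val_zero, Matrix.cons_val_one, Matrix.cons_val] at hg
    have g₁ := congrArg J₁ hg
    have g₂ := congrArg J₂ hg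
    have g₃ := congrArg J₃ hg
    simp only [map_add, map_smul, map_zero, smul_eq_mul, hJ₁, hJ₂, hJ₃, h₁₁, h₂₁, mul_zero,
      zero_add] at g₁ g₂ g₃
    have hdet : g 2 * ((I₁ e₃).toAdd * (I₂ e₂).toAdd - (I₂ e₃).toAdd * (I₁ e₂).toAdd) = 0 := by
      linear_combination (I₂ e₂).toAdd * g₁ - (I₁ e₂).toAdd * g₂
    have h2 : g 2 = 0 := by
      refine (mul_eq_zero.1 hdet).resolve_right (ne_of_lt ?_)
      have := mul_neg_of_neg_of_pos h₁₃ h₂₂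
      have := mul_nonneg h₂₃ h₁₂.le
      linarith
    rw [h2, zero_mul, add_zero] at g₁ g₃
    have h1 : g 1 = 0 := (mul_eq_zero.1 g₁).resolve_right h₁₂.ne'
    rw [h1, zero_mul, add_zero] at g₃
    have h0 : g 0 = 0 := (mul_eq_zero.1 g₃).resolve_right h₃₁
    intro i
    fin_cases i
    exacts [h0, h1, h2]
  simpa using hli.cardinal_le_rank

namespace ScrollData

variable {W : ScrollData}

open Subvariety RatCurve

namespace RatCurve

variable (Γ : RatCurve W) {V : W.Subvariety} (hC : V.ideal ≤ Γ.toSubvariety.ideal)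
  {U : Set V.Pt} (hU : Γ.points hC ⊆ U)

/-- The degree on the curve, as a homomorphism. -/
def degreeHom : V.cartier U →* Multiplicative ℤ :=
  MonoidHom.mk' (fun φ => Multiplicative.ofAdd (Γ.degree hC φ.1)) fun φ ψ => by
    rw [← ofAdd_add, ← degree_mul hC (cartier_mono hU φ.2) (cartier_mono hU ψ.2)]
    rfl

theorem toAdd_degreeHom (φ : V.cartier U) : (Γ.degreeHom hC hU φ).toAdd = Γ.degree hC φ.1 := rfl

theorem principal_le_ker_degreeHom :
    (V.principal U).subgroupOf (V.cartier U) ≤ (Γ.degreeHom hC hU).ker := fun φ hφ =>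
  degree_eq_zero_of_principal hC (cartier_mono hU φ.2) (principal_mono hU hφ)

theorem closure_numTrivial_le_ker_degreeHom :
    Subgroup.closure {φ | V.NumTrivial φ} ≤ (Γ.degreeHom hC (Set.subset_univ _)).ker :=
  (Subgroup.closure_le _).2 fun _ hφ => hφ _ hC Γ.dim_eq_one _

end RatCurve

/-- On the hypersurface `x_t A = x_l B` these are the line `x_t = x_l = 0` and the conic
`A = x_l = 0` in a general fibre, and a section in the surface `x_t = x_l = 0`. -/
theorem Subvariety.IsHypersurface.exists_curves {V : W.Subvariety} {t l : Fin 4} {d : ℤ} {A B : Cox}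
    {τ : ℂ} (h : V.IsHypersurface t l d A B) (hA : A ∉ V.ideal)
    (hsing : (V.regularLocusᶜ).Finite) (hτ : V.IsSmoothFibre τ) :
    ∃ (Γ₁ Γ₂ Γ₃ : RatCurve W) (hC₁ : V.ideal ≤ Γ₁.toSubvariety.ideal)
      (hC₂ : V.ideal ≤ Γ₂.toSubvariety.ideal) (hC₃ : V.ideal ≤ Γ₃.toSubvariety.ideal),
      Γ₁.points hC₁ ⊆ V.regularLocus ∧ Γ₂.points hC₂ ⊆ V.regularLocus ∧
      Γ₃.points hC₃ ⊆ V.regularLocus ∧ (∀ e, Γ₁.deg e = e.2) ∧ (∀ e, Γ₂.deg e = e.2) ∧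
      Γ₃.deg (1, 0) = 1 ∧ Γ₁.degree hC₁ (h.surfaceEq hA) < 0 ∧
      0 ≤ Γ₂.degree hC₂ (h.surfaceEq hA) := by
  obtain ⟨c₀, c₁, c₂, hAΓ, htΓ⟩ := h.exists_conic hτ
  obtain ⟨c, hc⟩ := exists_sectionCurve_points_subset h.frame hsing hτ
  set Γ₁ := verticalCurve h.frame τ 0 0 0
  set Γ₂ := verticalCurve h.frame τ c₀ c₁ c₂
  set Γ₃ := sectionCurve h.frame τ c
  have hl₁ : X (Sum.inr l) ∈ Γ₁.toSubvariety.ideal := verticalCurve_snd_mem h.frame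
  have ht₁ : X (Sum.inr t) ∈ Γ₁.toSubvariety.ideal :=
    (verticalCurve_fst_mem_iff h.frame).2 ⟨rfl, rfl, rfl⟩
  have hC₁ : V.ideal ≤ Γ₁.toSubvariety.ideal := h.ideal_le_of_mem (Ideal.mul_mem_right _ _ ht₁) hl₁
  have hC₂ : V.ideal ≤ Γ₂.toSubvariety.ideal :=
    h.ideal_le_of_mem (Ideal.mul_mem_left _ _ hAΓ) (verticalCurve_snd_mem h.frame)
  have hC₃ : V.ideal ≤ Γ₃.toSubvariety.ideal := h.ideal_le_of_mem (Ideal.mul_mem_right _ _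
    (sectionCurve_mem h.frame h.frame.fst_ne_zero h.frame.fst_ne_one))
    (sectionCurve_mem h.frame h.frame.snd_ne_zero h.frame.snd_ne_one)
  have hr₂ := verticalCurve_points_subset h.frame hτ hC₂
  refine ⟨Γ₁, Γ₂, Γ₃, hC₁, hC₂, hC₃, verticalCurve_points_subset h.frame hτ hC₁, hr₂, hc hC₃,
    fun _ => rfl, fun _ => rfl, by simp [Γ₃, sectionCurve], ?_, ?_⟩
  -- The line lies in the surface, where the local equations `x_l / A` only differ by the invertible
  -- fractions of bidegree `(n, 1)`; so the surface has degree `-1` on it.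
  · have ht : ∀ o, (Γ₁.pt o).1.coords (Sum.inr t) = 0 := fun o => by
      simpa using (Γ₁.pt o).2 _ ht₁
    have hl : ∀ o, (Γ₁.pt o).1.coords (Sum.inr l) = 0 := fun o => by
      simpa using (Γ₁.pt o).2 _ hl₁
    set n := d + W.a t + W.a l
    have hT := fun o => Point.isBihom_twistNum n
      (h.b_inrIndex (p := (Γ₁.pt o).incl hC₁) (ht o))
    have hT' := fun o => Point.isBihom_twistDen n (Γ₁.pt o).1
    have hTp := fun o => Point.eval_twistNum_ne_zero n (Γ₁.pt o).1
    have hTp' := fun o => Point.eval_twistDen_ne_zero n (Γ₁.pt o).1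
    rw [degree_eq_of_ratio hC₁ (fun o => (Γ₁.pt o).1.twistDen n)
      (fun o => (Γ₁.pt o).1.twistNum n) hT' hT hTp' hTp fun o => ?_]
    · change (0 : ℤ) - 1 < 0
      norm_num
    · have hne := toFrac_ne_zero.2 (h.X_notMem (Sum.inr l))
      have hAne := toFrac_ne_zero.2 hA
      have h1 := toFrac_ne_zero.2 (notMem_of_eval_ne_zero ((Γ₁.pt none).incl hC₁) (hTp none))
      have h2 := toFrac_ne_zero.2 (notMem_of_eval_ne_zero ((Γ₁.pt none).incl hC₁) (hTp' none))
      have h3 := toFrac_ne_zero.2 (notMem_of_eval_ne_zero ((Γ₁.pt o).incl hC₁) (hTp' o))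
      rw [unitVal_div, h.surfaceEq_of_mem hA (p := (Γ₁.pt o).incl hC₁) (ht o) (hl o),
        h.surfaceEq_of_mem hA (p := (Γ₁.pt none).incl hC₁) (ht none) (hl none)]
      simp only [frac_def, map_mul]
      change _ / (_ * V.toFrac ((Γ₁.pt o).1.twistDen n)) /
        (_ * V.toFrac ((Γ₁.pt none).1.twistNum n) / (_ * V.toFrac ((Γ₁.pt none).1.twistDen n))) = _
      field_simp
      rfl
  -- `A` vanishes on the conic, so the equation of the surface at the points of the conic is
  -- `x_t / B`, which does not vanish identically on the conic.
  · refine degree_nonneg hC₂ (cartier_mono hr₂ (h.surfaceEq_mem_cartier hA)) fun o => ?_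
    by_cases hD : ((Γ₂.pt o).incl hC₂).1.coords (Sum.inr t) = 0 ∧
      ((Γ₂.pt o).incl hC₂).1.coords (Sum.inr l) = 0
    · have hBp := (h.ne_zero_or_ne_zero (hr₂ ⟨o, rfl⟩) hD.1 hD.2).resolve_left
        fun h0 => h0 ((Γ₂.pt o).2 A hAΓ)
      set n := d + W.a t + W.a l
      have hTp := Point.eval_twistNum_ne_zero n (Γ₂.pt o).1
      refine ⟨_, _, _, IsBihom.congr (IsWeightedHomogeneous.mul (isBihom_X _)
        (Point.isBihom_twistNum n (h.b_inrIndex hD.1))) h.wt_add',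
        h.isBihom_snd.mul (Point.isBihom_twistDen n _),
        mul_notMem htΓ (notMem_of_eval_ne_zero (Γ₂.pt o) hTp), ?_,
        h.surfaceEq_of_mem' hA (notMem_of_eval_ne_zero _ hBp) hD.1 hD.2⟩
      rw [map_mul]
      exact mul_ne_zero hBp (Point.eval_twistDen_ne_zero n (Γ₂.pt o).1)
    · refine ⟨0, 1, 1, isWeightedHomogeneous_one _ _, isWeightedHomogeneous_one _ _,
        fun h1 => Γ₂.toSubvariety.prime.ne_top ((Ideal.eq_top_iff_one _).2 h1), by simp, ?_⟩
      rw [h.surfaceEq_of_notMem hA hD, map_one, frac_def, map_one, div_one]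

instance Subvariety.commGroupCartierQuotient {V : W.Subvariety} {U : Set V.Pt}
    (N : Subgroup (V.cartier U)) : CommGroup (V.cartier U ⧸ N) :=
  QuotientGroup.Quotient.commGroup N

/-- The divisor `𝒪(1,0)`, the divisor `𝒪(0,2)` and a divisor whose intersection numbers with curves
in the nonsingular locus are those of a positive multiple of the surface `x_t = x_l = 0` are
independent. -/
theorem Subvariety.IsHypersurface.three_le_rank {V : W.Subvariety} {t l : Fin 4} {d : ℤ}
    {A B : Cox} {τ : ℂ} (h : V.IsHypersurface t l d A B) (hA : A ∉ V.ideal)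
    (hsing : (V.regularLocusᶜ).Finite) (hτ : V.IsSmoothFibre τ) {U : Set V.Pt}
    (hU : V.regularLocus ⊆ U) (N : Subgroup (V.cartier U))
    (hN : ∀ (Γ : RatCurve W) (hC : V.ideal ≤ Γ.toSubvariety.ideal) (hΓ : Γ.points hC ⊆ U),
      N ≤ (Γ.degreeHom hC hΓ).ker)
    {φ : V.Pt → (V.functionField)ˣ} (hφ : φ ∈ V.cartier U) {m : ℕ} (hm : 0 < m)
    (hdeg : ∀ (Γ : RatCurve W) (hC : V.ideal ≤ Γ.toSubvariety.ideal),
      Γ.points hC ⊆ V.regularLocus → Γ.degree hC φ = m * Γ.degree hC (h.surfaceEq hA)) :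
    3 ≤ Module.rank ℤ (Additive (V.cartier U ⧸ N)) := by
  obtain ⟨Γ₁, Γ₂, Γ₃, hC₁, hC₂, hC₃, hr₁, hr₂, hr₃, d₁, d₂, d₃, hneg, hnn⟩ :=
    h.exists_curves hA hsing hτ
  obtain ⟨e₁, he₁, hd₁⟩ := V.exists_cartier_degree_eq (isBihom_X (Sum.inl 0)) (h.X_notMem _)
    fun p => ⟨_, isBihom_X (Sum.inl p.1.inlIndex), by simpa using p.1.inlIndex_spec⟩
  have hpow : ∀ i j, W.IsBihom (W.xhat j i ^ (2 / W.b i)) (0, 2) := by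
    intro i j
    refine IsBihom.congr ((isBihom_xhat j i).pow _) ?_
    rw [h.frame.b_eq]
    split_ifs <;> simp
  obtain ⟨e₂, he₂, hd₂⟩ := V.exists_cartier_degree_eq (hpow 0 0)
    (fun hmem => (V.prime.mem_or_mem (V.prime.mem_of_pow_mem _ hmem)).elim (h.X_notMem _)
      fun h0 => h.X_notMem _ (V.prime.mem_of_pow_mem _ h0))
    fun p => ⟨_, hpow p.1.inrIndex p.1.inlIndex, by
      rw [map_pow]
      exact pow_ne_zero _ p.1.eval_xhat_ne_zero⟩
  have hm' : (0 : ℤ) < m := by exact_mod_cast hm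
  have hu : V.cartier Set.univ ≤ V.cartier U := cartier_mono (Set.subset_univ U)
  refine three_le_rank_of_homs N (Γ₁.degreeHom hC₁ (hr₁.trans hU)) (Γ₂.degreeHom hC₂ (hr₂.trans hU))
    (Γ₃.degreeHom hC₃ (hr₃.trans hU)) (hN _ _ _) (hN _ _ _) (hN _ _ _)
    ⟨e₁, hu he₁⟩ ⟨e₂, hu he₂⟩ ⟨φ, hφ⟩ ?_ ?_ ?_ ?_ ?_ ?_ ?_ <;> rw [toAdd_degreeHom]
  · rw [hd₁, d₁]
    rfl
  · rw [hd₂, d₁]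
    decide
  · rw [hdeg _ _ hr₁]
    exact mul_neg_of_pos_of_neg hm' hneg
  · rw [hd₁, d₂]
    rfl
  · rw [hd₂, d₂]
    decide
  · rw [hdeg _ _ hr₂]
    exact mul_nonneg hm'.le hnn
  · rw [hd₁]
    change Γ₃.deg (1, 0) ≠ 0
    rw [d₃]
    exact one_ne_zero

/-- If `m` times the surface is Cartier, its intersection numbers with curves in the nonsingular
locus are determined by the local equations of the surface there. -/
theorem Subvariety.IsHypersurface.degree_eq_mul {V : W.Subvariety} {t l : Fin 4} {d : ℤ} {A B : Cox}
    (h : V.IsHypersurface t l d A B) (hA : A ∉ V.ideal) {m : ℕ} {φ : V.Pt → (V.functionField)ˣ}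
    (hφ : φ ∈ V.cartier Set.univ)
    (hz : ∀ p ∈ V.regularLocus, ∃ z : V.localRing p, (z : V.Frac) = unitVal (φ p) ∧
      V.idealAt (Ideal.span {X (Sum.inr t), X (Sum.inr l)}) p ^ m = Ideal.span {z})
    (Γ : RatCurve W) (hC : V.ideal ≤ Γ.toSubvariety.ideal) (hr : Γ.points hC ⊆ V.regularLocus) :
    Γ.degree hC φ = m * Γ.degree hC (h.surfaceEq hA) := by
  have hψ := cartier_mono hr (h.surfaceEq_mem_cartier hA)
  have hφ := cartier_mono (Set.subset_univ (Γ.points hC)) hφ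
  set ψ := h.surfaceEq hA
  have hdiv : φ / ψ ^ m ∈ V.principal (Γ.points hC) := by
    refine ⟨1, fun p hp => ?_⟩
    obtain ⟨z, hz, hzI⟩ := hz p (hr hp)
    obtain ⟨w, hw, hwI⟩ := h.idealAt_surface hA (hr hp)
    rw [hwI, Ideal.span_singleton_pow, Ideal.span_singleton_eq_span_singleton] at hzI
    obtain ⟨u, hu⟩ := hzI
    have hψ0 := unitVal_ne_zero (ψ p)
    have hval : unitVal ((φ / ψ ^ m) p / 1) = ((u : V.localRing p) : V.Frac) := by
      rw [div_one, Pi.div_apply, Pi.pow_apply, unitVal_div, map_pow, ← hz, ← hu,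
        div_eq_iff (pow_ne_zero _ hψ0), ← hw]
      push_cast
      ring
    refine isUnitAt_def.2 ⟨hval ▸ (u : V.localRing p).2, ?_⟩
    have hinv : ((u : V.localRing p) : V.Frac)⁻¹ = ((u⁻¹ : (V.localRing p)ˣ) : V.localRing p) := by
      refine inv_eq_of_mul_eq_one_right ?_
      exact congrArg Subtype.val u.mul_inv
    rw [unitVal_inv, hval, hinv]
    exact ((u⁻¹ : (V.localRing p)ˣ) : V.localRing p).2
  have hcart : φ / ψ ^ m ∈ V.cartier (Γ.points hC) :=
    (V.cartier (Γ.points hC)).div_mem hφ ((V.cartier (Γ.points hC)).pow_mem hψ m)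
  have hpow : Γ.degree hC (ψ ^ m) = m * Γ.degree hC ψ := by
    have h3 := congrArg Multiplicative.toAdd
      (map_pow (Γ.degreeHom hC (U := Γ.points hC) subset_rfl) ⟨ψ, hψ⟩ m)
    rw [toAdd_pow, toAdd_degreeHom, toAdd_degreeHom, nsmul_eq_mul] at h3
    exact h3
  have h1 := degree_mul hC ((V.cartier (Γ.points hC)).pow_mem hψ m) hcart
  rwa [mul_div_cancel, degree_eq_zero_of_principal hC hcart hdiv, add_zero, hpow] at h1

end ScrollData

open ScrollData Subvariety in
theorem mainTheorem11 (W : ScrollData) (ω : ℤ) (F f g : Cox)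
    (hF : W.IsBihom F (ω, 4)) (hirr : Irreducible F)
    (hfg : F = X (Sum.inr 2) * f - X (Sum.inr 3) * g)
    (V : W.Subvariety) (hV : V.ideal = Ideal.span {F})
    (hsing : (V.regularLocusᶜ).Finite) :
    (V.IsQCartier (Ideal.span {X (Sum.inr 2), X (Sum.inr 3)}) → 3 ≤ V.picardNumber) ∧
      3 ≤ Module.rank ℤ (Additive (V.Pic V.regularLocus)) := by
  obtain ⟨τ, hτ⟩ := exists_isSmoothFibre hsing
  have hmem : F ∈ Ideal.span {(X (Sum.inr 2) : Cox), X (Sum.inr 3)} :=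
    Ideal.mem_span_pair.2 ⟨f, -g, by rw [hfg]; ring⟩
  obtain ⟨t, l, hframe, htl⟩ := exists_isFrame hF ⟨2, rfl⟩ hV hτ hmem
  have hJ : ({X (Sum.inr t), X (Sum.inr l)} : Set Cox) = {X (Sum.inr 2), X (Sum.inr 3)} := by
    rcases htl with ⟨rfl, rfl⟩ | ⟨rfl, rfl⟩
    exacts [rfl, Set.pair_comm _ _]
  rw [← hJ] at hmem ⊢
  obtain ⟨A, B, hA, hB, rfl⟩ := exists_bihom_of_mem_span_pair hF hmem
  have h : V.IsHypersurface t l ω A (-B) := by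
    refine ⟨hframe, ?_, hA, IsWeightedHomogeneous.neg hB, ?_, ?_⟩ <;> rw [mul_neg, sub_neg_eq_add]
    exacts [hF, hirr.ne_zero, hV]
  have hAV := h.fst_notMem hτ
  refine ⟨fun ⟨m, hm, φ, hφ, hz⟩ => ?_, ?_⟩
  · exact h.three_le_rank hAV hsing hτ (Set.subset_univ _) _
      (fun Γ hC _ => Γ.closure_numTrivial_le_ker_degreeHom hC) hφ hm
      (h.degree_eq_mul hAV hφ hz)
  · exact h.three_le_rank hAV hsing hτ subset_rfl _
      (fun Γ hC hΓ => Γ.principal_le_ker_degreeHom hC hΓ) (h.surfaceEq_mem_cartier hAV) one_pos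
      fun _ _ _ => by rw [Nat.cast_one, one_mul]

end
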